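/- **Setting.** Let $(\mathcal M,\otimes,\mathbf 1)$ be a monoidal category, or a symmetric monoidal category with commutativity constraint $C$; let $(\mathcal E,\otimes,\mathbb 1)$ be a symmetric monoidal category that has coproducts indexed by the sets $\mathrm{Hom}_{\mathcal M}(X,Y)$, preserved by every $A\otimes -$. For a set $J$ write $J\odot\mathcal E=\coprod_J\mathbb 1$. For isomorphisms $\sigma:X\to X'$, $\tau:Y\to Y'$ and morphisms $\phi:X\to Y$, $\phi':X'\to Y'$ with $\phi'\sigma=\tau\phi$ write $(\sigma\Downarrow\tau):\phi\to\phi'$ for the corresponding isomorphism of arrows. **The category $\mathcal M^{loc+}$.** $\mathcal M^{nc+}$ is the symmetric monoidal category, with product $\boxtimes$, presented as follows. Its objects are the bracketed words $\phi_1\boxtimes\dots\boxtimes\phi_n$ in the morphisms of $\mathcal M$. Its generating morphisms are the isomorphisms of arrows $(\sigma\Downarrow\tau)$, the morphisms $\gamma_{\psi,\phi}:\psi\boxtimes\phi\to\psi\circ\phi$ for composable $\psi,\phi$, and the morphisms $\mu_{\phi,\psi}:\phi\boxtimes\psi\to\phi\otimes\psi$. The relations are: the isomorphisms of arrows compose as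 in $\mathcal M$; $\gamma$ is equivariant, $\gamma\circ((\tau\Downarrow\upsilon)\boxtimes(\sigma\Downarrow\tau))=(\sigma\Downarrow\upsilon)\circ\gamma$, and associative; $\mu$ is equivariant, $\mu\circ((\sigma_1\Downarrow\tau_1)\boxtimes(\sigma_2\Downarrow\tau_2))=(\sigma_1\otimes\sigma_2\Downarrow\tau_1\otimes\tau_2)\circ\mu$, and associative (up to the associators of $\mathcal M$); interchange holds, $\mu\circ(\gamma\boxtimes\gamma)=\gamma\circ(\mu\boxtimes\mu)\circ\tau_{23}$, as morphisms $\psi\boxtimes\phi\boxtimes\psi'\boxtimes\phi'\to(\psi\circ\phi)\otimes(\psi'\circ\phi')=(\psi\otimes\psi')\circ(\phi\otimes\phi')$, where $\tau_{23}$ exchanges the two middle factors; and, if $\mathcal M$ is symmetric, $(C\Downarrow C)\circ\mu_{\phi,\psi}=\mu_{\psi,\phi}\circ\tau$ with $\tau$ the symmetry of $\boxtimes$. The localized plus construction $\mathcal M^{loc+}=\mathcal M^{nc+}[\mu^{-1}]$ is obtained by adjoining generators $\mu_{\phi,\psi}^{-1}:\phi\otimes\psi\to\phi\boxtimes\psi$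 with $\mu\mu^{-1}=\mathrm{id}$, $\mu^{-1}\mu=\mathrm{id}$. **Functors.** $[\mathcal M^{loc+},\mathcal E]_\otimes$ is the category of strong symmetric monoidal functors and monoidal natural transformations. A *counital* functor is one equipped with a monoidal natural transformation to the trivial functor (with constant value $\mathbb 1$); morphisms respect the counits. **Bimodule monoids.** A lax monoidal bimodule monoid is a functor $\rho:\mathrm{Iso}(\mathcal M)^{op}\times\mathrm{Iso}(\mathcal M)\to\mathcal E$ with an associative (not necessarily unital) multiplication $\gamma:\rho(Y,Z)\otimes\rho(X,Y)\to\rho(X,Z)$, natural in $X,Z$ and dinatural in $Y$, and an associative natural product $\mu:\rho(X,Y)\otimes\rho(X',Y')\to\rho(X\otimes X',Y\otimes Y')$ satisfying interchange with $\gamma$. In the symmetric case $\mu$ is moreover compatible with the commutativity constraints. It is *over $\mathrm{Hom}_{\mathcal M}$* if it comes with a morphism $b$ of such structures to $(X,Y)\mapsto\mathrm{Hom}_{\mathcal M}(X,Y)\odot\mathcal E$ and a decomposition $\rho(X,Y)=\coprod_{\phi:X\to Y}\mathcal D(\phi)$ respecting all the structure, that is: $b=\coprod_\phi\epsilon_\phi$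 with $\epsilon_\phi:\mathcal D(\phi)\to\mathbb 1$, and the actions of isomorphisms, $\gamma$ and $\mu$ are induced by associative and equivariant maps $\mathcal D(\phi)\to\mathcal D(\phi')$ for each $(\sigma\Downarrow\tau):\phi\to\phi'$, $\gamma_{\psi,\phi}:\mathcal D(\psi)\otimes\mathcal D(\phi)\to\mathcal D(\psi\circ\phi)$, $\mu_{\phi,\psi}:\mathcal D(\phi)\otimes\mathcal D(\psi)\to\mathcal D(\phi\otimes\psi)$ that satisfy interchange (and symmetry) and are compatible with the $\epsilon_\phi$. Morphisms respect all of this. In the non-Cartesian case these are called *counital*, the counits being the $\epsilon_\phi$; if $\mathcal E$ is Cartesian, the $\epsilon_\phi$ carry no information. It is *strong* (over $\mathrm{Hom}_{\mathcal M}$) if all $\mu_{\phi,\psi}:\mathcal D(\phi)\otimes\mathcal D(\psi)\to\mathcal D(\phi\otimes\psi)$ are isomorphisms. **Splittings.** An element of $\mathcal D(\phi)$ is a morphism $\mathbb 1\to\mathcal D(\phi)$. For an isomorphism $\sigma:X\to Y$ an element of $\mathcal D(\sigma)$ is invertible if there is an element of $\mathcal D(\sigma^{-1})$ such that both products are two-sided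 units for $\gamma$, at $X$ and at $Y$. A functor (then $\mathcal D(\phi)$ is its value at $\phi$) is *split*, and a bimodule monoid over $\mathrm{Hom}_{\mathcal M}$ is *isomorphism split*, if there are sets $\mathcal D_I(\sigma)$ of invertible elements of $\mathcal D(\sigma)$ and decompositions $\mathcal D(\sigma)=(\mathcal D_I(\sigma)\odot\mathcal E)\amalg\mathcal D^{red}(\sigma)$, for all isomorphisms $\sigma$, such that every invertible element of $\mathcal D(\sigma)$ factors through the first summand, products of elements of the $\mathcal D_I$ lie in the $\mathcal D_I$, and left and right multiplication by an element of $\mathcal D_I(\tau)$ is a bijection $\mathcal D_I(\sigma)\to\mathcal D_I(\tau\sigma)$, resp. $\mathcal D_I(\sigma)\to\mathcal D_I(\sigma\tau)$. **Theorem 3.6.** 1. The category of counital strong symmetric monoidal functors $\mathcal M^{loc+}\to\mathcal E$ is equivalent to the category of counital strong monoidal bimodule monoids over $\mathrm{Hom}_{\mathcal M}$ (symmetric ones, if $\mathcal M$ is symmetric). The equivalence takes $\mathcal D$, naturally in $\mathcal D$, to $\rho(X,Y)=\coprod_{\phi:X\to Y}\mathcal D(\phi)$ with the structure maps induced by the actions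 of the isomorphisms $(\sigma\Downarrow\tau)$, by $\gamma$, by $\mu$ and by the counit; and $\mathcal D$ is split if and only if the corresponding $\rho$ is isomorphism split. 2. If $\mathcal E$ is Cartesian, the category $[\mathcal M^{loc+},\mathcal E]_\otimes$ of all strong symmetric monoidal functors is equivalent, by the same construction, to the category of strong monoidal bimodule monoids over $\mathrm{Hom}_{\mathcal M}$ (symmetric ones, if $\mathcal M$ is symmetric). If moreover the coproducts indexed by the sets $\mathrm{Hom}_{\mathcal M}(X,Y)$ are extensive (pull-backs along coproduct inclusions exist and the coproducts are van Kampen, as in $\mathcal Set$), it is compatibly equivalent to the category of those lax monoidal bimodule monoids $\rho$ with a morphism $b$ to $\mathrm{Hom}_{\mathcal M}(-,-)\odot\mathcal E$ (no decomposition being given) that are strong over $\mathrm{Hom}_{\mathcal M}$: $\mu$ exhibits $\rho(X,Y)\otimes\rho(X',Y')$ as the pull-back of $\rho(X\otimes X',Y\otimes Y')$ along the map $(\phi,\psi)\mapsto\phi\otimes\psi$ of the $\mathrm{Hom}_{\mathcal M}\odot\mathcal E$ (and $\mu$ is symmetric, if $\mathcal M$ is). -/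

import Mathlib

open CategoryTheory MonoidalCategory Limits

universe w v₁ u₁ v₂ u₂ v₃ u₃

namespace PlusConstruction

/-! ## Symmetric monoidal categories given by generators and relations -/

section Presentations

variable {O : Type u₁}

/-- Bracketed words in the letters `O`: the objects of a free (symmetric) monoidal category. -/
inductive Word (O : Type u₁) : Type u₁
  | of : O → Word O
  | unit : Word O
  | tensor : Word O → Word O → Word O

/-- Formal morphisms: formal composites and products of identities, associators, unitors,
symmetries and of the generators `G`. -/
inductive Term (G : Word O → Word O → Type w) : Word O → Word O → Type (max u₁ w)
  | gen {X Y : Word O} (g : G X Y) : Term G X Y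
  | id (X : Word O) : Term G X X
  | α_hom (X Y Z : Word O) : Term G ((X.tensor Y).tensor Z) (X.tensor (Y.tensor Z))
  | α_inv (X Y Z : Word O) : Term G (X.tensor (Y.tensor Z)) ((X.tensor Y).tensor Z)
  | l_hom (X : Word O) : Term G (Word.unit.tensor X) X
  | l_inv (X : Word O) : Term G X (Word.unit.tensor X)
  | ρ_hom (X : Word O) : Term G (X.tensor Word.unit) X
  | ρ_inv (X : Word O) : Term G X (X.tensor Word.unit)
  | swap (X Y : Word O) : Term G (X.tensor Y) (Y.tensor X)
  | comp {X Y Z : Word O} (f : Term G X Y) (g : Term G Y Z) : Term G X Z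
  | whiskerLeft (X : Word O) {Y₁ Y₂ : Word O} (f : Term G Y₁ Y₂) : Term G (X.tensor Y₁) (X.tensor Y₂)
  | whiskerRight {X₁ X₂ : Word O} (f : Term G X₁ X₂) (Y : Word O) : Term G (X₁.tensor Y) (X₂.tensor Y)
  | tensor {W X Y Z : Word O} (f : Term G W Y) (g : Term G X Z) : Term G (W.tensor X) (Y.tensor Z)

/-- The exchange of the two middle factors. -/
def Term.middleSwap {G : Word O → Word O → Type w} (A B C D : Word O) :
    Term G ((A.tensor B).tensor (C.tensor D)) ((A.tensor C).tensor (B.tensor D)) :=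
  (Term.α_hom A B (C.tensor D)).comp
    ((Term.whiskerLeft A ((Term.α_inv B C D).comp
      ((Term.whiskerRight (Term.swap B C) D).comp (Term.α_hom C B D)))).comp
        (Term.α_inv A C (B.tensor D)))

/-- A set of relations between parallel formal morphisms. -/
abbrev Relations (G : Word O → Word O → Type w) :=
  ∀ ⦃X Y : Word O⦄, Term G X Y → Term G X Y → Prop

/-- The smallest congruence that contains the relations `R` and the axioms of a symmetric
monoidal category. -/
inductive Eqv {G : Word O → Word O → Type w} (R : Relations G) :
    ∀ {X Y : Word O}, Term G X Y → Term G X Y → Prop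
  | rel {X Y : Word O} {f g : Term G X Y} : R f g → Eqv R f g
  | refl {X Y : Word O} (f : Term G X Y) : Eqv R f f
  | symm {X Y : Word O} {f g : Term G X Y} : Eqv R f g → Eqv R g f
  | trans {X Y : Word O} {f g h : Term G X Y} : Eqv R f g → Eqv R g h → Eqv R f h
  | comp {X Y Z : Word O} {f f' : Term G X Y} {g g' : Term G Y Z} :
      Eqv R f f' → Eqv R g g' → Eqv R (f.comp g) (f'.comp g')
  | whiskerLeft (X : Word O) {Y Z : Word O} {f f' : Term G Y Z} :
      Eqv R f f' → Eqv R (f.whiskerLeft X) (f'.whiskerLeft X)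
  | whiskerRight {Y Z : Word O} {f f' : Term G Y Z} (X : Word O) :
      Eqv R f f' → Eqv R (f.whiskerRight X) (f'.whiskerRight X)
  | tensor {W X Y Z : Word O} {f f' : Term G W X} {g g' : Term G Y Z} :
      Eqv R f f' → Eqv R g g' → Eqv R (f.tensor g) (f'.tensor g')
  | comp_id {X Y : Word O} (f : Term G X Y) : Eqv R (f.comp (Term.id _)) f
  | id_comp {X Y : Word O} (f : Term G X Y) : Eqv R ((Term.id _).comp f) f
  | assoc {X Y Z W : Word O} (f : Term G X Y) (g : Term G Y Z) (h : Term G Z W) :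
      Eqv R ((f.comp g).comp h) (f.comp (g.comp h))
  | tensorHom_def {X₁ Y₁ X₂ Y₂ : Word O} (f : Term G X₁ Y₁) (g : Term G X₂ Y₂) :
      Eqv R (f.tensor g) ((f.whiskerRight X₂).comp (g.whiskerLeft Y₁))
  | id_tensorHom_id (X Y : Word O) : Eqv R ((Term.id X).tensor (Term.id Y)) (Term.id _)
  | tensorHom_comp_tensorHom {X₁ Y₁ Z₁ X₂ Y₂ Z₂ : Word O} (f₁ : Term G X₁ Y₁) (f₂ : Term G X₂ Y₂)
      (g₁ : Term G Y₁ Z₁) (g₂ : Term G Y₂ Z₂) :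
      Eqv R ((f₁.tensor f₂).comp (g₁.tensor g₂)) ((f₁.comp g₁).tensor (f₂.comp g₂))
  | whiskerLeft_id (X Y : Word O) : Eqv R ((Term.id Y).whiskerLeft X) (Term.id (X.tensor Y))
  | id_whiskerRight (X Y : Word O) : Eqv R ((Term.id X).whiskerRight Y) (Term.id (X.tensor Y))
  | α_hom_inv (X Y Z : Word O) : Eqv R ((Term.α_hom X Y Z).comp (Term.α_inv X Y Z)) (Term.id _)
  | α_inv_hom (X Y Z : Word O) : Eqv R ((Term.α_inv X Y Z).comp (Term.α_hom X Y Z)) (Term.id _)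
  | associator_naturality {X₁ X₂ X₃ Y₁ Y₂ Y₃ : Word O}
      (f₁ : Term G X₁ Y₁) (f₂ : Term G X₂ Y₂) (f₃ : Term G X₃ Y₃) :
      Eqv R (((f₁.tensor f₂).tensor f₃).comp (Term.α_hom Y₁ Y₂ Y₃))
        ((Term.α_hom X₁ X₂ X₃).comp (f₁.tensor (f₂.tensor f₃)))
  | ρ_hom_inv (X : Word O) : Eqv R ((Term.ρ_hom X).comp (Term.ρ_inv X)) (Term.id _)
  | ρ_inv_hom (X : Word O) : Eqv R ((Term.ρ_inv X).comp (Term.ρ_hom X)) (Term.id _)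
  | ρ_naturality {X Y : Word O} (f : Term G X Y) :
      Eqv R ((f.whiskerRight Word.unit).comp (Term.ρ_hom Y)) ((Term.ρ_hom X).comp f)
  | l_hom_inv (X : Word O) : Eqv R ((Term.l_hom X).comp (Term.l_inv X)) (Term.id _)
  | l_inv_hom (X : Word O) : Eqv R ((Term.l_inv X).comp (Term.l_hom X)) (Term.id _)
  | l_naturality {X Y : Word O} (f : Term G X Y) :
      Eqv R ((f.whiskerLeft Word.unit).comp (Term.l_hom Y)) ((Term.l_hom X).comp f)
  | pentagon (W X Y Z : Word O) :
      Eqv R (((Term.α_hom W X Y).whiskerRight Z).comp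
          ((Term.α_hom W (X.tensor Y) Z).comp ((Term.α_hom X Y Z).whiskerLeft W)))
        ((Term.α_hom (W.tensor X) Y Z).comp (Term.α_hom W X (Y.tensor Z)))
  | triangle (X Y : Word O) :
      Eqv R ((Term.α_hom X Word.unit Y).comp ((Term.l_hom Y).whiskerLeft X))
        ((Term.ρ_hom X).whiskerRight Y)
  | swap_naturality_right (X : Word O) {Y Z : Word O} (f : Term G Y Z) :
      Eqv R ((f.whiskerLeft X).comp (Term.swap X Z)) ((Term.swap X Y).comp (f.whiskerRight X))
  | swap_naturality_left {X Y : Word O} (f : Term G X Y) (Z : Word O) :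
      Eqv R ((f.whiskerRight Z).comp (Term.swap Y Z)) ((Term.swap X Z).comp (f.whiskerLeft Z))
  | hexagon_forward (X Y Z : Word O) :
      Eqv R ((Term.α_hom X Y Z).comp ((Term.swap X (Y.tensor Z)).comp (Term.α_hom Y Z X)))
        (((Term.swap X Y).whiskerRight Z).comp
          ((Term.α_hom Y X Z).comp ((Term.swap X Z).whiskerLeft Y)))
  | hexagon_reverse (X Y Z : Word O) :
      Eqv R ((Term.α_inv X Y Z).comp ((Term.swap (X.tensor Y) Z).comp (Term.α_inv Z X Y)))
        (((Term.swap Y Z).whiskerLeft X).comp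
          ((Term.α_inv X Z Y).comp ((Term.swap X Z).whiskerRight Y)))
  | symmetry (X Y : Word O) : Eqv R ((Term.swap X Y).comp (Term.swap Y X)) (Term.id _)

/-- The symmetric monoidal category presented by the generators `G` and the relations `R`. -/
def Presented {G : Word O → Word O → Type w} (_R : Relations G) : Type u₁ := Word O

namespace Presented

variable {G : Word O → Word O → Type w} (R : Relations G)

/-- Equality of morphisms in the presented category. -/
abbrev setoidHom (X Y : Word O) : Setoid (Term G X Y) :=
  ⟨Eqv R, ⟨Eqv.refl, Eqv.symm, Eqv.trans⟩⟩

instance : Category.{max u₁ w} (Presented R) where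
  Hom X Y := Quotient (setoidHom R X Y)
  id X := Quotient.mk (setoidHom R X X) (Term.id X)
  comp := Quotient.map₂ Term.comp (fun _ _ hf _ _ hg => Eqv.comp hf hg)
  id_comp := by rintro X Y ⟨f⟩; exact Quotient.sound (Eqv.id_comp f)
  comp_id := by rintro X Y ⟨f⟩; exact Quotient.sound (Eqv.comp_id f)
  assoc := by rintro W X Y Z ⟨f⟩ ⟨g⟩ ⟨h⟩; exact Quotient.sound (Eqv.assoc f g h)

variable {R}

/-- The object given by a word. -/
def obj (X : Word O) : Presented R := X

/-- The morphism represented by a formal morphism. -/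
def homMk {X Y : Word O} (f : Term G X Y) : (obj X : Presented R) ⟶ obj Y :=
  Quotient.mk (setoidHom R X Y) f

instance : MonoidalCategory (Presented R) where
  tensorObj X Y := Word.tensor X Y
  tensorHom := Quotient.map₂ Term.tensor (fun _ _ hf _ _ hg => Eqv.tensor hf hg)
  whiskerLeft X _ _ f := Quotient.map (fun f => Term.whiskerLeft X f)
    (fun _ _ h => Eqv.whiskerLeft X h) f
  whiskerRight f Y := Quotient.map (fun f => Term.whiskerRight f Y)
    (fun _ _ h => Eqv.whiskerRight Y h) f
  tensorHom_def := by rintro _ _ _ _ ⟨f⟩ ⟨g⟩; exact Quotient.sound (Eqv.tensorHom_def f g)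
  id_tensorHom_id X Y := Quotient.sound (Eqv.id_tensorHom_id X Y)
  tensorHom_comp_tensorHom := by
    rintro _ _ _ _ _ _ ⟨f₁⟩ ⟨f₂⟩ ⟨g₁⟩ ⟨g₂⟩
    exact Quotient.sound (Eqv.tensorHom_comp_tensorHom f₁ f₂ g₁ g₂)
  whiskerLeft_id X Y := Quotient.sound (Eqv.whiskerLeft_id X Y)
  id_whiskerRight X Y := Quotient.sound (Eqv.id_whiskerRight X Y)
  tensorUnit := Word.unit
  associator X Y Z :=
    { hom := homMk (Term.α_hom X Y Z), inv := homMk (Term.α_inv X Y Z)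
      hom_inv_id := Quotient.sound (Eqv.α_hom_inv X Y Z)
      inv_hom_id := Quotient.sound (Eqv.α_inv_hom X Y Z) }
  associator_naturality := by
    rintro _ _ _ _ _ _ ⟨f₁⟩ ⟨f₂⟩ ⟨f₃⟩
    exact Quotient.sound (Eqv.associator_naturality f₁ f₂ f₃)
  leftUnitor X :=
    { hom := homMk (Term.l_hom X), inv := homMk (Term.l_inv X)
      hom_inv_id := Quotient.sound (Eqv.l_hom_inv X)
      inv_hom_id := Quotient.sound (Eqv.l_inv_hom X) }
  leftUnitor_naturality := by rintro _ _ ⟨f⟩; exact Quotient.sound (Eqv.l_naturality f)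
  rightUnitor X :=
    { hom := homMk (Term.ρ_hom X), inv := homMk (Term.ρ_inv X)
      hom_inv_id := Quotient.sound (Eqv.ρ_hom_inv X)
      inv_hom_id := Quotient.sound (Eqv.ρ_inv_hom X) }
  rightUnitor_naturality := by rintro _ _ ⟨f⟩; exact Quotient.sound (Eqv.ρ_naturality f)
  pentagon W X Y Z := Quotient.sound (Eqv.pentagon W X Y Z)
  triangle X Y := Quotient.sound (Eqv.triangle X Y)

instance : SymmetricCategory (Presented R) where
  braiding X Y :=
    { hom := homMk (Term.swap X Y), inv := homMk (Term.swap Y X)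
      hom_inv_id := Quotient.sound (Eqv.symmetry X Y)
      inv_hom_id := Quotient.sound (Eqv.symmetry Y X) }
  braiding_naturality_right := by
    rintro X _ _ ⟨f⟩; exact Quotient.sound (Eqv.swap_naturality_right X f)
  braiding_naturality_left := by
    rintro _ _ ⟨f⟩ Z; exact Quotient.sound (Eqv.swap_naturality_left f Z)
  hexagon_forward X Y Z := Quotient.sound (Eqv.hexagon_forward X Y Z)
  hexagon_reverse X Y Z := Quotient.sound (Eqv.hexagon_reverse X Y Z)
  symmetry X Y := Quotient.sound (Eqv.symmetry X Y)

end Presented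

end Presentations

/-! ## The groupoid of arrows of a monoidal category -/

section Arrows

variable {M : Type u₁} [Category.{v₁} M]

/-- The isomorphism of arrows `(σ ⇓ τ) : f ⟶ f'` given by a commutative square. -/
abbrev sq {X Y X' Y' : M} (f : X ⟶ Y) (f' : X' ⟶ Y') (σ : X ≅ X') (τ : Y ≅ Y')
    (h : σ.hom ≫ f' = f ≫ τ.hom) : Arrow.mk f ≅ Arrow.mk f' :=
  Arrow.isoMk σ τ h

/-- The isomorphism `(id ⇓ id)` between equal arrows. -/
abbrev sqEq {X Y : M} {f f' : X ⟶ Y} (h : f = f') : Arrow.mk f ≅ Arrow.mk f' :=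
  sq f f' (Iso.refl X) (Iso.refl Y) (by simp [h])

/-- The isomorphism of sources underlying an isomorphism of arrows. -/
abbrev srcIso {f g : Arrow M} (e : f ≅ g) : f.left ≅ g.left := Arrow.leftFunc.mapIso e

/-- The isomorphism of targets underlying an isomorphism of arrows. -/
abbrev tgtIso {f g : Arrow M} (e : f ≅ g) : f.right ≅ g.right := Arrow.rightFunc.mapIso e

variable [MonoidalCategory M]

/-- The tensor product of two arrows. -/
abbrev arrTensor (f g : Arrow M) : Arrow M := Arrow.mk (f.hom ⊗ₘ g.hom)

/-- `(σ₁ ⇓ τ₁) ⊗ (σ₂ ⇓ τ₂) = (σ₁ ⊗ σ₂ ⇓ τ₁ ⊗ τ₂)`. -/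
def arrTensorIso {f f' g g' : Arrow M} (e : f ≅ f') (e' : g ≅ g') :
    arrTensor f g ≅ arrTensor f' g' :=
  sq _ _ (srcIso e ⊗ᵢ srcIso e') (tgtIso e ⊗ᵢ tgtIso e') (by
    change (e.hom.left ⊗ₘ e'.hom.left) ≫ (f'.hom ⊗ₘ g'.hom) =
      (f.hom ⊗ₘ g.hom) ≫ (e.hom.right ⊗ₘ e'.hom.right)
    rw [tensorHom_comp_tensorHom, tensorHom_comp_tensorHom, Arrow.w, Arrow.w])

/-- The associativity constraint `(α ⇓ α)` of arrows. -/
def arrAssoc (f g h : Arrow M) :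
    arrTensor (arrTensor f g) h ≅ arrTensor f (arrTensor g h) :=
  sq _ _ (α_ _ _ _) (α_ _ _ _) (by simp)

/-- The commutativity constraint `(C ⇓ C)` of arrows for a symmetric structure `s`. -/
def arrBraiding (s : SymmetricCategory M) (f g : Arrow M) : arrTensor f g ≅ arrTensor g f :=
  sq _ _ (s.braiding _ _) (s.braiding _ _) (by simp)

/-- `(φ₁ ≫ φ₂) ⊗ (ψ₁ ≫ ψ₂) = (φ₁ ⊗ ψ₁) ≫ (φ₂ ⊗ ψ₂)`. -/
def arrInterchange {X Y Z X' Y' Z' : M} (f : X ⟶ Y) (g : Y ⟶ Z) (f' : X' ⟶ Y') (g' : Y' ⟶ Z') :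
    arrTensor (Arrow.mk (f ≫ g)) (Arrow.mk (f' ≫ g')) ≅
      Arrow.mk ((f ⊗ₘ f') ≫ (g ⊗ₘ g')) :=
  sqEq (by simp)

end Arrows

/-! ## The plus constructions

Throughout, `S : Option (SymmetricCategory M)` records whether `M` is regarded merely as a
monoidal category (`none`) or as a symmetric monoidal category (`some s`). -/

section Plus

variable (M : Type u₁) [Category.{v₁} M] [MonoidalCategory M]

/-- The generators of `M^{nc+}`: the isomorphisms of arrows, `γ_{g,f} : g ⊠ f ⟶ g ∘ f` for
composable pairs, and `μ_{f,g} : f ⊠ g ⟶ f ⊗ g`. -/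
inductive NcGen : Word (Arrow M) → Word (Arrow M) → Type (max u₁ v₁)
  | iso {f g : Arrow M} (e : f ≅ g) : NcGen (.of f) (.of g)
  | γ {X Y Z : M} (f : X ⟶ Y) (g : Y ⟶ Z) :
      NcGen ((Word.of (Arrow.mk g)).tensor (.of (Arrow.mk f))) (.of (Arrow.mk (f ≫ g)))
  | μ (f g : Arrow M) : NcGen ((Word.of f).tensor (.of g)) (.of (arrTensor f g))

/-- The generators of `M^{loc+}`: those of `M^{nc+}` and the inverses `μ⁻¹_{f,g}`. -/
inductive LocGen : Word (Arrow M) → Word (Arrow M) → Type (max u₁ v₁)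
  | nc {X Y} (g : NcGen M X Y) : LocGen X Y
  | μInv (f g : Arrow M) : LocGen (.of (arrTensor f g)) ((Word.of f).tensor (.of g))

variable {M}

/-- The relations of `M^{nc+}`, imposed on formal morphisms over any set of generators `G` that
contains those of `M^{nc+}` (by way of `j`). `iso_id`, `iso_comp` make the isomorphisms of arrows a
groupoid; `γ_equiv` is inner and outer equivariance in one equation. -/
inductive NcRel (S : Option (SymmetricCategory M))
    {G : Word (Arrow M) → Word (Arrow M) → Type (max u₁ v₁)}
    (j : ∀ {X Y}, NcGen M X Y → G X Y) : Relations G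
  | iso_id (f : Arrow M) : NcRel S j (.gen (j (.iso (Iso.refl f)))) (.id _)
  | iso_comp {f g h : Arrow M} (e : f ≅ g) (e' : g ≅ h) :
      NcRel S j (.gen (j (.iso (e ≪≫ e')))) ((Term.gen (j (.iso e))).comp (.gen (j (.iso e'))))
  | γ_equiv {X Y Z X' Y' Z' : M} (f : X ⟶ Y) (g : Y ⟶ Z) (f' : X' ⟶ Y') (g' : Y' ⟶ Z')
      (σ : X ≅ X') (τ : Y ≅ Y') (υ : Z ≅ Z')
      (hf : σ.hom ≫ f' = f ≫ τ.hom) (hg : τ.hom ≫ g' = g ≫ υ.hom) :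
      NcRel S j
        (((Term.gen (j (.iso (sq g g' τ υ hg)))).tensor
          (.gen (j (.iso (sq f f' σ τ hf))))).comp (.gen (j (.γ f' g'))))
        ((Term.gen (j (.γ f g))).comp
          (.gen (j (.iso (sq (f ≫ g) (f' ≫ g') σ υ (by rw [reassoc_of% hf, hg, Category.assoc]))))))
  | γ_assoc {X Y Z W : M} (f : X ⟶ Y) (g : Y ⟶ Z) (h : Z ⟶ W) :
      NcRel S j
        (((Term.gen (j (.γ g h))).whiskerRight _).comp (.gen (j (.γ f (g ≫ h)))))
        ((Term.α_hom _ _ _).comp (((Term.gen (j (.γ f g))).whiskerLeft _).comp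
          ((Term.gen (j (.γ (f ≫ g) h))).comp
            (.gen (j (.iso (sqEq (Category.assoc f g h))))))))
  | μ_equiv {f f' g g' : Arrow M} (e : f ≅ f') (e' : g ≅ g') :
      NcRel S j
        (((Term.gen (j (.iso e))).tensor (.gen (j (.iso e')))).comp (.gen (j (.μ f' g'))))
        ((Term.gen (j (.μ f g))).comp (.gen (j (.iso (arrTensorIso e e')))))
  | μ_assoc (f g h : Arrow M) :
      NcRel S j
        (((Term.gen (j (.μ f g))).whiskerRight _).comp
          ((Term.gen (j (.μ (arrTensor f g) h))).comp (.gen (j (.iso (arrAssoc f g h))))))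
        ((Term.α_hom _ _ _).comp (((Term.gen (j (.μ g h))).whiskerLeft _).comp
          (.gen (j (.μ f (arrTensor g h))))))
  | interchange {X Y Z X' Y' Z' : M}
      (f : X ⟶ Y) (g : Y ⟶ Z) (f' : X' ⟶ Y') (g' : Y' ⟶ Z') :
      NcRel S j
        ((Term.middleSwap (.of (Arrow.mk g)) (.of (Arrow.mk g'))
            (.of (Arrow.mk f)) (.of (Arrow.mk f'))).comp
          (((Term.gen (j (.γ f g))).tensor (.gen (j (.γ f' g')))).comp
            ((Term.gen (j (.μ (Arrow.mk (f ≫ g)) (Arrow.mk (f' ≫ g'))))).comp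
              (.gen (j (.iso (arrInterchange f g f' g')))))))
        (((Term.gen (j (.μ (Arrow.mk g) (Arrow.mk g')))).tensor
          (.gen (j (.μ (Arrow.mk f) (Arrow.mk f'))))).comp
            (.gen (j (.γ (f ⊗ₘ f') (g ⊗ₘ g')))))
  | commutator (s : SymmetricCategory M) (hs : S = some s) (f g : Arrow M) :
      NcRel S j
        ((Term.gen (j (.μ f g))).comp (.gen (j (.iso (arrBraiding s f g)))))
        ((Term.swap _ _).comp (.gen (j (.μ g f))))

/-- The relations of `M^{loc+}`. -/
inductive LocRel (S : Option (SymmetricCategory M)) : Relations (LocGen M)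
  | nc {X Y} {f g : Term (LocGen M) X Y} : NcRel S LocGen.nc f g → LocRel S f g
  | μ_inv (f g : Arrow M) :
      LocRel S ((Term.gen (.nc (.μ f g))).comp (.gen (.μInv f g))) (.id _)
  | inv_μ (f g : Arrow M) :
      LocRel S ((Term.gen (.μInv f g)).comp (.gen (.nc (.μ f g)))) (.id _)

/-- The plus construction `M^{nc+}`. -/
abbrev NcPlus (S : Option (SymmetricCategory M)) : Type (max u₁ v₁) :=
  Presented (NcRel S (G := NcGen M) (fun g => g))

/-- The localized plus construction `M^{loc+} = M^{nc+}[μ⁻¹]`. -/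
abbrev LocPlus (S : Option (SymmetricCategory M)) : Type (max u₁ v₁) := Presented (LocRel S)

namespace LocPlus

variable (S : Option (SymmetricCategory M))

/-- An arrow of `M` as an object of `M^{loc+}`. -/
def arr (f : Arrow M) : LocPlus S := Presented.obj (.of f)

/-- The isomorphism `(σ ⇓ τ)` in `M^{loc+}`. -/
def iso {f g : Arrow M} (e : f ≅ g) : arr S f ⟶ arr S g :=
  Presented.homMk (.gen (.nc (.iso e)))

/-- The generator `γ` in `M^{loc+}`. -/
def γ {X Y Z : M} (f : X ⟶ Y) (g : Y ⟶ Z) :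
    arr S (Arrow.mk g) ⊗ arr S (Arrow.mk f) ⟶ arr S (Arrow.mk (f ≫ g)) :=
  Presented.homMk (.gen (.nc (.γ f g)))

/-- The generator `μ` in `M^{loc+}`. -/
def μ (f g : Arrow M) : arr S f ⊗ arr S g ⟶ arr S (arrTensor f g) :=
  Presented.homMk (.gen (.nc (.μ f g)))

end LocPlus

end Plus

/-! ## Strong symmetric monoidal functors -/

section Functors

variable (C : Type u₁) [Category.{v₁} C] [MonoidalCategory C] [SymmetricCategory C]
  (E : Type u₂) [Category.{v₂} E] [MonoidalCategory E] [SymmetricCategory E]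

/-- A lax symmetric monoidal functor is strong if its structure morphisms are isomorphisms. -/
def isStrong : ObjectProperty (LaxBraidedFunctor C E) := fun F =>
  IsIso (Functor.LaxMonoidal.ε F.toFunctor) ∧
    ∀ X Y : C, IsIso (Functor.LaxMonoidal.μ F.toFunctor X Y)

/-- The category `[C, E]_⊗` of strong symmetric monoidal functors and monoidal natural
transformations. -/
abbrev StrongFunctor := (isStrong C E).FullSubcategory

instance trivialLaxBraided : ((Functor.const C).obj (𝟙_ E)).LaxBraided where
  ε := 𝟙 _
  μ _ _ := (λ_ (𝟙_ E)).hom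
  braided X Y := by simp [← unitors_equal]
  associativity X Y Z := by simp [unitors_equal]
  right_unitality X := by simp [← unitors_equal]

/-- The trivial functor, with constant value the unit object. -/
def trivialFunctor : StrongFunctor C E where
  obj := LaxBraidedFunctor.of ((Functor.const C).obj (𝟙_ E))
  property := by
    refine ⟨?_, fun X Y => ?_⟩
    · change IsIso (𝟙 _); infer_instance
    · change IsIso (λ_ (𝟙_ E)).hom; infer_instance

/-- Counital strong symmetric monoidal functors: those equipped with a monoidal natural
transformation to the trivial functor. -/
abbrev CounitalFunctor := Over (trivialFunctor C E)

end Functors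

/-! ## Fibrewise multiplications, units, invertible elements and splittings -/

section Fibres

variable (M : Type u₁) [Category.{v₁} M] (E : Type u₂) [Category.{v₂} E] [MonoidalCategory E]

/-- The part of the structure on a family `D f` that invertibility and splittings refer to: the
action of the isomorphisms of arrows and the multiplication over the composition of `M`. -/
structure FibreMul where
  D : Arrow M → E
  act {f g : Arrow M} (e : f ≅ g) : D f ⟶ D g
  mul {X Y Z : M} (f : X ⟶ Y) (g : Y ⟶ Z) :
    D (Arrow.mk g) ⊗ D (Arrow.mk f) ⟶ D (Arrow.mk (f ≫ g))

namespace FibreMul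

variable {M E} (A : FibreMul M E)

/-- An element of `D f`. -/
abbrev Elt {X Y : M} (f : X ⟶ Y) := 𝟙_ E ⟶ A.D (Arrow.mk f)

/-- The product of two elements. -/
def eltMul {X Y Z : M} {f : X ⟶ Y} {g : Y ⟶ Z} (y : A.Elt g) (x : A.Elt f) : A.Elt (f ≫ g) :=
  (λ_ (𝟙_ E)).inv ≫ (y ⊗ₘ x) ≫ A.mul f g

/-- `e` is a two-sided unit at the object `X`. -/
def IsUnitAt (X : M) (e : A.Elt (𝟙 X)) : Prop :=
  (∀ {W : M} (f : W ⟶ X), (λ_ (A.D (Arrow.mk f))).inv ≫ (e ▷ A.D (Arrow.mk f)) ≫ A.mul f (𝟙 X) ≫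
      A.act (sqEq (Category.comp_id f)) = 𝟙 _) ∧
  (∀ {Z : M} (g : X ⟶ Z), (ρ_ (A.D (Arrow.mk g))).inv ≫ (A.D (Arrow.mk g) ◁ e) ≫ A.mul (𝟙 X) g ≫
      A.act (sqEq (Category.id_comp g)) = 𝟙 _)

/-- `x ∈ D σ` has an inverse in `D σ⁻¹`. -/
def IsInvertible {X Y : M} (σ : X ≅ Y) (x : A.Elt σ.hom) : Prop :=
  ∃ y : A.Elt σ.inv,
    A.IsUnitAt X (A.eltMul y x ≫ A.act (sqEq σ.hom_inv_id)) ∧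
    A.IsUnitAt Y (A.eltMul x y ≫ A.act (sqEq σ.inv_hom_id))

/-- A splitting: for every isomorphism `σ` a set `I σ` of invertible elements of `D σ` and a
decomposition `D σ = (∐_{I σ} 𝟙) ⨿ red σ` such that every invertible element of `D σ` lies in the
first summand, and such that the `I σ` are closed under composition and composition with a fixed
element is bijective (so that they form a groupoid over the isomorphisms of `M`). -/
structure Splitting where
  I {X Y : M} (σ : X ≅ Y) : Set (A.Elt σ.hom)
  free {X Y : M} (σ : X ≅ Y) : E
  red {X Y : M} (σ : X ≅ Y) : E
  elt {X Y : M} (σ : X ≅ Y) (x : I σ) : 𝟙_ E ⟶ free σ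
  elt_isCoproduct {X Y : M} (σ : X ≅ Y) : IsColimit (Cofan.mk (free σ) (elt σ))
  freeIncl {X Y : M} (σ : X ≅ Y) : free σ ⟶ A.D (Arrow.mk σ.hom)
  redIncl {X Y : M} (σ : X ≅ Y) : red σ ⟶ A.D (Arrow.mk σ.hom)
  isCoproduct {X Y : M} (σ : X ≅ Y) : IsColimit (BinaryCofan.mk (freeIncl σ) (redIncl σ))
  elt_incl {X Y : M} (σ : X ≅ Y) (x : I σ) : elt σ x ≫ freeIncl σ = x.1
  invertible {X Y : M} (σ : X ≅ Y) (x : I σ) : A.IsInvertible σ x.1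
  invertible_mem {X Y : M} (σ : X ≅ Y) (x : A.Elt σ.hom) :
    A.IsInvertible σ x → ∃ y : 𝟙_ E ⟶ free σ, y ≫ freeIncl σ = x
  mul_mem {X Y Z : M} (σ : X ≅ Y) (τ : Y ≅ Z) (x : I σ) (y : I τ) :
    A.eltMul y.1 x.1 ∈ I (σ ≪≫ τ)
  mul_bijective {X Y Z : M} (σ : X ≅ Y) (τ : Y ≅ Z) (x : I σ) :
    Function.Bijective (fun y : I τ => (⟨A.eltMul y.1 x.1, mul_mem σ τ x y⟩ : I (σ ≪≫ τ)))
  bijective_mul {X Y Z : M} (σ : X ≅ Y) (τ : Y ≅ Z) (y : I τ) :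
    Function.Bijective (fun x : I σ => (⟨A.eltMul y.1 x.1, mul_mem σ τ x y⟩ : I (σ ≪≫ τ)))

end FibreMul

variable {M E} [MonoidalCategory M] [SymmetricCategory E] {S : Option (SymmetricCategory M)}

/-- The value of a functor on `M^{loc+}` at an arrow. -/
abbrev fib (F : StrongFunctor (LocPlus S) E) (f : Arrow M) : E :=
  F.obj.toFunctor.obj (LocPlus.arr S f)

/-- The multiplication on the values of a functor on `M^{loc+}`. -/
def fibMul (F : StrongFunctor (LocPlus S) E) {X Y Z : M} (f : X ⟶ Y) (g : Y ⟶ Z) :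
    fib F (Arrow.mk g) ⊗ fib F (Arrow.mk f) ⟶ fib F (Arrow.mk (f ≫ g)) :=
  Functor.LaxMonoidal.μ F.obj.toFunctor _ _ ≫ F.obj.toFunctor.map (LocPlus.γ S f g)

/-- The product over `⊗` on the values of a functor on `M^{loc+}`. -/
def fibTensor (F : StrongFunctor (LocPlus S) E) (f g : Arrow M) :
    fib F f ⊗ fib F g ⟶ fib F (arrTensor f g) :=
  Functor.LaxMonoidal.μ F.obj.toFunctor _ _ ≫ F.obj.toFunctor.map (LocPlus.μ S f g)

/-- The fibrewise multiplication defined by a functor on `M^{loc+}`. -/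
def functorFibreMul (F : StrongFunctor (LocPlus S) E) : FibreMul M E where
  D := fib F
  act e := F.obj.toFunctor.map (LocPlus.iso S e)
  mul f g := fibMul F f g

/-- Split functors on `M^{loc+}`. -/
def IsSplitFunctor (F : StrongFunctor (LocPlus S) E) : Prop :=
  Nonempty (functorFibreMul F).Splitting

end Fibres

/-! ## Bimodule monoids -/

section Bimodules

variable (M : Type u₁) [Category.{v₁} M] [MonoidalCategory M]
  (E : Type u₂) [Category.{v₂} E] [MonoidalCategory E]

variable {M E} in
/-- The action `(σ ⇓ τ)` of a pair of isomorphisms on a bimodule over the groupoid `Iso(M)`. -/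
def bimodAct (ρ : (Core M)ᵒᵖ × Core M ⥤ E) {X Y X' Y' : M} (σ : X ≅ X') (τ : Y ≅ Y') :
    ρ.obj (.op ⟨X⟩, ⟨Y⟩) ⟶ ρ.obj (.op ⟨X'⟩, ⟨Y'⟩) :=
  ρ.map (X := (.op ⟨X⟩, ⟨Y⟩)) (Y := (.op ⟨X'⟩, ⟨Y'⟩)) (Prod.mkHom (Quiver.Hom.op ⟨σ.symm⟩) ⟨τ⟩)

variable [BraidedCategory E]

/-- A lax monoidal `Iso(M)`-bimodule monoid in `E`. The monoid structure `γ` for the plethysm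
product is given, by the universal property of the coend, by a family of maps
`ρ(Y,Z) ⊗ ρ(X,Y) ⟶ ρ(X,Z)` that is natural in `X`, `Z` and dinatural in `Y` (`γ_nat`). -/
structure BimoduleMonoid where
  ρ : (Core M)ᵒᵖ × Core M ⥤ E
  γ (X Y Z : M) : ρ.obj (.op ⟨Y⟩, ⟨Z⟩) ⊗ ρ.obj (.op ⟨X⟩, ⟨Y⟩) ⟶ ρ.obj (.op ⟨X⟩, ⟨Z⟩)
  γ_nat {X Y Z X' Y' Z' : M} (σ : X ≅ X') (τ : Y ≅ Y') (υ : Z ≅ Z') :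
    (bimodAct ρ τ υ ⊗ₘ bimodAct ρ σ τ) ≫ γ X' Y' Z' = γ X Y Z ≫ bimodAct ρ σ υ
  γ_assoc (X Y Z W : M) :
    (γ Y Z W ▷ ρ.obj (.op ⟨X⟩, ⟨Y⟩)) ≫ γ X Y W =
      (α_ _ _ _).hom ≫ (ρ.obj (.op ⟨Z⟩, ⟨W⟩) ◁ γ X Y Z) ≫ γ X Z W
  μ (X Y X' Y' : M) :
    ρ.obj (.op ⟨X⟩, ⟨Y⟩) ⊗ ρ.obj (.op ⟨X'⟩, ⟨Y'⟩) ⟶ ρ.obj (.op ⟨X ⊗ X'⟩, ⟨Y ⊗ Y'⟩)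
  μ_nat {X₁ Y₁ X₂ Y₂ X₁' Y₁' X₂' Y₂' : M}
    (σ₁ : X₁ ≅ X₁') (τ₁ : Y₁ ≅ Y₁') (σ₂ : X₂ ≅ X₂') (τ₂ : Y₂ ≅ Y₂') :
    (bimodAct ρ σ₁ τ₁ ⊗ₘ bimodAct ρ σ₂ τ₂) ≫ μ X₁' Y₁' X₂' Y₂' =
      μ X₁ Y₁ X₂ Y₂ ≫ bimodAct ρ (σ₁ ⊗ᵢ σ₂) (τ₁ ⊗ᵢ τ₂)
  μ_assoc (X₁ Y₁ X₂ Y₂ X₃ Y₃ : M) :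
    (μ X₁ Y₁ X₂ Y₂ ▷ ρ.obj (.op ⟨X₃⟩, ⟨Y₃⟩)) ≫ μ (X₁ ⊗ X₂) (Y₁ ⊗ Y₂) X₃ Y₃ ≫
        bimodAct ρ (α_ X₁ X₂ X₃) (α_ Y₁ Y₂ Y₃) =
      (α_ _ _ _).hom ≫ (ρ.obj (.op ⟨X₁⟩, ⟨Y₁⟩) ◁ μ X₂ Y₂ X₃ Y₃) ≫ μ X₁ Y₁ (X₂ ⊗ X₃) (Y₂ ⊗ Y₃)
  interchange (X Y Z X' Y' Z' : M) :
    tensorμ (ρ.obj (.op ⟨Y⟩, ⟨Z⟩)) (ρ.obj (.op ⟨Y'⟩, ⟨Z'⟩))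
        (ρ.obj (.op ⟨X⟩, ⟨Y⟩)) (ρ.obj (.op ⟨X'⟩, ⟨Y'⟩)) ≫
        (γ X Y Z ⊗ₘ γ X' Y' Z') ≫ μ X Z X' Z' =
      (μ Y Z Y' Z' ⊗ₘ μ X Y X' Y') ≫ γ (X ⊗ X') (Y ⊗ Y') (Z ⊗ Z')

namespace BimoduleMonoid

variable {M E}

/-- The object `ρ(X,Y)`. -/
abbrev at' (B : BimoduleMonoid M E) (X Y : M) : E := B.ρ.obj (.op ⟨X⟩, ⟨Y⟩)

/-- The action of a pair of isomorphisms. -/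
abbrev act (B : BimoduleMonoid M E) {X Y X' Y' : M} (σ : X ≅ X') (τ : Y ≅ Y') :
    B.at' X Y ⟶ B.at' X' Y' := bimodAct B.ρ σ τ

/-- Morphisms of bimodule monoids. -/
@[ext]
structure Hom (B B' : BimoduleMonoid M E) where
  app (X Y : M) : B.at' X Y ⟶ B'.at' X Y
  nat {X Y X' Y' : M} (σ : X ≅ X') (τ : Y ≅ Y') : B.act σ τ ≫ app X' Y' = app X Y ≫ B'.act σ τ
  γ (X Y Z : M) : B.γ X Y Z ≫ app X Z = (app Y Z ⊗ₘ app X Y) ≫ B'.γ X Y Z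
  μ (X Y X' Y' : M) :
    B.μ X Y X' Y' ≫ app (X ⊗ X') (Y ⊗ Y') = (app X Y ⊗ₘ app X' Y') ≫ B'.μ X Y X' Y'

instance : Category (BimoduleMonoid M E) where
  Hom := Hom
  id B := { app := fun _ _ => 𝟙 _, nat := by simp, γ := by simp, μ := by simp }
  comp f g :=
    { app := fun X Y => f.app X Y ≫ g.app X Y
      nat := fun σ τ => by
        rw [← Category.assoc, Hom.nat, Category.assoc, Hom.nat, Category.assoc]
      γ := fun X Y Z => by
        rw [← Category.assoc, Hom.γ, Category.assoc, Hom.γ, tensorHom_comp_tensorHom_assoc]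
      μ := fun X Y X' Y' => by
        rw [← Category.assoc, Hom.μ, Category.assoc, Hom.μ, tensorHom_comp_tensorHom_assoc] }
  id_comp f := Hom.ext (by ext; exact Category.id_comp _)
  comp_id f := Hom.ext (by ext; exact Category.comp_id _)
  assoc f g h := Hom.ext (by ext; exact Category.assoc _ _ _)

/-- Compatibility of `μ` with the commutativity constraints. -/
def IsSymm (S : Option (SymmetricCategory M)) (B : BimoduleMonoid M E) : Prop :=
  ∀ s : SymmetricCategory M, S = some s → ∀ X Y X' Y' : M,
    B.μ X Y X' Y' ≫ B.act (s.braiding X X') (s.braiding Y Y') =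
      (β_ _ _).hom ≫ B.μ X' Y' X Y

end BimoduleMonoid

end Bimodules

/-! ## The freely enriched Hom bimodule and bimodule monoids over it -/

section Copowers

variable (E : Type u₂) [Category.{v₂} E] [MonoidalCategory E]

/-- `∐_J 𝟙`; for `J = Hom_M(X,Y)` this is the morphism object of the free enrichment of `M`. -/
noncomputable abbrev copow (J : Type w) [HasColimitsOfShape (Discrete J) E] : E :=
  ∐ fun _ : J => 𝟙_ E

/-- The map `∐_J 𝟙 ⟶ ∐_K 𝟙` induced by a map of sets. -/
noncomputable def copowMap {J K : Type w} [HasColimitsOfShape (Discrete J) E]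
    [HasColimitsOfShape (Discrete K) E] (h : J → K) : copow E J ⟶ copow E K :=
  Sigma.desc fun j => Sigma.ι (fun _ : K => 𝟙_ E) (h j)

/-- The map `(∐_J 𝟙) ⊗ (∐_K 𝟙) ⟶ ∐_L 𝟙` induced by an operation `J → K → L`; on the summand
`𝟙 ⊗ 𝟙` with index `(j, k)` it is the inclusion of the summand with index `op j k`. -/
noncomputable def copowMul {J K L : Type w} [HasColimitsOfShape (Discrete J) E]
    [HasColimitsOfShape (Discrete K) E] [HasColimitsOfShape (Discrete L) E]
    [∀ A : E, PreservesColimitsOfShape (Discrete K) (tensorLeft A)] (op : J → K → L) :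
    copow E J ⊗ copow E K ⟶ copow E L :=
  (PreservesCoproduct.iso (tensorLeft (copow E J)) (fun _ : K => 𝟙_ E)).hom ≫
    Sigma.desc fun k => (ρ_ (copow E J)).hom ≫
      Sigma.desc fun j => Sigma.ι (fun _ : L => 𝟙_ E) (op j k)

end Copowers

section Over

variable (M : Type u₁) [Category.{v₁} M] [MonoidalCategory M]
  (E : Type u₂) [Category.{v₂} E] [MonoidalCategory E] [BraidedCategory E]
  [∀ X Y : M, HasColimitsOfShape (Discrete (X ⟶ Y)) E]
  [∀ (X Y : M) (A : E), PreservesColimitsOfShape (Discrete (X ⟶ Y)) (tensorLeft A)]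

/-- A lax monoidal bimodule monoid with a morphism `b` of lax monoidal bimodule monoids to the free
enrichment `(X, Y) ↦ ∐_{Hom_M(X,Y)} 𝟙` of `Hom_M`. -/
structure SliceMonoid extends BimoduleMonoid M E where
  b (X Y : M) : toBimoduleMonoid.at' X Y ⟶ copow E (X ⟶ Y)
  b_nat {X Y X' Y' : M} (σ : X ≅ X') (τ : Y ≅ Y') :
    toBimoduleMonoid.act σ τ ≫ b X' Y' = b X Y ≫ copowMap E (fun φ => σ.inv ≫ φ ≫ τ.hom)
  b_γ (X Y Z : M) :
    γ X Y Z ≫ b X Z =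
      (b Y Z ⊗ₘ b X Y) ≫ copowMul E (fun (ψ : Y ⟶ Z) (φ : X ⟶ Y) => φ ≫ ψ)
  b_μ (X Y X' Y' : M) :
    μ X Y X' Y' ≫ b (X ⊗ X') (Y ⊗ Y') =
      (b X Y ⊗ₘ b X' Y') ≫ copowMul E (fun (φ : X ⟶ Y) (ψ : X' ⟶ Y') => φ ⊗ₘ ψ)

namespace SliceMonoid

variable {M E}

/-- Morphisms of bimodule monoids over `Hom_M`. -/
@[ext]
structure Hom (B B' : SliceMonoid M E) where
  hom : B.toBimoduleMonoid ⟶ B'.toBimoduleMonoid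
  w (X Y : M) : BimoduleMonoid.Hom.app hom X Y ≫ B'.b X Y = B.b X Y

instance : Category (SliceMonoid M E) where
  Hom := Hom
  id B := ⟨𝟙 _, fun _ _ => Category.id_comp _⟩
  comp f g := ⟨f.hom ≫ g.hom, fun X Y => by
    have h : BimoduleMonoid.Hom.app (f.hom ≫ g.hom) X Y =
      BimoduleMonoid.Hom.app f.hom X Y ≫ BimoduleMonoid.Hom.app g.hom X Y := rfl
    rw [h, Category.assoc, g.w, f.w]⟩
  id_comp f := Hom.ext (Category.id_comp _)
  comp_id f := Hom.ext (Category.comp_id _)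
  assoc f g h := Hom.ext (Category.assoc _ _ _)

/-- Strong (over `Hom_M`): `μ` exhibits `ρ(X,Y) ⊗ ρ(X',Y')` as the pull-back of
`ρ(X ⊗ X', Y ⊗ Y')` along `Hom(X,Y) ⊗ Hom(X',Y') ⟶ Hom(X ⊗ X', Y ⊗ Y')`. When the symmetric
structure is part of the data, `μ` is also compatible with the commutativity constraints. -/
def isStrong (S : Option (SymmetricCategory M)) : ObjectProperty (SliceMonoid M E) := fun B =>
  (∀ X Y X' Y' : M, IsPullback (B.μ X Y X' Y') (B.b X Y ⊗ₘ B.b X' Y') (B.b (X ⊗ X') (Y ⊗ Y'))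
    (copowMul E (fun (φ : X ⟶ Y) (ψ : X' ⟶ Y') => φ ⊗ₘ ψ))) ∧
  B.toBimoduleMonoid.IsSymm S

end SliceMonoid

end Over

section Indexing

variable (M : Type u₁) [Category.{v₁} M] [MonoidalCategory M]
  (E : Type u₂) [Category.{v₂} E] [MonoidalCategory E] [BraidedCategory E]

/-- Counital lax monoidal indexing data: objects `D f` for the arrows `f` of `M` with an action of
the groupoid of arrows, associative multiplications `γ`, `μ` over the composition and the tensor
product of `M`, and compatible counits. -/
structure IndexingData where
  D : Core (Arrow M) ⥤ E
  γ {X Y Z : M} (f : X ⟶ Y) (g : Y ⟶ Z) :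
    D.obj ⟨Arrow.mk g⟩ ⊗ D.obj ⟨Arrow.mk f⟩ ⟶ D.obj ⟨Arrow.mk (f ≫ g)⟩
  γ_equiv {X Y Z X' Y' Z' : M} (f : X ⟶ Y) (g : Y ⟶ Z) (f' : X' ⟶ Y') (g' : Y' ⟶ Z')
    (σ : X ≅ X') (τ : Y ≅ Y') (υ : Z ≅ Z')
    (hf : σ.hom ≫ f' = f ≫ τ.hom) (hg : τ.hom ≫ g' = g ≫ υ.hom) :
    (D.map ⟨sq g g' τ υ hg⟩ ⊗ₘ D.map ⟨sq f f' σ τ hf⟩) ≫ γ f' g' =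
      γ f g ≫ D.map ⟨sq (f ≫ g) (f' ≫ g') σ υ (by rw [reassoc_of% hf, hg, Category.assoc])⟩
  γ_assoc {X Y Z W : M} (f : X ⟶ Y) (g : Y ⟶ Z) (h : Z ⟶ W) :
    (γ g h ▷ D.obj ⟨Arrow.mk f⟩) ≫ γ f (g ≫ h) =
      (α_ _ _ _).hom ≫ (D.obj ⟨Arrow.mk h⟩ ◁ γ f g) ≫ γ (f ≫ g) h ≫
        D.map ⟨sqEq (Category.assoc f g h)⟩
  μ (f g : Arrow M) : D.obj ⟨f⟩ ⊗ D.obj ⟨g⟩ ⟶ D.obj ⟨arrTensor f g⟩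
  μ_equiv {f f' g g' : Arrow M} (e : f ≅ f') (e' : g ≅ g') :
    (D.map (X := ⟨f⟩) (Y := ⟨f'⟩) ⟨e⟩ ⊗ₘ D.map (X := ⟨g⟩) (Y := ⟨g'⟩) ⟨e'⟩) ≫ μ f' g' =
      μ f g ≫ D.map ⟨arrTensorIso e e'⟩
  μ_assoc (f g h : Arrow M) :
    (μ f g ▷ D.obj ⟨h⟩) ≫ μ (arrTensor f g) h ≫ D.map ⟨arrAssoc f g h⟩ =
      (α_ _ _ _).hom ≫ (D.obj ⟨f⟩ ◁ μ g h) ≫ μ f (arrTensor g h)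
  interchange {X Y Z X' Y' Z' : M}
    (f : X ⟶ Y) (g : Y ⟶ Z) (f' : X' ⟶ Y') (g' : Y' ⟶ Z') :
    tensorμ (D.obj ⟨Arrow.mk g⟩) (D.obj ⟨Arrow.mk g'⟩)
        (D.obj ⟨Arrow.mk f⟩) (D.obj ⟨Arrow.mk f'⟩) ≫
        (γ f g ⊗ₘ γ f' g') ≫ μ (Arrow.mk (f ≫ g)) (Arrow.mk (f' ≫ g')) ≫
          D.map ⟨arrInterchange f g f' g'⟩ =
      (μ (Arrow.mk g) (Arrow.mk g') ⊗ₘ μ (Arrow.mk f) (Arrow.mk f')) ≫ γ (f ⊗ₘ f') (g ⊗ₘ g')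
  ε (f : Arrow M) : D.obj ⟨f⟩ ⟶ 𝟙_ E
  ε_act {f g : Arrow M} (e : f ≅ g) : D.map (X := ⟨f⟩) (Y := ⟨g⟩) ⟨e⟩ ≫ ε g = ε f
  ε_γ {X Y Z : M} (f : X ⟶ Y) (g : Y ⟶ Z) :
    γ f g ≫ ε (Arrow.mk (f ≫ g)) = (ε (Arrow.mk g) ⊗ₘ ε (Arrow.mk f)) ≫ (λ_ (𝟙_ E)).hom
  ε_μ (f g : Arrow M) : μ f g ≫ ε (arrTensor f g) = (ε f ⊗ₘ ε g) ≫ (λ_ (𝟙_ E)).hom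

namespace IndexingData

variable {M E}

/-- Morphisms of counital indexing data. -/
@[ext]
structure Hom (A A' : IndexingData M E) where
  app (f : Arrow M) : A.D.obj ⟨f⟩ ⟶ A'.D.obj ⟨f⟩
  nat {f g : Arrow M} (e : f ≅ g) :
    A.D.map (X := ⟨f⟩) (Y := ⟨g⟩) ⟨e⟩ ≫ app g = app f ≫ A'.D.map (X := ⟨f⟩) (Y := ⟨g⟩) ⟨e⟩
  γ {X Y Z : M} (f : X ⟶ Y) (g : Y ⟶ Z) :
    A.γ f g ≫ app (Arrow.mk (f ≫ g)) = (app (Arrow.mk g) ⊗ₘ app (Arrow.mk f)) ≫ A'.γ f g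
  μ (f g : Arrow M) : A.μ f g ≫ app (arrTensor f g) = (app f ⊗ₘ app g) ≫ A'.μ f g
  ε (f : Arrow M) : app f ≫ A'.ε f = A.ε f

instance : Category (IndexingData M E) where
  Hom := Hom
  id A :=
    { app := fun _ => 𝟙 _, nat := by simp, γ := by simp, μ := by simp, ε := by simp }
  comp a a' :=
    { app := fun f => a.app f ≫ a'.app f
      nat := fun e => by
        rw [← Category.assoc, Hom.nat, Category.assoc, Hom.nat, Category.assoc]
      γ := fun f g => by
        rw [← Category.assoc, Hom.γ, Category.assoc, Hom.γ, tensorHom_comp_tensorHom_assoc]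
      μ := fun f g => by
        rw [← Category.assoc, Hom.μ, Category.assoc, Hom.μ, tensorHom_comp_tensorHom_assoc]
      ε := fun f => by rw [Category.assoc, Hom.ε, Hom.ε] }
  id_comp f := Hom.ext (by ext; exact Category.id_comp _)
  comp_id f := Hom.ext (by ext; exact Category.comp_id _)
  assoc f g h := Hom.ext (by ext; exact Category.assoc _ _ _)

end IndexingData

end Indexing

section BimoduleOver

variable (M : Type u₁) [Category.{v₁} M] [MonoidalCategory M]
  (E : Type u₂) [Category.{v₂} E] [MonoidalCategory E] [BraidedCategory E]
  [∀ X Y : M, HasColimitsOfShape (Discrete (X ⟶ Y)) E]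
  [∀ (X Y : M) (A : E), PreservesColimitsOfShape (Discrete (X ⟶ Y)) (tensorLeft A)]

/-- A (counital) lax monoidal bimodule monoid over `Hom_M`: a bimodule monoid `ρ` with a morphism
`b` to the free enrichment of `Hom_M`, decomposed over the morphisms of `M`, i.e. with
`ρ(X,Y) = ∐_{φ : X ⟶ Y} D(φ)`, where `b` is the sum of maps `ε_φ : D(φ) ⟶ 𝟙` and all the structure
of `ρ` is induced by corresponding structure on the summands. -/
structure BimoduleOver where
  tot : SliceMonoid M E
  fib : IndexingData M E
  ι {X Y : M} (φ : X ⟶ Y) : fib.D.obj ⟨Arrow.mk φ⟩ ⟶ tot.at' X Y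
  isCoproduct (X Y : M) : IsColimit (Cofan.mk (tot.at' X Y) (fun φ : X ⟶ Y => ι φ))
  ι_act {X Y X' Y' : M} (φ : X ⟶ Y) (φ' : X' ⟶ Y') (σ : X ≅ X') (τ : Y ≅ Y')
    (h : σ.hom ≫ φ' = φ ≫ τ.hom) : ι φ ≫ tot.act σ τ = fib.D.map ⟨sq φ φ' σ τ h⟩ ≫ ι φ'
  ι_γ {X Y Z : M} (φ : X ⟶ Y) (ψ : Y ⟶ Z) :
    (ι ψ ⊗ₘ ι φ) ≫ tot.γ X Y Z = fib.γ φ ψ ≫ ι (φ ≫ ψ)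
  ι_μ {X Y X' Y' : M} (φ : X ⟶ Y) (ψ : X' ⟶ Y') :
    (ι φ ⊗ₘ ι ψ) ≫ tot.μ X Y X' Y' = fib.μ (Arrow.mk φ) (Arrow.mk ψ) ≫ ι (φ ⊗ₘ ψ)
  ι_b {X Y : M} (φ : X ⟶ Y) :
    ι φ ≫ tot.b X Y = fib.ε (Arrow.mk φ) ≫ Sigma.ι (fun _ : X ⟶ Y => 𝟙_ E) φ

namespace BimoduleOver

variable {M E}

/-- Morphisms of bimodule monoids over `Hom_M`, respecting the decompositions. -/
@[ext]
structure Hom (B B' : BimoduleOver M E) where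
  tot : B.tot ⟶ B'.tot
  fib : B.fib ⟶ B'.fib
  w {X Y : M} (φ : X ⟶ Y) :
    B.ι φ ≫ BimoduleMonoid.Hom.app (SliceMonoid.Hom.hom tot) X Y =
      IndexingData.Hom.app fib (Arrow.mk φ) ≫ B'.ι φ

instance : Category (BimoduleOver M E) where
  Hom := Hom
  id B := ⟨𝟙 _, 𝟙 _, fun _ => (Category.comp_id _).trans (Category.id_comp _).symm⟩
  comp f g := ⟨f.tot ≫ g.tot, f.fib ≫ g.fib, fun {X Y} φ => by
    have h₁ : BimoduleMonoid.Hom.app (SliceMonoid.Hom.hom (f.tot ≫ g.tot)) X Y =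
      BimoduleMonoid.Hom.app (SliceMonoid.Hom.hom f.tot) X Y ≫
        BimoduleMonoid.Hom.app (SliceMonoid.Hom.hom g.tot) X Y := rfl
    have h₂ : IndexingData.Hom.app (f.fib ≫ g.fib) (Arrow.mk φ) =
      IndexingData.Hom.app f.fib (Arrow.mk φ) ≫ IndexingData.Hom.app g.fib (Arrow.mk φ) := rfl
    rw [h₁, h₂, ← Category.assoc, f.w, Category.assoc, g.w, Category.assoc]⟩
  id_comp f := Hom.ext (Category.id_comp _) (Category.id_comp _)
  comp_id f := Hom.ext (Category.comp_id _) (Category.comp_id _)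
  assoc f g h := Hom.ext (Category.assoc _ _ _) (Category.assoc _ _ _)

/-- The functor that forgets the decomposition and keeps the map to `Hom_M`. -/
def toSlice : BimoduleOver M E ⥤ SliceMonoid M E where
  obj B := B.tot
  map f := Hom.tot f

/-- Strong (over `Hom_M`): the maps `μ_{f,g} : D(f) ⊗ D(g) ⟶ D(f ⊗ g)` are isomorphisms. When
the symmetric structure is part of the data, `μ` is compatible with the commutativity
constraints. -/
def isStrong (S : Option (SymmetricCategory M)) : ObjectProperty (BimoduleOver M E) := fun B =>
  (∀ f g : Arrow M, IsIso (B.fib.μ f g)) ∧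
  (∀ s : SymmetricCategory M, S = some s → ∀ f g : Arrow M,
    B.fib.μ f g ≫ B.fib.D.map ⟨arrBraiding s f g⟩ = (β_ _ _).hom ≫ B.fib.μ g f) ∧
  B.tot.toBimoduleMonoid.IsSymm S

/-- The fibrewise multiplication of a bimodule monoid over `Hom_M`. -/
def fibreMul (B : BimoduleOver M E) : FibreMul M E where
  D f := B.fib.D.obj ⟨f⟩
  act e := B.fib.D.map ⟨e⟩
  mul f g := B.fib.γ f g

/-- Isomorphism split bimodule monoids over `Hom_M`: `ρ(X,Y) = (∐_{ι(X,Y)} 𝟙) ⨿ ρ̄(X,Y)`,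
compatibly with the decomposition over `Hom_M(X,Y)`, where `ι(X,Y)` is a groupoid of invertible
elements over `Iso(M)` and all invertible elements lie in the first summand. -/
def IsIsoSplit (B : BimoduleOver M E) : Prop := Nonempty B.fibreMul.Splitting

end BimoduleOver

/-- The category of strong (symmetric) monoidal bimodule monoids over `Hom_M`. -/
abbrev StrongBimoduleOver (S : Option (SymmetricCategory M)) :=
  (BimoduleOver.isStrong (M := M) (E := E) S).FullSubcategory

/-- The category of strong (symmetric) monoidal bimodule monoids in the slice over `Hom_M`. -/
abbrev StrongSliceMonoid (S : Option (SymmetricCategory M)) :=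
  (SliceMonoid.isStrong (M := M) (E := E) S).FullSubcategory

end BimoduleOver

/-! ## Comparison of functors and bimodule monoids -/

section Comparison

variable {M : Type u₁} [Category.{v₁} M] [MonoidalCategory M]
  {E : Type u₂} [Category.{v₂} E] [MonoidalCategory E] [SymmetricCategory E]
  [∀ X Y : M, HasColimitsOfShape (Discrete (X ⟶ Y)) E]
  [∀ (X Y : M) (A : E), PreservesColimitsOfShape (Discrete (X ⟶ Y)) (tensorLeft A)]
  {S : Option (SymmetricCategory M)} {𝒜 : Type u₃} [Category.{v₃} 𝒜]

/-- For a family of functors `P a` on `M^{loc+}` and a family of bimodule monoids `Q a` over `Hom_M`,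
both functorial in `a`: natural isomorphisms `P a (f) ≅ D_{Q a}(f)` that identify the actions of
isomorphisms, the multiplications and the monoidal structures. In other words, the bimodule
monoid `Q a` is `ρ(X,Y) = ∐_{φ : X ⟶ Y} P a (φ)` with the structure induced by `P a`. -/
structure FibreComparison (P : 𝒜 ⥤ StrongFunctor (LocPlus S) E) (Q : 𝒜 ⥤ BimoduleOver M E) where
  κ (a : 𝒜) (f : Arrow M) : fib (P.obj a) f ≅ (Q.obj a).fib.D.obj ⟨f⟩
  natural {a a' : 𝒜} (t : a ⟶ a') (f : Arrow M) :
    (P.map t).hom.hom.hom.app (LocPlus.arr S f) ≫ (κ a' f).hom =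
      (κ a f).hom ≫ IndexingData.Hom.app (BimoduleOver.Hom.fib (Q.map t)) f
  act (a : 𝒜) {f g : Arrow M} (e : f ≅ g) :
    (P.obj a).obj.toFunctor.map (LocPlus.iso S e) ≫ (κ a g).hom =
      (κ a f).hom ≫ (Q.obj a).fib.D.map (X := ⟨f⟩) (Y := ⟨g⟩) ⟨e⟩
  γ (a : 𝒜) {X Y Z : M} (f : X ⟶ Y) (g : Y ⟶ Z) :
    fibMul (P.obj a) f g ≫ (κ a (Arrow.mk (f ≫ g))).hom =
      ((κ a (Arrow.mk g)).hom ⊗ₘ (κ a (Arrow.mk f)).hom) ≫ (Q.obj a).fib.γ f g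
  μ (a : 𝒜) (f g : Arrow M) :
    fibTensor (P.obj a) f g ≫ (κ a (arrTensor f g)).hom =
      ((κ a f).hom ⊗ₘ (κ a g).hom) ≫ (Q.obj a).fib.μ f g

/-- The counit of a counital functor on `M^{loc+}`, at an arrow. -/
def counit (F : CounitalFunctor (LocPlus S) E) (f : Arrow M) : fib F.left f ⟶ 𝟙_ E :=
  F.hom.hom.hom.hom.app (LocPlus.arr S f)

end Comparison

/-- Coproducts indexed by `J` in `E` are extensive (disjoint and stable under pull-back, as in the
category of sets): pull-backs along coproduct inclusions exist and coproducts are van Kampen. -/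
structure ExtensiveCoproducts (J : Type w) (E : Type u₂) [Category.{v₂} E]
    [HasColimitsOfShape (Discrete J) E] : Prop where
  hasPullback (f : J → E) (j : J) {Z : E} (g : Z ⟶ ∐ f) : HasPullback g (Sigma.ι f j)
  vanKampen (f : J → E) : IsVanKampenColimit (colimit.cocone (Discrete.functor f))

end PlusConstruction

/-! Both sides of the equivalence are the same data, namely indexing data on the arrows of `M`:
objects `D(φ)` with an action of the isomorphisms of arrows, multiplications `γ`, invertible
products `μ`, and counits `ε`.

On the functor side this is the universal property of a category given by generators and relations.
Generators interpreted so that the relations hold evaluate to a strong functor (`Eqv.eval_eq`,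
`liftStrong`). A monoidal transformation is determined by its components at the letters
(`hom_ext_letters`), and components at the letters extend as soon as they are natural for the
generators (`extApp_naturality`). Naturality for `μ⁻¹` follows from naturality for `μ`. Hence
`restriction` is an equivalence; the counit is the case of a transformation to the trivial functor.

On the bimodule side, `ρ(X,Y)` is the coproduct of its fibres. Since `⊗` preserves these coproducts
in each variable, a map out of `ρ ⊗ ρ` may be prescribed on the summands (`tensorDesc`), and
equations between such maps, also for iterated products, may be tested there (`TensorEpi.tensor`).
So structure, axioms and morphisms correspond to those of the fibres, and `totalization` is an
equivalence. The composite equivalence does not change the fibres, so the comparison consists of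
identities and the two notions of splitting coincide by definition.

If `E` is Cartesian, the unit and therefore the trivial functor are terminal, and a counit is no
extra datum. If moreover the coproducts are extensive, a map from `ρ(X,Y)` to a coproduct of copies
of `𝟙` already decomposes `ρ(X,Y)`: the fibres are the pull-backs along the inclusions of `𝟙`, and
they sit in `ρ(X,Y)` as subobjects. Structure and morphisms restrict to them, and `μ` is a pull-back
square over `Hom_M` exactly when every fibrewise `μ` is an isomorphism (`isPullback_μ`,
`isIso_fibreμ`). -/

namespace PlusConstruction

/-! ## The universal property of a presented symmetric monoidal category -/

section Evaluation

variable {O : Type u₁} {E : Type u₂} [Category.{v₂} E] [MonoidalCategory E]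

/-- The value of a word under an interpretation of the letters as objects. -/
def Word.eval (o : O → E) : Word O → E
  | .of x => o x
  | .unit => 𝟙_ E
  | .tensor X Y => X.eval o ⊗ Y.eval o

variable [SymmetricCategory E] {G : Word O → Word O → Type w} {o : O → E}

/-- The value of a formal morphism under an interpretation of the generators. -/
def Term.eval (g : ∀ {X Y : Word O}, G X Y → (X.eval o ⟶ Y.eval o)) :
    ∀ {X Y : Word O}, Term G X Y → (X.eval o ⟶ Y.eval o)
  | _, _, .gen f => g f
  | _, _, .id _ => 𝟙 _
  | _, _, .α_hom X Y Z => (α_ (X.eval o) (Y.eval o) (Z.eval o)).hom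
  | _, _, .α_inv X Y Z => (α_ (X.eval o) (Y.eval o) (Z.eval o)).inv
  | _, _, .l_hom X => (λ_ (X.eval o)).hom
  | _, _, .l_inv X => (λ_ (X.eval o)).inv
  | _, _, .ρ_hom X => (ρ_ (X.eval o)).hom
  | _, _, .ρ_inv X => (ρ_ (X.eval o)).inv
  | _, _, .swap X Y => (β_ (X.eval o) (Y.eval o)).hom
  | _, _, .comp f h => f.eval g ≫ h.eval g
  | _, _, .whiskerLeft X f => X.eval o ◁ f.eval g
  | _, _, .whiskerRight f Y => f.eval g ▷ Y.eval o
  | _, _, .tensor f h => f.eval g ⊗ₘ h.eval g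

/-- Soundness: a rule of `Eqv` is an assumed relation, a congruence rule, or an axiom that holds in
every symmetric monoidal category. -/
theorem Eqv.eval_eq {R : Relations G} (g : ∀ {X Y : Word O}, G X Y → (X.eval o ⟶ Y.eval o))
    (hg : ∀ ⦃X Y : Word O⦄ (f f' : Term G X Y), R f f' → f.eval g = f'.eval g)
    {X Y : Word O} {f f' : Term G X Y} (h : Eqv R f f') : f.eval g = f'.eval g := by
  induction h with
  | rel h => exact hg _ _ h
  | refl => rfl
  | symm _ ih => exact ih.symm
  | trans _ _ ih ih' => exact ih.trans ih'
  | comp _ _ ih ih' => simp only [Term.eval, ih, ih']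
  | whiskerLeft X _ ih => exact congrArg (X.eval o ◁ ·) ih
  | whiskerRight X _ ih => exact congrArg (· ▷ X.eval o) ih
  | tensor _ _ ih ih' => exact congrArg₂ (· ⊗ₘ ·) ih ih'
  | tensorHom_def => exact MonoidalCategory.tensorHom_def _ _
  | swap_naturality_right => exact BraidedCategory.braiding_naturality_right _ _
  | swap_naturality_left => exact BraidedCategory.braiding_naturality_left _ _
  | hexagon_forward => exact BraidedCategory.hexagon_forward _ _ _
  | hexagon_reverse => exact BraidedCategory.hexagon_reverse _ _ _
  | _ => simp [Term.eval, Word.eval]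

namespace Presented

variable {R : Relations G} (g : ∀ {X Y : Word O}, G X Y → (X.eval o ⟶ Y.eval o))
  (hg : ∀ ⦃X Y : Word O⦄ (f f' : Term G X Y), R f f' → f.eval g = f'.eval g)

/-- The functor on a presented category defined by an interpretation of the generators that
satisfies the relations. -/
def lift : Presented R ⥤ E where
  obj X := Word.eval o X
  map := Quotient.lift (fun f => f.eval g) (fun _ _ h => h.eval_eq g hg)
  map_id _ := rfl
  map_comp := by rintro _ _ _ ⟨f⟩ ⟨f'⟩; rfl

/-- Evaluation turns formal products into products on the nose, so identities serve as constraints.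
-/
instance : (lift g hg).LaxBraided where
  ε := 𝟙 (𝟙_ E)
  μ X Y := 𝟙 (Word.eval o X ⊗ Word.eval o Y)
  μ_natural_left := by
    rintro X Y ⟨f⟩ Z
    exact (Category.comp_id _).trans (Category.id_comp _).symm
  μ_natural_right := by
    rintro X Y Z ⟨f⟩
    exact (Category.comp_id _).trans (Category.id_comp _).symm
  associativity X Y Z := by
    change 𝟙 (Word.eval o X ⊗ Word.eval o Y) ▷ Word.eval o Z ≫ 𝟙 _ ≫ (α_ _ _ _).hom =
      (α_ _ _ _).hom ≫ Word.eval o X ◁ 𝟙 (Word.eval o Y ⊗ Word.eval o Z) ≫ 𝟙 _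
    simp
  left_unitality X := by
    change (λ_ (Word.eval o X)).hom = 𝟙 (𝟙_ E) ▷ _ ≫ 𝟙 _ ≫ (λ_ (Word.eval o X)).hom
    simp
  right_unitality X := by
    change (ρ_ (Word.eval o X)).hom = _ ◁ 𝟙 (𝟙_ E) ≫ 𝟙 _ ≫ (ρ_ (Word.eval o X)).hom
    simp
  braided X Y := by
    change 𝟙 _ ≫ (β_ (Word.eval o X) (Word.eval o Y)).hom = (β_ _ _).hom ≫ 𝟙 _
    simp

/-- The strong symmetric monoidal functor defined by an interpretation of the generators that
satisfies the relations. -/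
def liftStrong : StrongFunctor (Presented R) E where
  obj := LaxBraidedFunctor.of (lift g hg)
  property := ⟨inferInstanceAs (IsIso (𝟙 (𝟙_ E))), fun X Y =>
    inferInstanceAs (IsIso (𝟙 (Word.eval o X ⊗ Word.eval o Y)))⟩

end Presented

end Evaluation

/-! ## Monoidal transformations between functors on a presented category -/

section Extension

open Functor.LaxMonoidal

/-- Here `T` is only a family of morphisms. The lemma serves the inverse structural isomorphisms and
the generators `μ⁻¹`. -/
theorem natural_inv {C : Type u₁} [Category.{v₁} C] {E : Type u₂} [Category.{v₂} E]
    {F F' : C ⥤ E} {T : ∀ X : C, F.obj X ⟶ F'.obj X} {X Y : C} (u : X ≅ Y)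
    (h : F.map u.hom ≫ T Y = T X ≫ F'.map u.hom) :
    F.map u.inv ≫ T X = T Y ≫ F'.map u.inv := by
  rw [← cancel_epi (F.map u.hom), ← Functor.map_comp_assoc, u.hom_inv_id,
    CategoryTheory.Functor.map_id, Category.id_comp, reassoc_of% h, ← Functor.map_comp,
    u.hom_inv_id, CategoryTheory.Functor.map_id, Category.comp_id]

section Naturality

variable {C : Type u₁} [Category.{v₁} C] [MonoidalCategory C] [SymmetricCategory C]
  {E : Type u₂} [Category.{v₂} E] [MonoidalCategory E] [SymmetricCategory E]
  {F F' : C ⥤ E} {T : ∀ X : C, F.obj X ⟶ F'.obj X}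

variable [F.LaxBraided] [F'.LaxBraided] [∀ X Y, IsIso (μ F X Y)]

/-- The constraint of `F` is invertible, so naturality may be tested after composing with it, where
`T` splits into its two factors. -/
theorem natural_tensorHom (hμ : ∀ X Y, μ F X Y ≫ T (X ⊗ Y) = (T X ⊗ₘ T Y) ≫ μ F' X Y)
    {X Y X' Y' : C} {f : X ⟶ X'} {g : Y ⟶ Y'}
    (hf : F.map f ≫ T X' = T X ≫ F'.map f) (hg : F.map g ≫ T Y' = T Y ≫ F'.map g) :
    F.map (f ⊗ₘ g) ≫ T (X' ⊗ Y') = T (X ⊗ Y) ≫ F'.map (f ⊗ₘ g) := by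
  rw [← cancel_epi (μ F X Y), ← μ_natural_assoc, hμ, reassoc_of% hμ, ← μ_natural,
    tensorHom_comp_tensorHom_assoc, tensorHom_comp_tensorHom_assoc, hf, hg]

theorem natural_associator (hμ : ∀ X Y, μ F X Y ≫ T (X ⊗ Y) = (T X ⊗ₘ T Y) ≫ μ F' X Y)
    (X Y Z : C) :
    F.map (α_ X Y Z).hom ≫ T (X ⊗ (Y ⊗ Z)) = T ((X ⊗ Y) ⊗ Z) ≫ F'.map (α_ X Y Z).hom := by
  rw [← cancel_epi (μ F (X ⊗ Y) Z), ← cancel_epi (μ F X Y ▷ F.obj Z), associativity_assoc, hμ,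
    reassoc_of% hμ, ← tensorHom_id, ← id_tensorHom, tensorHom_comp_tensorHom_assoc,
    tensorHom_comp_tensorHom_assoc, hμ, hμ, Category.id_comp, Category.id_comp,
    ← Category.comp_id (T X), ← tensorHom_comp_tensorHom_assoc, ← associator_naturality_assoc,
    id_tensorHom, ← associativity, ← tensorHom_id, tensorHom_comp_tensorHom_assoc, Category.comp_id,
    Category.comp_id]

theorem natural_leftUnitor (hε : ε F ≫ T (𝟙_ C) = ε F')
    (hμ : ∀ X Y, μ F X Y ≫ T (X ⊗ Y) = (T X ⊗ₘ T Y) ≫ μ F' X Y) [IsIso (ε F)] (X : C) :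
    F.map (λ_ X).hom ≫ T X = T (𝟙_ C ⊗ X) ≫ F'.map (λ_ X).hom := by
  rw [← cancel_epi (μ F (𝟙_ C) X), ← cancel_epi (ε F ▷ F.obj X), reassoc_of% hμ,
    ← left_unitality_assoc, ← tensorHom_id, tensorHom_comp_tensorHom_assoc, hε, Category.id_comp,
    ← Category.comp_id (ε F'), ← Category.id_comp (T X), ← tensorHom_comp_tensorHom_assoc,
    tensorHom_id, id_tensorHom, ← whisker_exchange_assoc, ← left_unitality, leftUnitor_naturality,
    Category.id_comp]

theorem natural_braiding (hμ : ∀ X Y, μ F X Y ≫ T (X ⊗ Y) = (T X ⊗ₘ T Y) ≫ μ F' X Y) (X Y : C) :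
    F.map (β_ X Y).hom ≫ T (Y ⊗ X) = T (X ⊗ Y) ≫ F'.map (β_ X Y).hom := by
  rw [← cancel_epi (μ F X Y), Functor.LaxBraided.braided_assoc, hμ, reassoc_of% hμ,
    Functor.LaxBraided.braided, BraidedCategory.braiding_naturality_assoc]

/-- The right unitor is the braiding followed by the left unitor, so no separate unit computation is
needed. -/
theorem natural_rightUnitor (hε : ε F ≫ T (𝟙_ C) = ε F')
    (hμ : ∀ X Y, μ F X Y ≫ T (X ⊗ Y) = (T X ⊗ₘ T Y) ≫ μ F' X Y) [IsIso (ε F)] (X : C) :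
    F.map (ρ_ X).hom ≫ T X = T (X ⊗ 𝟙_ C) ≫ F'.map (ρ_ X).hom := by
  rw [← braiding_leftUnitor, Functor.map_comp, Functor.map_comp, Category.assoc,
    natural_leftUnitor hε hμ, reassoc_of% natural_braiding hμ]

end Naturality

namespace Presented

variable {O : Type u₁} {G : Word O → Word O → Type w} {R : Relations G}
  {E : Type u₂} [Category.{v₂} E] [MonoidalCategory E] [SymmetricCategory E]
  (F F' : StrongFunctor (Presented R) E)

instance : IsIso (ε F.obj.toFunctor) := F.property.1

instance (X Y : Presented R) : IsIso (μ F.obj.toFunctor X Y) := F.property.2 X Y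

/-- The unit constraint of a strong functor on a presented category. -/
noncomputable def unitIso : 𝟙_ E ≅ F.obj.toFunctor.obj (obj .unit) :=
  (asIso (ε F.obj.toFunctor) :)

/-- The tensor constraint of a strong functor on a presented category. -/
noncomputable def tensIso (X Y : Word O) :
    F.obj.toFunctor.obj (obj X) ⊗ F.obj.toFunctor.obj (obj Y) ≅
      F.obj.toFunctor.obj (obj (X.tensor Y)) :=
  (asIso (μ F.obj.toFunctor (obj X) (obj Y)) :)

variable {F F'}

/-- The components at all words of a monoidal transformation with given components at the
letters. -/
noncomputable def extApp
    (a : ∀ x : O, F.obj.toFunctor.obj (obj (.of x)) ⟶ F'.obj.toFunctor.obj (obj (.of x))) :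
    ∀ X : Word O, F.obj.toFunctor.obj (obj X) ⟶ F'.obj.toFunctor.obj (obj X)
  | .of x => a x
  | .unit => (unitIso F).inv ≫ (unitIso F').hom
  | .tensor X Y => (tensIso F X Y).inv ≫ (extApp a X ⊗ₘ extApp a Y) ≫ (tensIso F' X Y).hom

variable (a : ∀ x : O, F.obj.toFunctor.obj (obj (.of x)) ⟶ F'.obj.toFunctor.obj (obj (.of x)))

theorem unitIso_extApp : (unitIso F).hom ≫ extApp a .unit = (unitIso F').hom :=
  Iso.hom_inv_id_assoc _ _

theorem tensIso_extApp (X Y : Word O) :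
    (tensIso F X Y).hom ≫ extApp a (X.tensor Y) =
      (extApp a X ⊗ₘ extApp a Y) ≫ (tensIso F' X Y).hom :=
  Iso.hom_inv_id_assoc _ _

variable {a}

/-- `extApp` is compatible with the constraints by construction, which gives naturality for all
structural morphisms; induction on formal morphisms then leaves only the generators. -/
theorem extApp_naturality (ha : ∀ {X Y : Word O} (f : G X Y),
      F.obj.toFunctor.map (homMk (.gen f)) ≫ extApp a Y =
        extApp a X ≫ F'.obj.toFunctor.map (homMk (.gen f))) {X Y : Word O} (f : Term G X Y) :
    F.obj.toFunctor.map (homMk f) ≫ extApp a Y =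
      extApp a X ≫ F'.obj.toFunctor.map (homMk f) := by
  -- The same family indexed by objects of the presented category instead of words, so that the
  -- naturality lemmas apply.
  let T : ∀ X : Presented R, F.obj.toFunctor.obj X ⟶ F'.obj.toFunctor.obj X := extApp a
  have hε : ε F.obj.toFunctor ≫ T (𝟙_ _) = ε F'.obj.toFunctor := unitIso_extApp a
  have hμ (X Y) : μ F.obj.toFunctor X Y ≫ T (X ⊗ Y) =
    (T X ⊗ₘ T Y) ≫ μ F'.obj.toFunctor X Y := tensIso_extApp a X Y
  have hid (X) : F.obj.toFunctor.map (𝟙 X) ≫ T X = T X ≫ F'.obj.toFunctor.map (𝟙 X) := by simp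
  induction f with
  | gen f => exact ha f
  | id X => exact hid X
  | α_hom X Y Z => exact natural_associator hμ X Y Z
  | α_inv X Y Z => exact natural_inv (α_ (obj X) (obj Y) (obj Z)) (natural_associator hμ X Y Z)
  | l_hom X => exact natural_leftUnitor hε hμ X
  | l_inv X => exact natural_inv (λ_ (obj X)) (natural_leftUnitor hε hμ X)
  | ρ_hom X => exact natural_rightUnitor hε hμ X
  | ρ_inv X => exact natural_inv (ρ_ (obj X)) (natural_rightUnitor hε hμ X)
  | swap X Y => exact natural_braiding hμ X Y
  | comp f g hf hg =>
    change F.obj.toFunctor.map (homMk f ≫ homMk g) ≫ _ = _ ≫ F'.obj.toFunctor.map (homMk f ≫ homMk g)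
    rw [Functor.map_comp, Functor.map_comp, Category.assoc, hg, reassoc_of% hf]
  | whiskerLeft X f hf =>
    have h := natural_tensorHom hμ (hid (obj X)) hf
    rwa [id_tensorHom] at h
  | whiskerRight f X hf =>
    have h := natural_tensorHom hμ hf (hid (obj X))
    rwa [tensorHom_id] at h
  | tensor f g hf hg => exact natural_tensorHom hμ hf hg

/-- The monoidal transformation with given components at the letters. -/
noncomputable def ext (ha : ∀ {X Y : Word O} (f : G X Y),
      F.obj.toFunctor.map (homMk (.gen f)) ≫ extApp a Y =
        extApp a X ≫ F'.obj.toFunctor.map (homMk (.gen f))) : F ⟶ F' :=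
  ObjectProperty.homMk ⟨⟨{
    app := extApp a
    naturality := by rintro X Y ⟨f⟩; exact extApp_naturality ha f },
    { unit := unitIso_extApp a, tensor := tensIso_extApp a }⟩⟩

/-- A monoidal transformation between strong functors on a presented category is determined by
its components at the letters. -/
theorem hom_ext_letters {s t : F ⟶ F'}
    (h : ∀ x : O, s.hom.hom.hom.app (obj (.of x)) = t.hom.hom.hom.app (obj (.of x))) : s = t := by
  ext X
  induction X using Word.rec with
  | of x => exact h x
  | unit =>
    refine (cancel_epi (unitIso F).hom).1 ?_
    exact (NatTrans.IsMonoidal.unit (τ := s.hom.hom.hom)).trans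
      (NatTrans.IsMonoidal.unit (τ := t.hom.hom.hom)).symm
  | tensor X Y hX hY =>
    refine (cancel_epi (tensIso F X Y).hom).1 ?_
    refine (NatTrans.IsMonoidal.tensor (τ := s.hom.hom.hom) (obj X) (obj Y)).trans
      (Eq.trans ?_ (NatTrans.IsMonoidal.tensor (τ := t.hom.hom.hom) (obj X) (obj Y)).symm)
    exact congrArg (· ≫ _) (congrArg₂ (· ⊗ₘ ·) hX hY)

end Presented
end Extension

/-- The bracketing used by `Term.middleSwap`; it matches the interchange relation with the
interchange axiom. -/
theorem tensorμ_eq {C : Type u₁} [Category.{v₁} C] [MonoidalCategory C] [BraidedCategory C]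
    (W X Y Z : C) : tensorμ W X Y Z = (α_ W X (Y ⊗ Z)).hom ≫
      W ◁ ((α_ X Y Z).inv ≫ (β_ X Y).hom ▷ Z ≫ (α_ Y X Z).hom) ≫ (α_ W Y (X ⊗ Z)).inv := by
  simp [tensorμ]

section

variable {M : Type u₁} [Category.{v₁} M] [MonoidalCategory M]

/-! ## The relations of the localized plus construction -/

namespace LocPlus

variable (S : Option (SymmetricCategory M))

theorem sound {X Y : Word (Arrow M)} {f g : Term (LocGen M) X Y} (h : NcRel S LocGen.nc f g) :
    (Presented.homMk f : (Presented.obj X : LocPlus S) ⟶ _) = Presented.homMk g :=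
  Quotient.sound (Eqv.rel (.nc h))

theorem iso_refl (f : Arrow M) : iso S (Iso.refl f) = 𝟙 _ := sound S (.iso_id f)

theorem iso_trans {f g h : Arrow M} (e : f ≅ g) (e' : g ≅ h) :
    iso S (e ≪≫ e') = iso S e ≫ iso S e' := sound S (.iso_comp e e')

theorem γ_equiv {X Y Z X' Y' Z' : M} (f : X ⟶ Y) (g : Y ⟶ Z) (f' : X' ⟶ Y') (g' : Y' ⟶ Z')
    (σ : X ≅ X') (τ : Y ≅ Y') (υ : Z ≅ Z')
    (hf : σ.hom ≫ f' = f ≫ τ.hom) (hg : τ.hom ≫ g' = g ≫ υ.hom) :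
    (iso S (sq g g' τ υ hg) ⊗ₘ iso S (sq f f' σ τ hf)) ≫ γ S f' g' =
      γ S f g ≫ iso S (sq (f ≫ g) (f' ≫ g') σ υ (by rw [reassoc_of% hf, hg, Category.assoc])) :=
  sound S (.γ_equiv f g f' g' σ τ υ hf hg)

theorem γ_assoc {X Y Z W : M} (f : X ⟶ Y) (g : Y ⟶ Z) (h : Z ⟶ W) :
    γ S g h ▷ _ ≫ γ S f (g ≫ h) =
      (α_ _ _ _).hom ≫ _ ◁ γ S f g ≫ γ S (f ≫ g) h ≫ iso S (sqEq (Category.assoc f g h)) :=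
  sound S (.γ_assoc f g h)

theorem μ_equiv {f f' g g' : Arrow M} (e : f ≅ f') (e' : g ≅ g') :
    (iso S e ⊗ₘ iso S e') ≫ μ S f' g' = μ S f g ≫ iso S (arrTensorIso e e') :=
  sound S (.μ_equiv e e')

theorem μ_assoc (f g h : Arrow M) :
    μ S f g ▷ _ ≫ μ S (arrTensor f g) h ≫ iso S (arrAssoc f g h) =
      (α_ _ _ _).hom ≫ _ ◁ μ S g h ≫ μ S f (arrTensor g h) :=
  sound S (.μ_assoc f g h)

theorem interchange {X Y Z X' Y' Z' : M}
    (f : X ⟶ Y) (g : Y ⟶ Z) (f' : X' ⟶ Y') (g' : Y' ⟶ Z') :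
    tensorμ (arr S (Arrow.mk g)) (arr S (Arrow.mk g')) (arr S (Arrow.mk f)) (arr S (Arrow.mk f')) ≫
      (γ S f g ⊗ₘ γ S f' g') ≫ μ S (Arrow.mk (f ≫ g)) (Arrow.mk (f' ≫ g')) ≫
        iso S (arrInterchange f g f' g') =
      (μ S (Arrow.mk g) (Arrow.mk g') ⊗ₘ μ S (Arrow.mk f) (Arrow.mk f')) ≫
        γ S (f ⊗ₘ f') (g ⊗ₘ g') := by
  rw [tensorμ_eq]
  exact (sound S (.interchange f g f' g'))

theorem commutator (s : SymmetricCategory M) (hs : S = some s) (f g : Arrow M) :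
    μ S f g ≫ iso S (arrBraiding s f g) = (β_ _ _).hom ≫ μ S g f :=
  sound S (.commutator s hs f g)

/-- The generator `μ` as an isomorphism. -/
def μIso (f g : Arrow M) : arr S f ⊗ arr S g ≅ arr S (arrTensor f g) where
  hom := μ S f g
  inv := Presented.homMk (.gen (.μInv f g))
  hom_inv_id := Quotient.sound (Eqv.rel (.μ_inv f g))
  inv_hom_id := Quotient.sound (Eqv.rel (.inv_μ f g))

end LocPlus

variable {E : Type u₂} [Category.{v₂} E] [MonoidalCategory E] [SymmetricCategory E]

/-! ## Strong indexing data -/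

namespace IndexingData

/-- The isomorphism of indexing data given by compatible isomorphisms of the fibres. -/
def isoMk {A A' : IndexingData M E} (κ : ∀ f : Arrow M, A.D.obj ⟨f⟩ ≅ A'.D.obj ⟨f⟩)
    (nat : ∀ {f g : Arrow M} (e : f ≅ g), A.D.map (X := ⟨f⟩) (Y := ⟨g⟩) ⟨e⟩ ≫ (κ g).hom =
      (κ f).hom ≫ A'.D.map (X := ⟨f⟩) (Y := ⟨g⟩) ⟨e⟩)
    (γ : ∀ {X Y Z : M} (f : X ⟶ Y) (g : Y ⟶ Z), A.γ f g ≫ (κ (Arrow.mk (f ≫ g))).hom =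
      ((κ (Arrow.mk g)).hom ⊗ₘ (κ (Arrow.mk f)).hom) ≫ A'.γ f g)
    (μ : ∀ f g : Arrow M, A.μ f g ≫ (κ (arrTensor f g)).hom =
      ((κ f).hom ⊗ₘ (κ g).hom) ≫ A'.μ f g)
    (ε : ∀ f : Arrow M, (κ f).hom ≫ A'.ε f = A.ε f) : A ≅ A' where
  hom := ⟨fun f => (κ f).hom, nat, γ, μ, ε⟩
  inv :=
    { app := fun f => (κ f).inv
      nat := fun e => by
        rw [Iso.comp_inv_eq, Category.assoc, nat, Iso.inv_hom_id_assoc]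
      γ := fun f g => by
        rw [Iso.comp_inv_eq, Category.assoc, γ, tensorHom_comp_tensorHom_assoc]
        simp
      μ := fun f g => by
        rw [Iso.comp_inv_eq, Category.assoc, μ, tensorHom_comp_tensorHom_assoc]
        simp
      ε := fun f => by rw [Iso.inv_comp_eq, ε] }
  hom_inv_id := Hom.ext (funext fun f => (κ f).hom_inv_id)
  inv_hom_id := Hom.ext (funext fun f => (κ f).inv_hom_id)

/-- Strong (symmetric) indexing data: the maps `μ` are isomorphisms and, when the symmetric
structure is part of the data, compatible with the commutativity constraints. -/
def isStrong (S : Option (SymmetricCategory M)) : ObjectProperty (IndexingData M E) := fun A =>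
  (∀ f g : Arrow M, IsIso (A.μ f g)) ∧
  ∀ s : SymmetricCategory M, S = some s → ∀ f g : Arrow M,
    A.μ f g ≫ A.D.map ⟨arrBraiding s f g⟩ = (β_ _ _).hom ≫ A.μ g f

end IndexingData

/-- The category of strong (symmetric) indexing data. -/
abbrev StrongIndexing (M : Type u₁) [Category.{v₁} M] [MonoidalCategory M]
    (E : Type u₂) [Category.{v₂} E] [MonoidalCategory E] [SymmetricCategory E]
    (S : Option (SymmetricCategory M)) :=
  (IndexingData.isStrong (M := M) (E := E) S).FullSubcategory

variable {S : Option (SymmetricCategory M)}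

/-! ## Functors on the localized plus construction as indexing data -/

section Restriction

open Functor.LaxMonoidal

/-- Gathers what follows the constraint under a single application of `F`, where a relation of
`M^{loc+}` can be rewritten. -/
theorem fibMul_comp_map {F : StrongFunctor (LocPlus S) E} {X Y Z : M} (f : X ⟶ Y) (g : Y ⟶ Z)
    {W : LocPlus S} (u : LocPlus.arr S (Arrow.mk (f ≫ g)) ⟶ W) :
    fibMul F f g ≫ F.obj.toFunctor.map u =
      μ F.obj.toFunctor _ _ ≫ F.obj.toFunctor.map (LocPlus.γ S f g ≫ u) := by
  rw [fibMul, Category.assoc, ← Functor.map_comp]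

theorem fibTensor_comp_map {F : StrongFunctor (LocPlus S) E} (f g : Arrow M)
    {W : LocPlus S} (u : LocPlus.arr S (arrTensor f g) ⟶ W) :
    fibTensor F f g ≫ F.obj.toFunctor.map u =
      μ F.obj.toFunctor _ _ ≫ F.obj.toFunctor.map (LocPlus.μ S f g ≫ u) := by
  rw [fibTensor, Category.assoc, ← Functor.map_comp]

section

variable (F : StrongFunctor (LocPlus S) E)

/-- The pattern for this and the following laws: apply `F` to a relation and move the generators
past the constraint by its naturality and coherence. -/
theorem fibMul_equiv {X Y Z X' Y' Z' : M} (f : X ⟶ Y) (g : Y ⟶ Z) (f' : X' ⟶ Y') (g' : Y' ⟶ Z')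
    (σ : X ≅ X') (τ : Y ≅ Y') (υ : Z ≅ Z')
    (hf : σ.hom ≫ f' = f ≫ τ.hom) (hg : τ.hom ≫ g' = g ≫ υ.hom) :
    (F.obj.toFunctor.map (LocPlus.iso S (sq g g' τ υ hg)) ⊗ₘ
        F.obj.toFunctor.map (LocPlus.iso S (sq f f' σ τ hf))) ≫ fibMul F f' g' =
      fibMul F f g ≫ F.obj.toFunctor.map (LocPlus.iso S (sq (f ≫ g) (f' ≫ g') σ υ
        (by rw [reassoc_of% hf, hg, Category.assoc]))) := by
  rw [fibMul_comp_map, ← LocPlus.γ_equiv S f g f' g' σ τ υ hf hg, fibMul, μ_natural_assoc,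
    ← Functor.map_comp]

theorem fibMul_assoc {X Y Z W : M} (f : X ⟶ Y) (g : Y ⟶ Z) (h : Z ⟶ W) :
    fibMul F g h ▷ fib F (Arrow.mk f) ≫ fibMul F f (g ≫ h) =
      (α_ _ _ _).hom ≫ fib F (Arrow.mk h) ◁ fibMul F f g ≫ fibMul F (f ≫ g) h ≫
        F.obj.toFunctor.map (LocPlus.iso S (sqEq (Category.assoc f g h))) := by
  rw [fibMul_comp_map, fibMul, fibMul, comp_whiskerRight_assoc, μ_natural_left_assoc,
    ← Functor.map_comp, LocPlus.γ_assoc, Functor.map_comp, associativity_assoc, fibMul,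
    MonoidalCategory.whiskerLeft_comp_assoc, μ_natural_right_assoc, ← Functor.map_comp]

theorem fibTensor_equiv {f f' g g' : Arrow M} (e : f ≅ f') (e' : g ≅ g') :
    (F.obj.toFunctor.map (LocPlus.iso S e) ⊗ₘ F.obj.toFunctor.map (LocPlus.iso S e')) ≫
        fibTensor F f' g' =
      fibTensor F f g ≫ F.obj.toFunctor.map (LocPlus.iso S (arrTensorIso e e')) := by
  rw [fibTensor_comp_map, ← LocPlus.μ_equiv, fibTensor, μ_natural_assoc, ← Functor.map_comp]

theorem fibTensor_assoc (f g h : Arrow M) :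
    fibTensor F f g ▷ fib F h ≫ fibTensor F (arrTensor f g) h ≫
        F.obj.toFunctor.map (LocPlus.iso S (arrAssoc f g h)) =
      (α_ _ _ _).hom ≫ fib F f ◁ fibTensor F g h ≫ fibTensor F f (arrTensor g h) := by
  rw [fibTensor_comp_map, fibTensor, comp_whiskerRight_assoc, μ_natural_left_assoc,
    ← Functor.map_comp, LocPlus.μ_assoc, Functor.map_comp, associativity_assoc, fibTensor,
    fibTensor, MonoidalCategory.whiskerLeft_comp_assoc, μ_natural_right_assoc, ← Functor.map_comp]

/-- The extra ingredient is that the constraints of a lax braided functor are compatible with the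
exchange of the two middle factors. -/
theorem fib_interchange {X Y Z X' Y' Z' : M}
    (f : X ⟶ Y) (g : Y ⟶ Z) (f' : X' ⟶ Y') (g' : Y' ⟶ Z') :
    tensorμ (fib F (Arrow.mk g)) (fib F (Arrow.mk g')) (fib F (Arrow.mk f))
        (fib F (Arrow.mk f')) ≫ (fibMul F f g ⊗ₘ fibMul F f' g') ≫
        fibTensor F (Arrow.mk (f ≫ g)) (Arrow.mk (f' ≫ g')) ≫
          F.obj.toFunctor.map (LocPlus.iso S (arrInterchange f g f' g')) =
      (fibTensor F (Arrow.mk g) (Arrow.mk g') ⊗ₘ fibTensor F (Arrow.mk f) (Arrow.mk f')) ≫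
        fibMul F (f ⊗ₘ f') (g ⊗ₘ g') := by
  rw [fibTensor_comp_map, fibMul, fibMul, ← tensorHom_comp_tensorHom_assoc, μ_natural_assoc,
    ← Functor.map_comp, tensorμ_comp_μ_tensorHom_μ_comp_μ_assoc, ← Functor.map_comp,
    LocPlus.interchange, Functor.map_comp]
  refine (congrArg (_ ≫ ·) (μ_natural_assoc F.obj.toFunctor (LocPlus.μ S (Arrow.mk g) (Arrow.mk g'))
    (LocPlus.μ S (Arrow.mk f) (Arrow.mk f')) _).symm).trans ?_
  exact tensorHom_comp_tensorHom_assoc _ _ _ _ _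

end

/-- The indexing data given by the values of a counital functor at the arrows. -/
def restrict (F : CounitalFunctor (LocPlus S) E) : IndexingData M E where
  D :=
    { obj f := fib F.left f.of
      map e := F.left.obj.toFunctor.map (LocPlus.iso S e.iso)
      map_id f := by
        refine (congrArg F.left.obj.toFunctor.map (LocPlus.iso_refl S f.of)).trans ?_
        exact F.left.obj.toFunctor.map_id _
      map_comp e e' := by
        refine (congrArg F.left.obj.toFunctor.map (LocPlus.iso_trans S e.iso e'.iso)).trans ?_
        exact F.left.obj.toFunctor.map_comp _ _ }
  γ f g := fibMul F.left f g
  γ_equiv := fibMul_equiv F.left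
  γ_assoc := fibMul_assoc F.left
  μ f g := fibTensor F.left f g
  μ_equiv := fibTensor_equiv F.left
  μ_assoc := fibTensor_assoc F.left
  interchange := fib_interchange F.left
  ε f := counit F f
  -- The trivial functor sends every morphism to an identity, which `Category.comp_id` removes.
  ε_act e := (F.hom.hom.hom.hom.naturality (LocPlus.iso S e)).trans (Category.comp_id _)
  ε_γ f g := by
    refine (Category.assoc _ _ _).trans ((congrArg (_ ≫ ·)
      ((F.hom.hom.hom.hom.naturality (LocPlus.γ S f g)).trans (Category.comp_id _))).trans ?_)
    exact NatTrans.IsMonoidal.tensor (τ := F.hom.hom.hom.hom) _ _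
  ε_μ f g := by
    refine (Category.assoc _ _ _).trans ((congrArg (_ ≫ ·)
      ((F.hom.hom.hom.hom.naturality (LocPlus.μ S f g)).trans (Category.comp_id _))).trans ?_)
    exact NatTrans.IsMonoidal.tensor (τ := F.hom.hom.hom.hom) _ _

/-- The product is the constraint followed by the image of the generator `μ`. The first is
invertible because `F` is strong, the second because `μ` is inverted in `M^{loc+}`. -/
theorem restrict_isStrong (F : CounitalFunctor (LocPlus S) E) :
    IndexingData.isStrong S (restrict F) := by
  refine ⟨fun f g => ?_, fun s hs f g => ?_⟩
  · exact ((Presented.tensIso F.left (.of f) (.of g)) ≪≫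
      F.left.obj.toFunctor.mapIso (LocPlus.μIso S f g)).isIso_hom
  · refine (fibTensor_comp_map f g (LocPlus.iso S (arrBraiding s f g))).trans ?_
    rw [LocPlus.commutator S s hs, Functor.map_comp, Functor.LaxBraided.braided_assoc]
    rfl

/-- Counital functors on the localized plus construction as strong indexing data. -/
def restriction : CounitalFunctor (LocPlus S) E ⥤ StrongIndexing M E S where
  obj F := ⟨restrict F, restrict_isStrong F⟩
  map {F F'} t := ObjectProperty.homMk
    { app f := t.left.hom.hom.hom.app (LocPlus.arr S f)
      nat e := t.left.hom.hom.hom.naturality (LocPlus.iso S e)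
      γ f g := by
        refine (Category.assoc _ _ _).trans ((congrArg (_ ≫ ·)
          (t.left.hom.hom.hom.naturality (LocPlus.γ S f g))).trans ?_)
        exact (NatTrans.IsMonoidal.tensor_assoc (τ := t.left.hom.hom.hom) _ _ _).trans rfl
      μ f g := by
        refine (Category.assoc _ _ _).trans ((congrArg (_ ≫ ·)
          (t.left.hom.hom.hom.naturality (LocPlus.μ S f g))).trans ?_)
        exact (NatTrans.IsMonoidal.tensor_assoc (τ := t.left.hom.hom.hom) _ _ _).trans rfl
      ε f := congrArg (fun u => u.hom.hom.hom.app (LocPlus.arr S f)) (Over.w t) }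
  map_id F := rfl
  map_comp t t' := rfl

instance : (restriction (M := M) (E := E) (S := S)).Faithful where
  map_injective {F F' t t'} h := by
    refine Over.OverMorphism.ext (Presented.hom_ext_letters fun f => ?_)
    exact congrArg (fun u => IndexingData.Hom.app (InducedCategory.Hom.hom u) f) h

/-- Compatibility with the generators of `M^{nc+}` implies compatibility with all generators of
`M^{loc+}`. -/
theorem extApp_naturality_generators {F F' : StrongFunctor (LocPlus S) E}
    (a : ∀ f : Arrow M, fib F f ⟶ fib F' f)
    (nat : ∀ {f g : Arrow M} (e : f ≅ g), F.obj.toFunctor.map (LocPlus.iso S e) ≫ a g =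
      a f ≫ F'.obj.toFunctor.map (LocPlus.iso S e))
    (γ : ∀ {X Y Z : M} (f : X ⟶ Y) (g : Y ⟶ Z), fibMul F f g ≫ a (Arrow.mk (f ≫ g)) =
      (a (Arrow.mk g) ⊗ₘ a (Arrow.mk f)) ≫ fibMul F' f g)
    (μ : ∀ f g : Arrow M, fibTensor F f g ≫ a (arrTensor f g) = (a f ⊗ₘ a g) ≫ fibTensor F' f g)
    {X Y : Word (Arrow M)} (g : LocGen M X Y) :
    F.obj.toFunctor.map (Presented.homMk (.gen g)) ≫ Presented.extApp a Y =
      Presented.extApp a X ≫ F'.obj.toFunctor.map (Presented.homMk (.gen g)) := by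
  -- Needed twice: for the generator `μ` itself and, through `natural_inv`, for its inverse.
  have hμ (f g : Arrow M) : F.obj.toFunctor.map (LocPlus.μ S f g) ≫ a (arrTensor f g) =
      Presented.extApp a ((Word.of f).tensor (.of g)) ≫ F'.obj.toFunctor.map (LocPlus.μ S f g) := by
    -- At a product of letters, `extApp` is `a ⊗ a` conjugated by the constraints; cancelling the
    -- constraint of `F` leaves the hypothesis.
    refine (cancel_epi (Presented.tensIso F (.of f) (.of g)).hom).1 ?_
    refine ((Category.assoc _ _ _).symm.trans (μ f g)).trans ?_
    refine Eq.trans ?_ (congrArg (· ≫ F'.obj.toFunctor.map (LocPlus.μ S f g))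
      (Presented.tensIso_extApp a (.of f) (.of g)).symm |>.trans (Category.assoc _ _ _))
    exact (Category.assoc _ _ _).symm
  match g with
  | .nc (.iso e) => exact nat e
  | .nc (.γ f g) =>
    refine (cancel_epi (Presented.tensIso F (.of (Arrow.mk g)) (.of (Arrow.mk f))).hom).1 ?_
    refine ((Category.assoc _ _ _).symm.trans (γ f g)).trans ?_
    refine Eq.trans ?_ (congrArg (· ≫ F'.obj.toFunctor.map (LocPlus.γ S f g))
      (Presented.tensIso_extApp a (.of (Arrow.mk g)) (.of (Arrow.mk f))).symm |>.trans
        (Category.assoc _ _ _))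
    exact (Category.assoc _ _ _).symm
  | .nc (.μ f g) => exact hμ f g
  | .μInv f g =>
    exact natural_inv (T := fun X : LocPlus S => Presented.extApp a X) (LocPlus.μIso S f g) (hμ f g)

instance : (restriction (M := M) (E := E) (S := S)).Full where
  map_surjective {F F'} t := by
    have h {X Y} (g : LocGen M X Y) := extApp_naturality_generators (F := F.left) (F' := F'.left)
      t.hom.app t.hom.nat t.hom.γ t.hom.μ g
    -- The triangle over the trivial functor need only commute at the letters, where it is the
    -- compatibility of `t` with the counits.
    refine ⟨Over.homMk (Presented.ext h) (Presented.hom_ext_letters t.hom.ε), ?_⟩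
    rfl

/-- The interpretation of the generators of `M^{loc+}` in strong indexing data. -/
noncomputable def LocGen.eval (A : StrongIndexing M E S) : ∀ {X Y : Word (Arrow M)}, LocGen M X Y →
    (X.eval (fun f => A.obj.D.obj ⟨f⟩) ⟶ Y.eval (fun f => A.obj.D.obj ⟨f⟩))
  | _, _, .nc (.iso e) => A.obj.D.map ⟨e⟩
  | _, _, .nc (.γ f g) => A.obj.γ f g
  | _, _, .nc (.μ f g) => A.obj.μ f g
  | _, _, .μInv f g => (@asIso _ _ _ _ (A.obj.μ f g) (A.property.1 f g)).inv

/-- Evaluated relations are the axioms of indexing data; strength accounts for `μ⁻¹` and symmetry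
for the commutator. -/
theorem LocRel.eval_eq (A : StrongIndexing M E S) ⦃X Y : Word (Arrow M)⦄
    (f f' : Term (LocGen M) X Y) (h : LocRel S f f') :
    f.eval (LocGen.eval A) = f'.eval (LocGen.eval A) := by
  cases h with
  | μ_inv f g => exact (@asIso _ _ _ _ (A.obj.μ f g) (A.property.1 f g)).hom_inv_id
  | inv_μ f g => exact (@asIso _ _ _ _ (A.obj.μ f g) (A.property.1 f g)).inv_hom_id
  | nc h =>
    cases h with
    | iso_id f => exact A.obj.D.map_id _
    | iso_comp e e' => exact A.obj.D.map_comp (X := ⟨_⟩) (Y := ⟨_⟩) (Z := ⟨_⟩) ⟨e⟩ ⟨e'⟩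
    | γ_equiv => exact A.obj.γ_equiv _ _ _ _ _ _ _ _ _
    | γ_assoc => exact A.obj.γ_assoc _ _ _
    | μ_equiv => exact A.obj.μ_equiv _ _
    | μ_assoc => exact A.obj.μ_assoc _ _ _
    | interchange f g f' g' =>
      have h := A.obj.interchange f g f' g'
      rw [tensorμ_eq] at h
      exact h
    | commutator s hs => exact A.property.2 s hs _ _

/-- Evaluation in `A` gives the functor. Its constraints are identities, so its fibrewise structure
is that of `A` up to composition with identities. -/
instance : (restriction (M := M) (E := E) (S := S)).EssSurj where
  mem_essImage A := by
    let F : StrongFunctor (LocPlus S) E := Presented.liftStrong (LocGen.eval A) (LocRel.eval_eq A)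
    have hγ {X Y Z : M} (f : X ⟶ Y) (g : Y ⟶ Z) : fibMul F f g = A.obj.γ f g :=
      Category.id_comp (A.obj.γ f g)
    have hμ (f g : Arrow M) : fibTensor F f g = A.obj.μ f g := Category.id_comp (A.obj.μ f g)
    -- The axioms on `ε` say that the counits are compatible with the generators as maps to the
    -- trivial functor, so they extend to a monoidal transformation.
    have h {X Y} (g : LocGen M X Y) := extApp_naturality_generators (F := F)
      (F' := trivialFunctor (LocPlus S) E) A.obj.ε
      (fun e => (A.obj.ε_act e).trans (Category.comp_id _).symm)
      (fun f g => (congrArg (· ≫ _) (hγ f g)).trans ((A.obj.ε_γ f g).trans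
        (congrArg (_ ≫ ·) (Category.comp_id _).symm)))
      (fun f g => (congrArg (· ≫ _) (hμ f g)).trans ((A.obj.ε_μ f g).trans
        (congrArg (_ ≫ ·) (Category.comp_id _).symm))) g
    refine ⟨Over.mk (Presented.ext h), ⟨ObjectProperty.isoMk _ (IndexingData.isoMk
      (fun f => Iso.refl (A.obj.D.obj ⟨f⟩)) ?_ ?_ ?_ ?_)⟩⟩
    · exact fun e => (Category.comp_id _).trans (Category.id_comp _).symm
    · intro X Y Z f g
      refine (Category.comp_id _).trans ((hγ f g).trans ?_)
      exact ((congrArg (· ≫ _) (id_tensorHom_id _ _)).trans (Category.id_comp _)).symm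
    · intro f g
      refine (Category.comp_id _).trans ((hμ f g).trans ?_)
      exact ((congrArg (· ≫ _) (id_tensorHom_id _ _)).trans (Category.id_comp _)).symm
    · exact fun f => Category.id_comp _

instance : (restriction (M := M) (E := E) (S := S)).IsEquivalence where

end Restriction
end

/-! ## Tensor products of coproducts -/

section TensorCoproducts

variable {E : Type u₂} [Category.{v₂} E] [MonoidalCategory E]

/-- A family of morphisms with common target that is jointly epimorphic, also after tensoring
with any object on the left. -/
def TensorEpi {I : Type w} {A : I → E} {B : E} (u : ∀ i, A i ⟶ B) : Prop :=
  ∀ ⦃W T : E⦄ (f g : W ⊗ B ⟶ T), (∀ i, W ◁ u i ≫ f = W ◁ u i ≫ g) → f = g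

theorem TensorEpi.hom_ext {I : Type w} {A : I → E} {B : E} {u : ∀ i, A i ⟶ B} (hu : TensorEpi u)
    {T : E} {f g : B ⟶ T} (h : ∀ i, u i ≫ f = u i ≫ g) : f = g := by
  -- The case where the auxiliary factor is the unit object.
  rw [← cancel_epi (λ_ B).hom]
  refine hu _ _ fun i => ?_
  rw [leftUnitor_naturality_assoc, leftUnitor_naturality_assoc, h]

/-- Tensoring a coproduct on the left. -/
noncomputable def isColimitWhiskerLeft {J : Type w} (W : E)
    [PreservesColimitsOfShape (Discrete J) (tensorLeft W)] {A : J → E} {B : E} {u : ∀ j, A j ⟶ B}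
    (hu : IsColimit (Cofan.mk B u)) : IsColimit (Cofan.mk (W ⊗ B) fun j => W ◁ u j) :=
  isColimitCofanMkObjOfIsColimit (tensorLeft W) A u hu

theorem TensorEpi.of_isColimit {J : Type w}
    [∀ W : E, PreservesColimitsOfShape (Discrete J) (tensorLeft W)] {A : J → E} {B : E}
    {u : ∀ j, A j ⟶ B} (hu : IsColimit (Cofan.mk B u)) : TensorEpi u := fun W _ _ _ h =>
  Cofan.IsColimit.hom_ext (isColimitWhiskerLeft W hu) _ _ h

/-- Determines `copowMul` on summands, which is all that is used of it. The inverse of the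
preservation isomorphism is the canonical comparison map, whose restriction to each summand is
known. -/
theorem ι_copowMul {J K L : Type w} [HasColimitsOfShape (Discrete J) E]
    [HasColimitsOfShape (Discrete K) E] [HasColimitsOfShape (Discrete L) E]
    [∀ A : E, PreservesColimitsOfShape (Discrete K) (tensorLeft A)] (op : J → K → L) (j : J)
    (k : K) : (Sigma.ι (fun _ : J => 𝟙_ E) j ⊗ₘ Sigma.ι (fun _ : K => 𝟙_ E) k) ≫
      copowMul E op = (λ_ (𝟙_ E)).hom ≫ Sigma.ι (fun _ : L => 𝟙_ E) (op j k) := by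
  have h : copow E J ◁ Sigma.ι (fun _ : K => 𝟙_ E) k ≫
      (PreservesCoproduct.iso (tensorLeft (copow E J)) (fun _ : K => 𝟙_ E)).hom =
        Sigma.ι (fun _ : K => copow E J ⊗ 𝟙_ E) k := by
    rw [← Iso.eq_comp_inv, PreservesCoproduct.inv_hom]
    exact (ι_comp_sigmaComparison (tensorLeft (copow E J)) (fun _ : K => 𝟙_ E) k).symm
  rw [copowMul, MonoidalCategory.tensorHom_def, Category.assoc, reassoc_of% h, Sigma.ι_desc,
    rightUnitor_naturality_assoc, Sigma.ι_desc, unitors_equal]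

theorem ι_copowMap {J K : Type w} [HasColimitsOfShape (Discrete J) E]
    [HasColimitsOfShape (Discrete K) E] (h : J → K) (j : J) :
    Sigma.ι (fun _ : J => 𝟙_ E) j ≫ copowMap E h = Sigma.ι (fun _ : K => 𝟙_ E) (h j) :=
  Sigma.ι_desc _ _

variable [SymmetricCategory E]

/-- Tensoring a coproduct on the right. -/
noncomputable def isColimitWhiskerRight {J : Type w} (W : E)
    [PreservesColimitsOfShape (Discrete J) (tensorLeft W)] {A : J → E} {B : E} {u : ∀ j, A j ⟶ B}
    (hu : IsColimit (Cofan.mk B u)) : IsColimit (Cofan.mk (B ⊗ W) fun j => u j ▷ W) :=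
  Cofan.IsColimit.mk _
    -- Only `W ⊗ -` is assumed to preserve coproducts; the symmetry carries this over to `- ⊗ W`.
    (fun s => (β_ B W).hom ≫ Cofan.IsColimit.desc (isColimitWhiskerLeft W hu)
      fun j => (β_ W (A j)).hom ≫ s.inj j)
    (fun s j => by
      change u j ▷ W ≫ (β_ B W).hom ≫ _ = _
      rw [BraidedCategory.braiding_naturality_left_assoc]
      have h := Cofan.IsColimit.fac (isColimitWhiskerLeft W hu)
        (fun j => (β_ W (A j)).hom ≫ s.inj j) j
      refine (congrArg (_ ≫ ·) h).trans ?_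
      rw [SymmetricCategory.symmetry_assoc])
    (fun s m hm => by
      rw [← cancel_epi (β_ W B).hom, SymmetricCategory.symmetry_assoc]
      refine Cofan.IsColimit.hom_ext (isColimitWhiskerLeft W hu) _ _ fun j => ?_
      rw [Cofan.IsColimit.fac]
      change W ◁ u j ≫ _ = _
      rw [BraidedCategory.braiding_naturality_right_assoc]
      exact congrArg (_ ≫ ·) (hm j))

/-- The auxiliary factor in `TensorEpi` makes the notion stable: test `u'` with `W ⊗ B` on its left,
exchange the two factors, then test `u` with `W ⊗ A' j` on its left. -/
theorem TensorEpi.tensor {I : Type w} {J : Type v₁} {A : I → E} {B : E} {u : ∀ i, A i ⟶ B}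
    {A' : J → E} {B' : E} {u' : ∀ j, A' j ⟶ B'} (hu : TensorEpi u) (hu' : TensorEpi u') :
    TensorEpi (fun p : I × J => u p.1 ⊗ₘ u' p.2) := by
  intro W T f g h
  rw [← cancel_epi (α_ W B B').hom]
  refine hu' _ _ fun j => ?_
  rw [associator_naturality_right_assoc, associator_naturality_right_assoc, cancel_epi,
    ← cancel_epi (W ◁ (β_ (A' j) B).hom), ← cancel_epi (α_ W (A' j) B).hom]
  refine hu _ _ fun i => ?_
  rw [associator_naturality_right_assoc, associator_naturality_right_assoc, cancel_epi,
    ← MonoidalCategory.whiskerLeft_comp_assoc,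
    ← MonoidalCategory.whiskerLeft_comp_assoc W (A' j ◁ u i) _ (W ◁ B ◁ u' j ≫ g),
    BraidedCategory.braiding_naturality_right, MonoidalCategory.whiskerLeft_comp_assoc,
    MonoidalCategory.whiskerLeft_comp_assoc, cancel_epi]
  have := h (i, j)
  dsimp only at this
  rwa [MonoidalCategory.tensorHom_def, MonoidalCategory.whiskerLeft_comp_assoc,
    MonoidalCategory.whiskerLeft_comp_assoc] at this

section Desc

variable {J K : Type w} [∀ W : E, PreservesColimitsOfShape (Discrete J) (tensorLeft W)]
  [∀ W : E, PreservesColimitsOfShape (Discrete K) (tensorLeft W)]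
  {A : J → E} {B : E} {u : ∀ j, A j ⟶ B} (hu : IsColimit (Cofan.mk B u))
  {A' : K → E} {B' : E} {u' : ∀ k, A' k ⟶ B'} (hu' : IsColimit (Cofan.mk B' u'))

/-- The morphism out of a tensor product of two coproducts given by a family of morphisms. -/
noncomputable def tensorDesc {T : E} (t : ∀ j k, A j ⊗ A' k ⟶ T) : B ⊗ B' ⟶ T :=
  Cofan.IsColimit.desc (isColimitWhiskerLeft B hu') fun k =>
    Cofan.IsColimit.desc (isColimitWhiskerRight (A' k) hu) fun j => t j k

theorem tensorDesc_fac {T : E} (t : ∀ j k, A j ⊗ A' k ⟶ T) (j : J) (k : K) :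
    (u j ⊗ₘ u' k) ≫ tensorDesc hu hu' t = t j k := by
  rw [MonoidalCategory.tensorHom_def, Category.assoc]
  have h₁ := Cofan.IsColimit.fac (isColimitWhiskerLeft B hu') (fun k =>
    Cofan.IsColimit.desc (isColimitWhiskerRight (A' k) hu) fun j => t j k) k
  have h₂ := Cofan.IsColimit.fac (isColimitWhiskerRight (A' k) hu) (fun j => t j k) j
  exact (congrArg (_ ≫ ·) h₁).trans h₂

end Desc

end TensorCoproducts

theorem map_sq_comp {M : Type u₁} [Category.{v₁} M] {E : Type u₂} [Category.{v₂} E]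
    {D : Core (Arrow M) ⥤ E} {X Y X' Y' X'' Y'' : M} {φ : X ⟶ Y} {φ' : X' ⟶ Y'} {φ'' : X'' ⟶ Y''}
    (σ : X ≅ X') (τ : Y ≅ Y') (σ' : X' ≅ X'') (τ' : Y' ≅ Y'')
    (h : σ.hom ≫ φ' = φ ≫ τ.hom) (h' : σ'.hom ≫ φ'' = φ' ≫ τ'.hom) :
    D.map (X := ⟨Arrow.mk φ⟩) (Y := ⟨Arrow.mk φ'⟩) ⟨sq φ φ' σ τ h⟩ ≫
        D.map (X := ⟨Arrow.mk φ'⟩) (Y := ⟨Arrow.mk φ''⟩) ⟨sq φ' φ'' σ' τ' h'⟩ =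
      D.map ⟨sq φ φ'' (σ ≪≫ σ') (τ ≪≫ τ') (by
        rw [Iso.trans_hom, Category.assoc, h', reassoc_of% h, Iso.trans_hom])⟩ := by
  rw [← D.map_comp]
  congr 1

/-! ## The bimodule monoid of indexing data -/

section Totalization

variable {M : Type u₁} [Category.{v₁} M] [MonoidalCategory M]
  {E : Type u₂} [Category.{v₂} E] [MonoidalCategory E] [SymmetricCategory E]
  [∀ X Y : M, HasColimitsOfShape (Discrete (X ⟶ Y)) E]

namespace IndexingData

variable (A : IndexingData M E)

/-- The object `∐_φ D(φ)`. -/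
noncomputable abbrev totObj (X Y : M) : E := ∐ fun φ : X ⟶ Y => A.D.obj ⟨Arrow.mk φ⟩

/-- The inclusion of a summand. -/
noncomputable abbrev totι {X Y : M} (φ : X ⟶ Y) : A.D.obj ⟨Arrow.mk φ⟩ ⟶ A.totObj X Y :=
  Sigma.ι (fun φ : X ⟶ Y => A.D.obj ⟨Arrow.mk φ⟩) φ

/-- A square with invertible sides determines its second arrow, but objects of `E` over
propositionally equal arrows are not interchangeable in types. Comparing after inclusion in the
coproduct avoids the transport. -/
theorem map_totι {X Y X' Y' : M} {φ : X ⟶ Y} {φ' φ'' : X' ⟶ Y'} {σ σ' : X ≅ X'} {τ τ' : Y ≅ Y'}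
    (h : σ.hom ≫ φ' = φ ≫ τ.hom) (h' : σ'.hom ≫ φ'' = φ ≫ τ'.hom) (hσ : σ = σ') (hτ : τ = τ') :
    A.D.map ⟨sq φ φ' σ τ h⟩ ≫ A.totι φ' = A.D.map ⟨sq φ φ'' σ' τ' h'⟩ ≫ A.totι φ'' := by
  subst hσ hτ
  obtain rfl : φ' = φ'' := by rw [← cancel_epi σ.hom, h, h']
  rfl

/-- The corrections by `(id ⇓ id)` in the axioms of indexing data disappear in the coproduct; hence
the axioms of bimodule monoids have none. -/
theorem map_sqEq_totι {X Y : M} {φ φ' : X ⟶ Y} (h : φ = φ') :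
    A.D.map ⟨sqEq h⟩ ≫ A.totι φ' = A.totι φ := by
  subst h
  exact (congrArg (· ≫ _) (A.D.map_id ⟨Arrow.mk φ⟩)).trans (Category.id_comp _)

/-- The action of a pair of isomorphisms on `∐_φ D(φ)`. -/
noncomputable def totAct {X Y X' Y' : M} (σ : X ≅ X') (τ : Y ≅ Y') :
    A.totObj X Y ⟶ A.totObj X' Y' :=
  Sigma.desc fun φ => A.D.map ⟨sq φ (σ.inv ≫ φ ≫ τ.hom) σ τ (by simp)⟩ ≫ A.totι _

/-- Any `φ'` that completes the square is allowed, so that targets need not be written as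
conjugates. -/
theorem totι_act {X Y X' Y' : M} (φ : X ⟶ Y) (φ' : X' ⟶ Y') (σ : X ≅ X') (τ : Y ≅ Y')
    (h : σ.hom ≫ φ' = φ ≫ τ.hom) :
    A.totι φ ≫ A.totAct σ τ = A.D.map ⟨sq φ φ' σ τ h⟩ ≫ A.totι φ' :=
  (Sigma.ι_desc _ _).trans (A.map_totι _ _ rfl rfl)

theorem totAct_comp {X Y X' Y' X'' Y'' : M} (σ : X ≅ X') (τ : Y ≅ Y') (σ' : X' ≅ X'')
    (τ' : Y' ≅ Y'') : A.totAct σ τ ≫ A.totAct σ' τ' = A.totAct (σ ≪≫ σ') (τ ≪≫ τ') := by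
  refine Sigma.hom_ext _ _ fun φ => ?_
  -- Only the commuting square is kept of the conjugate, which keeps later terms free of inverses.
  obtain ⟨φ', h⟩ : ∃ φ', σ.hom ≫ φ' = φ ≫ τ.hom := ⟨σ.inv ≫ φ ≫ τ.hom, by simp⟩
  obtain ⟨φ'', h'⟩ : ∃ φ'', σ'.hom ≫ φ'' = φ' ≫ τ'.hom := ⟨σ'.inv ≫ φ' ≫ τ'.hom, by simp⟩
  rw [reassoc_of% (A.totι_act φ φ' σ τ h), A.totι_act φ' φ'' σ' τ' h',
    reassoc_of% (map_sq_comp (D := A.D) σ τ σ' τ' h h')]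
  exact (A.totι_act φ φ'' _ _ _).symm

/-- The bimodule `(X, Y) ↦ ∐_φ D(φ)`. -/
noncomputable def totFunctor : (Core M)ᵒᵖ × Core M ⥤ E where
  obj p := A.totObj p.1.unop.of p.2.of
  -- The first variable is contravariant: the inverse leads from the old source to the new one, as
  -- in `bimodAct`.
  map m := A.totAct m.1.unop.iso.symm m.2.iso
  map_id p := by
    refine Sigma.hom_ext _ _ fun φ => ?_
    rw [A.totι_act φ φ _ _ (by simp), Category.comp_id]
    refine Eq.trans (congrArg (· ≫ _) ?_) (Category.id_comp _)
    exact A.D.map_id ⟨Arrow.mk φ⟩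
  map_comp m n := (A.totAct_comp m.1.unop.iso.symm m.2.iso n.1.unop.iso.symm n.2.iso).symm

/-- The morphism from `∐_φ D(φ)` to the free enrichment of `Hom_M`. -/
noncomputable def totb (X Y : M) : A.totObj X Y ⟶ copow E (X ⟶ Y) :=
  Sigma.desc fun φ => A.ε (Arrow.mk φ) ≫ Sigma.ι (fun _ : X ⟶ Y => 𝟙_ E) φ

theorem totι_b {X Y : M} (φ : X ⟶ Y) :
    A.totι φ ≫ A.totb X Y = A.ε (Arrow.mk φ) ≫ Sigma.ι (fun _ : X ⟶ Y => 𝟙_ E) φ :=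
  Sigma.ι_desc _ _

theorem totb_nat {X Y X' Y' : M} (σ : X ≅ X') (τ : Y ≅ Y') :
    A.totAct σ τ ≫ A.totb X' Y' = A.totb X Y ≫ copowMap E (fun φ => σ.inv ≫ φ ≫ τ.hom) := by
  refine Sigma.hom_ext _ _ fun φ => ?_
  rw [reassoc_of% (A.totι_act φ (σ.inv ≫ φ ≫ τ.hom) σ τ (by simp)), A.totι_b,
    reassoc_of% (A.totι_b φ), ι_copowMap]
  exact (Category.assoc _ _ _).symm.trans (congrArg (· ≫ _) (A.ε_act _))

variable [∀ (X Y : M) (A : E), PreservesColimitsOfShape (Discrete (X ⟶ Y)) (tensorLeft A)]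

theorem totι_tensorEpi (X Y : M) : TensorEpi (fun φ : X ⟶ Y => A.totι φ) :=
  TensorEpi.of_isColimit (coproductIsCoproduct _)

/-- The multiplication on `∐_φ D(φ)`. -/
noncomputable def totγ (X Y Z : M) : A.totObj Y Z ⊗ A.totObj X Y ⟶ A.totObj X Z :=
  tensorDesc (coproductIsCoproduct _) (coproductIsCoproduct _) fun (ψ : Y ⟶ Z) (φ : X ⟶ Y) =>
    A.γ φ ψ ≫ A.totι (φ ≫ ψ)

/-- The product over `⊗` on `∐_φ D(φ)`. -/
noncomputable def totμ (X Y X' Y' : M) :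
    A.totObj X Y ⊗ A.totObj X' Y' ⟶ A.totObj (X ⊗ X') (Y ⊗ Y') :=
  tensorDesc (coproductIsCoproduct _) (coproductIsCoproduct _) fun (φ : X ⟶ Y) (ψ : X' ⟶ Y') =>
    A.μ (Arrow.mk φ) (Arrow.mk ψ) ≫ A.totι (φ ⊗ₘ ψ)

theorem totι_γ {X Y Z : M} (φ : X ⟶ Y) (ψ : Y ⟶ Z) :
    (A.totι ψ ⊗ₘ A.totι φ) ≫ A.totγ X Y Z = A.γ φ ψ ≫ A.totι (φ ≫ ψ) :=
  tensorDesc_fac _ _ _ _ _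

theorem totι_μ {X Y X' Y' : M} (φ : X ⟶ Y) (ψ : X' ⟶ Y') :
    (A.totι φ ⊗ₘ A.totι ψ) ≫ A.totμ X Y X' Y' =
      A.μ (Arrow.mk φ) (Arrow.mk ψ) ≫ A.totι (φ ⊗ₘ ψ) :=
  tensorDesc_fac _ _ _ _ _

/-- As in all the laws that follow, both sides are compared on the summands, where the claim is the
corresponding axiom of `A`. -/
theorem totγ_nat {X Y Z X' Y' Z' : M} (σ : X ≅ X') (τ : Y ≅ Y') (υ : Z ≅ Z') :
    (A.totAct τ υ ⊗ₘ A.totAct σ τ) ≫ A.totγ X' Y' Z' = A.totγ X Y Z ≫ A.totAct σ υ := by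
  refine ((A.totι_tensorEpi Y Z).tensor (A.totι_tensorEpi X Y)).hom_ext fun ⟨ψ, φ⟩ => ?_
  obtain ⟨φ', h⟩ : ∃ φ', σ.hom ≫ φ' = φ ≫ τ.hom := ⟨σ.inv ≫ φ ≫ τ.hom, by simp⟩
  obtain ⟨ψ', h'⟩ : ∃ ψ', τ.hom ≫ ψ' = ψ ≫ υ.hom := ⟨τ.inv ≫ ψ ≫ υ.hom, by simp⟩
  have h'' : σ.hom ≫ (φ' ≫ ψ') = (φ ≫ ψ) ≫ υ.hom := by
    rw [reassoc_of% h, h', Category.assoc]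
  rw [tensorHom_comp_tensorHom_assoc, A.totι_act _ _ _ _ h, A.totι_act _ _ _ _ h',
    ← tensorHom_comp_tensorHom_assoc, A.totι_γ, reassoc_of% (A.totι_γ φ ψ),
    A.totι_act _ _ _ _ h'', reassoc_of% (A.γ_equiv φ ψ φ' ψ' σ τ υ h h')]

theorem totγ_assoc (X Y Z W : M) :
    A.totγ Y Z W ▷ A.totObj X Y ≫ A.totγ X Y W =
      (α_ _ _ _).hom ≫ A.totObj Z W ◁ A.totγ X Y Z ≫ A.totγ X Z W := by
  refine (((A.totι_tensorEpi Z W).tensor (A.totι_tensorEpi Y Z)).tensor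
    (A.totι_tensorEpi X Y)).hom_ext fun ⟨⟨χ, ψ⟩, φ⟩ => ?_
  have h := A.γ_assoc φ ψ χ
  have h' : A.D.map ⟨sqEq (Category.assoc φ ψ χ)⟩ ≫ A.totι (φ ≫ ψ ≫ χ) =
      A.totι ((φ ≫ ψ) ≫ χ) :=
    A.map_sqEq_totι _
  rw [← tensorHom_id, ← id_tensorHom, tensorHom_comp_tensorHom_assoc, A.totι_γ,
    associator_naturality_assoc, tensorHom_comp_tensorHom_assoc, A.totι_γ,
    -- Inserted identities let the tensor product split into a fibrewise factor followed by an
    -- inclusion.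
    Category.comp_id, Category.comp_id, ← Category.id_comp (A.totι φ),
    ← tensorHom_comp_tensorHom_assoc, A.totι_γ, ← Category.id_comp (A.totι χ),
    ← tensorHom_comp_tensorHom_assoc, A.totι_γ, tensorHom_id, id_tensorHom, reassoc_of% h, h']

theorem totμ_nat {X₁ Y₁ X₂ Y₂ X₁' Y₁' X₂' Y₂' : M}
    (σ₁ : X₁ ≅ X₁') (τ₁ : Y₁ ≅ Y₁') (σ₂ : X₂ ≅ X₂') (τ₂ : Y₂ ≅ Y₂') :
    (A.totAct σ₁ τ₁ ⊗ₘ A.totAct σ₂ τ₂) ≫ A.totμ X₁' Y₁' X₂' Y₂' =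
      A.totμ X₁ Y₁ X₂ Y₂ ≫ A.totAct (σ₁ ⊗ᵢ σ₂) (τ₁ ⊗ᵢ τ₂) := by
  refine ((A.totι_tensorEpi X₁ Y₁).tensor (A.totι_tensorEpi X₂ Y₂)).hom_ext fun ⟨φ, ψ⟩ => ?_
  obtain ⟨φ', h⟩ : ∃ φ', σ₁.hom ≫ φ' = φ ≫ τ₁.hom := ⟨σ₁.inv ≫ φ ≫ τ₁.hom, by simp⟩
  obtain ⟨ψ', h'⟩ : ∃ ψ', σ₂.hom ≫ ψ' = ψ ≫ τ₂.hom := ⟨σ₂.inv ≫ ψ ≫ τ₂.hom, by simp⟩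
  have h'' : (σ₁ ⊗ᵢ σ₂).hom ≫ (φ' ⊗ₘ ψ') = (φ ⊗ₘ ψ) ≫ (τ₁ ⊗ᵢ τ₂).hom := by
    rw [tensorIso_hom, tensorIso_hom, tensorHom_comp_tensorHom, tensorHom_comp_tensorHom, h, h']
  rw [tensorHom_comp_tensorHom_assoc, A.totι_act _ _ _ _ h, A.totι_act _ _ _ _ h',
    ← tensorHom_comp_tensorHom_assoc, A.totι_μ, reassoc_of% (A.totι_μ φ ψ),
    A.totι_act _ _ _ _ h'']
  exact congrArg (· ≫ A.totι (φ' ⊗ₘ ψ')) (A.μ_equiv (sq φ φ' σ₁ τ₁ h) (sq ψ ψ' σ₂ τ₂ h'))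
    |> fun e => (Category.assoc _ _ _).symm.trans (e.trans (Category.assoc _ _ _))

theorem totμ_assoc (X₁ Y₁ X₂ Y₂ X₃ Y₃ : M) :
    A.totμ X₁ Y₁ X₂ Y₂ ▷ A.totObj X₃ Y₃ ≫ A.totμ (X₁ ⊗ X₂) (Y₁ ⊗ Y₂) X₃ Y₃ ≫
        A.totAct (α_ X₁ X₂ X₃) (α_ Y₁ Y₂ Y₃) =
      (α_ _ _ _).hom ≫ A.totObj X₁ Y₁ ◁ A.totμ X₂ Y₂ X₃ Y₃ ≫
        A.totμ X₁ Y₁ (X₂ ⊗ X₃) (Y₂ ⊗ Y₃) := by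
  refine (((A.totι_tensorEpi X₁ Y₁).tensor (A.totι_tensorEpi X₂ Y₂)).tensor
    (A.totι_tensorEpi X₃ Y₃)).hom_ext fun ⟨⟨φ₁, φ₂⟩, φ₃⟩ => ?_
  have h := A.μ_assoc (Arrow.mk φ₁) (Arrow.mk φ₂) (Arrow.mk φ₃)
  rw [← tensorHom_id, ← id_tensorHom, tensorHom_comp_tensorHom_assoc, A.totι_μ,
    associator_naturality_assoc, tensorHom_comp_tensorHom_assoc, A.totι_μ,
    Category.comp_id, Category.comp_id, ← Category.id_comp (A.totι φ₃),
    ← tensorHom_comp_tensorHom_assoc, reassoc_of% (A.totι_μ (φ₁ ⊗ₘ φ₂) φ₃),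
    ← Category.id_comp (A.totι φ₁), ← tensorHom_comp_tensorHom_assoc,
    A.totι_μ, tensorHom_id, id_tensorHom,
    A.totι_act _ (φ₁ ⊗ₘ φ₂ ⊗ₘ φ₃) _ _ (by simp)]
  have e := h =≫ A.totι (φ₁ ⊗ₘ φ₂ ⊗ₘ φ₃)
  simp only [Category.assoc] at e
  exact e

theorem tot_interchange (X Y Z X' Y' Z' : M) :
    tensorμ (A.totObj Y Z) (A.totObj Y' Z') (A.totObj X Y) (A.totObj X' Y') ≫
        (A.totγ X Y Z ⊗ₘ A.totγ X' Y' Z') ≫ A.totμ X Z X' Z' =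
      (A.totμ Y Z Y' Z' ⊗ₘ A.totμ X Y X' Y') ≫ A.totγ (X ⊗ X') (Y ⊗ Y') (Z ⊗ Z') := by
  refine (((A.totι_tensorEpi Y Z).tensor (A.totι_tensorEpi Y' Z')).tensor
    ((A.totι_tensorEpi X Y).tensor (A.totι_tensorEpi X' Y'))).hom_ext
      fun ⟨⟨ψ, ψ'⟩, ⟨φ, φ'⟩⟩ => ?_
  have h := A.interchange φ ψ φ' ψ'
  rw [tensorμ_natural_assoc, tensorHom_comp_tensorHom_assoc, A.totι_γ, A.totι_γ,
    ← tensorHom_comp_tensorHom_assoc, A.totι_μ, tensorHom_comp_tensorHom_assoc, A.totι_μ, A.totι_μ,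
    ← tensorHom_comp_tensorHom_assoc, A.totι_γ]
  have h' : A.D.map ⟨arrInterchange φ ψ φ' ψ'⟩ ≫ A.totι ((φ ⊗ₘ φ') ≫ (ψ ⊗ₘ ψ')) =
      A.totι ((φ ≫ ψ) ⊗ₘ (φ' ≫ ψ')) := A.map_sqEq_totι (by simp)
  have e := h =≫ A.totι ((φ ⊗ₘ φ') ≫ (ψ ⊗ₘ ψ'))
  simp only [Category.assoc, h'] at e
  exact e

/-- The bimodule monoid `(X, Y) ↦ ∐_φ D(φ)`. -/
noncomputable def totMonoid : BimoduleMonoid M E where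
  ρ := A.totFunctor
  γ := A.totγ
  γ_nat := A.totγ_nat
  γ_assoc := A.totγ_assoc
  μ := A.totμ
  μ_nat := A.totμ_nat
  μ_assoc := A.totμ_assoc
  interchange := A.tot_interchange

theorem totb_γ (X Y Z : M) : A.totγ X Y Z ≫ A.totb X Z =
    (A.totb Y Z ⊗ₘ A.totb X Y) ≫ copowMul E (fun (ψ : Y ⟶ Z) (φ : X ⟶ Y) => φ ≫ ψ) := by
  refine ((A.totι_tensorEpi Y Z).tensor (A.totι_tensorEpi X Y)).hom_ext fun ⟨ψ, φ⟩ => ?_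
  rw [reassoc_of% (A.totι_γ φ ψ), A.totι_b, reassoc_of% (A.ε_γ φ ψ),
    tensorHom_comp_tensorHom_assoc, A.totι_b, A.totι_b, ← tensorHom_comp_tensorHom_assoc,
    ι_copowMul]

theorem totb_μ (X Y X' Y' : M) : A.totμ X Y X' Y' ≫ A.totb (X ⊗ X') (Y ⊗ Y') =
    (A.totb X Y ⊗ₘ A.totb X' Y') ≫ copowMul E (fun (φ : X ⟶ Y) (ψ : X' ⟶ Y') => φ ⊗ₘ ψ) := by
  refine ((A.totι_tensorEpi X Y).tensor (A.totι_tensorEpi X' Y')).hom_ext fun ⟨φ, ψ⟩ => ?_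
  have h := A.ε_μ (Arrow.mk φ) (Arrow.mk ψ)
  rw [reassoc_of% (A.totι_μ φ ψ), A.totι_b,
    tensorHom_comp_tensorHom_assoc, A.totι_b, A.totι_b, ← tensorHom_comp_tensorHom_assoc,
    ι_copowMul]
  have e := h =≫ Sigma.ι (fun _ : X ⊗ X' ⟶ Y ⊗ Y' => 𝟙_ E) (φ ⊗ₘ ψ)
  simp only [Category.assoc] at e
  exact e

/-- The bimodule monoid over `Hom_M` with given fibres. -/
noncomputable def tot : BimoduleOver M E where
  tot :=
    { A.totMonoid with
      b := A.totb
      b_nat := A.totb_nat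
      b_γ := A.totb_γ
      b_μ := A.totb_μ }
  fib := A
  ι φ := A.totι φ
  isCoproduct _ _ := coproductIsCoproduct _
  ι_act := A.totι_act
  ι_γ := A.totι_γ
  ι_μ := A.totι_μ
  ι_b := A.totι_b

end IndexingData
end Totalization

section

variable {M : Type u₁} [Category.{v₁} M] [MonoidalCategory M]
  {E : Type u₂} [Category.{v₂} E] [MonoidalCategory E] [SymmetricCategory E]
  [∀ X Y : M, HasColimitsOfShape (Discrete (X ⟶ Y)) E]
  [∀ (X Y : M) (A : E), PreservesColimitsOfShape (Discrete (X ⟶ Y)) (tensorLeft A)]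
  {S : Option (SymmetricCategory M)}

/-! ## Bimodule monoids over `Hom_M` are determined by their fibres -/

namespace BimoduleOver

theorem ι_tensorEpi (B : BimoduleOver M E) (X Y : M) : TensorEpi (fun φ : X ⟶ Y => B.ι φ) :=
  TensorEpi.of_isColimit (B.isCoproduct X Y)

/-- The functor that takes a bimodule monoid over `Hom_M` to its fibres. -/
def fibres : BimoduleOver M E ⥤ IndexingData M E where
  obj B := B.fib
  map f := Hom.fib f

variable {B B' : BimoduleOver M E} (a : B.fib ⟶ B'.fib)

/-- The coproduct of the components of a morphism of fibres. -/
noncomputable def sumApp (X Y : M) : B.tot.at' X Y ⟶ B'.tot.at' X Y :=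
  Cofan.IsColimit.desc (B.isCoproduct X Y) fun φ =>
    IndexingData.Hom.app a (Arrow.mk φ) ≫ B'.ι φ

theorem ι_sumApp {X Y : M} (φ : X ⟶ Y) :
    B.ι φ ≫ sumApp a X Y = IndexingData.Hom.app a (Arrow.mk φ) ≫ B'.ι φ :=
  Cofan.IsColimit.fac (B.isCoproduct X Y) _ φ

/-- The morphism of bimodule monoids over `Hom_M` with given components at the fibres. -/
noncomputable def homOfFib : B ⟶ B' where
  tot :=
    { hom :=
        { app := sumApp a
          nat {X Y X' Y'} σ τ := by
            refine (B.ι_tensorEpi X Y).hom_ext fun φ => ?_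
            have h : σ.hom ≫ (σ.inv ≫ φ ≫ τ.hom) = φ ≫ τ.hom := by simp
            rw [reassoc_of% (B.ι_act φ _ σ τ h), ι_sumApp, reassoc_of% (ι_sumApp a φ),
              B'.ι_act φ _ σ τ h, reassoc_of% (a.nat (sq φ _ σ τ h))]
          γ X Y Z := by
            refine ((B.ι_tensorEpi Y Z).tensor (B.ι_tensorEpi X Y)).hom_ext fun ⟨ψ, φ⟩ => ?_
            rw [reassoc_of% (B.ι_γ φ ψ), ι_sumApp, tensorHom_comp_tensorHom_assoc, ι_sumApp,
              ι_sumApp, ← tensorHom_comp_tensorHom_assoc, B'.ι_γ, reassoc_of% (a.γ φ ψ)]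
          μ X Y X' Y' := by
            refine ((B.ι_tensorEpi X Y).tensor (B.ι_tensorEpi X' Y')).hom_ext fun ⟨φ, ψ⟩ => ?_
            rw [reassoc_of% (B.ι_μ φ ψ), ι_sumApp, tensorHom_comp_tensorHom_assoc, ι_sumApp,
              ι_sumApp, ← tensorHom_comp_tensorHom_assoc, B'.ι_μ]
            have e := a.μ (Arrow.mk φ) (Arrow.mk ψ) =≫ B'.ι (φ ⊗ₘ ψ)
            simp only [Category.assoc] at e
            exact e }
      w X Y := by
        refine (B.ι_tensorEpi X Y).hom_ext fun φ => ?_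
        rw [reassoc_of% (ι_sumApp a φ), B'.ι_b, B.ι_b, reassoc_of% (a.ε (Arrow.mk φ))] }
  fib := a
  w φ := ι_sumApp a φ

/-- The inclusions of the fibres are jointly epimorphic, so the total map is forced. -/
theorem hom_ext_fib {f g : B ⟶ B'} (h : Hom.fib f = Hom.fib g) : f = g := by
  refine Hom.ext (SliceMonoid.Hom.ext (BimoduleMonoid.Hom.ext ?_)) h
  funext X Y
  refine (B.ι_tensorEpi X Y).hom_ext fun φ => ?_
  rw [f.w, g.w, h]

instance : (fibres (M := M) (E := E)).Faithful where
  map_injective h := hom_ext_fib h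

instance : (fibres (M := M) (E := E)).Full where
  map_surjective a := ⟨homOfFib a, rfl⟩

/-- Symmetry of the total product is thus no condition beyond symmetry on the fibres. -/
theorem isSymm_of_fib (B : BimoduleOver M E)
    (h : ∀ s : SymmetricCategory M, S = some s → ∀ f g : Arrow M,
      B.fib.μ f g ≫ B.fib.D.map ⟨arrBraiding s f g⟩ = (β_ _ _).hom ≫ B.fib.μ g f) :
    B.tot.toBimoduleMonoid.IsSymm S := by
  intro s hs X Y X' Y'
  refine ((B.ι_tensorEpi X Y).tensor (B.ι_tensorEpi X' Y')).hom_ext fun ⟨φ, ψ⟩ => ?_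
  have e := h s hs (Arrow.mk φ) (Arrow.mk ψ) =≫ B.ι (ψ ⊗ₘ φ)
  rw [reassoc_of% (B.ι_μ φ ψ), B.ι_act (φ ⊗ₘ ψ) (ψ ⊗ₘ φ) _ _ (by simp),
    BraidedCategory.braiding_naturality_assoc, B.ι_μ]
  simp only [Category.assoc] at e
  exact e

end BimoduleOver

/-! ## Totalization -/

/-- Strong indexing data as a strong bimodule monoid over `Hom_M`. -/
noncomputable def totalization : StrongIndexing M E S ⥤ StrongBimoduleOver M E S where
  obj A := ⟨A.obj.tot, A.property.1, A.property.2, BimoduleOver.isSymm_of_fib _ A.property.2⟩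
  map a := ObjectProperty.homMk (BimoduleOver.homOfFib (B := IndexingData.tot _)
    (B' := IndexingData.tot _) a.hom)
  map_id _ := ObjectProperty.hom_ext _ (BimoduleOver.hom_ext_fib rfl)
  map_comp _ _ := ObjectProperty.hom_ext _ (BimoduleOver.hom_ext_fib rfl)

instance : (totalization (M := M) (E := E) (S := S)).Faithful where
  map_injective h := ObjectProperty.hom_ext _
    (congrArg (fun u => BimoduleOver.Hom.fib (InducedCategory.Hom.hom u)) h)

instance : (totalization (M := M) (E := E) (S := S)).Full where
  map_surjective a := ⟨ObjectProperty.homMk (BimoduleOver.Hom.fib a.hom),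
    ObjectProperty.hom_ext _ (BimoduleOver.hom_ext_fib rfl)⟩

instance : (totalization (M := M) (E := E) (S := S)).EssSurj where
  mem_essImage B := ⟨⟨B.obj.fib, B.property.1, B.property.2.1⟩,
    -- `B` and the coproduct of its fibres have equal fibres, and `fibres` is fully faithful.
    ⟨ObjectProperty.isoMk _ (BimoduleOver.fibres.preimageIso (Iso.refl B.obj.fib))⟩⟩

instance : (totalization (M := M) (E := E) (S := S)).IsEquivalence where

/-! ## The comparison -/

section

variable (M E S)

/-- Counital functors on `M^{loc+}` are equivalent to strong bimodule monoids over `Hom_M`. -/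
noncomputable def counitalEquivalence :
    CounitalFunctor (LocPlus S) E ≌ StrongBimoduleOver M E S :=
  (restriction ⋙ totalization).asEquivalence

/-- The fibres of the bimodule monoid of a counital functor are the values of the functor. -/
noncomputable def counitalComparison : FibreComparison (Over.forget (trivialFunctor (LocPlus S) E))
    ((counitalEquivalence M E S).functor ⋙ (BimoduleOver.isStrong S).ι) where
  -- Neither restriction nor totalization changes the values at the arrows.
  κ F f := Iso.refl (fib F.left f)
  natural _ _ := (Category.comp_id _).trans (Category.id_comp _).symm
  act _ _ _ _ := (Category.comp_id _).trans (Category.id_comp _).symm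
  γ _ _ _ _ _ _ := (Category.comp_id _).trans
    ((congrArg (· ≫ _) (id_tensorHom_id _ _)).trans (Category.id_comp _)).symm
  μ _ _ _ := (Category.comp_id _).trans
    ((congrArg (· ≫ _) (id_tensorHom_id _ _)).trans (Category.id_comp _)).symm

end

end

/-! ### The Cartesian case: counits are unique. -/

section Cartesian

variable {M : Type u₁} [Category.{v₁} M] [MonoidalCategory M]
  {E : Type u₂} [Category.{v₂} E] [CartesianMonoidalCategory E] [SymmetricCategory E]
  {S : Option (SymmetricCategory M)}

/-- In the Cartesian case the trivial functor is terminal. -/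
def trivialIsTerminal : IsTerminal (trivialFunctor (LocPlus S) E) :=
  IsTerminal.ofUniqueHom
    (fun _ => ObjectProperty.homMk ⟨⟨
      { app _ := CartesianMonoidalCategory.toUnit _
        naturality _ _ _ := CartesianMonoidalCategory.toUnit_unique _ _ },
      { unit := CartesianMonoidalCategory.toUnit_unique _ _
        tensor _ _ := CartesianMonoidalCategory.toUnit_unique _ _ }⟩⟩)
    (fun _ _ => Presented.hom_ext_letters fun _ => CartesianMonoidalCategory.toUnit_unique _ _)

variable [∀ X Y : M, HasColimitsOfShape (Discrete (X ⟶ Y)) E]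
  [∀ (X Y : M) (A : E), PreservesColimitsOfShape (Discrete (X ⟶ Y)) (tensorLeft A)]

variable (M E S) in
/-- In the Cartesian case functors on `M^{loc+}` are equivalent to strong bimodule monoids over
`Hom_M`. -/
noncomputable def cartesianEquivalence : StrongFunctor (LocPlus S) E ≌ StrongBimoduleOver M E S :=
  -- A slice over a terminal object is the whole category.
  (Over.equivalenceOfIsTerminal trivialIsTerminal).symm.trans (counitalEquivalence M E S)

variable (M E S) in
/-- The fibres of the bimodule monoid of a functor are the values of the functor. -/
noncomputable def cartesianComparison : FibreComparison (𝟭 (StrongFunctor (LocPlus S) E))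
    ((cartesianEquivalence M E S).functor ⋙ (BimoduleOver.isStrong S).ι) where
  κ F f := Iso.refl (fib F f)
  natural _ _ := (Category.comp_id _).trans (Category.id_comp _).symm
  act _ _ _ _ := (Category.comp_id _).trans (Category.id_comp _).symm
  γ _ _ _ _ _ _ := (Category.comp_id _).trans
    ((congrArg (· ≫ _) (id_tensorHom_id _ _)).trans (Category.id_comp _)).symm
  μ _ _ _ := (Category.comp_id _).trans
    ((congrArg (· ≫ _) (id_tensorHom_id _ _)).trans (Category.id_comp _)).symm

end Cartesian

/-! ## Extensive coproducts -/

namespace ExtensiveCoproducts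

variable {J : Type w} {E : Type u₂} [Category.{v₂} E] [HasColimitsOfShape (Discrete J) E]
  (h : ExtensiveCoproducts J E) {A : J → E} {T : E} {t : ∀ j, A j ⟶ T}
  (hT : IsColimit (Cofan.mk T t))
include h hT

theorem isVanKampenColimit : IsVanKampenColimit (Cofan.mk T t) :=
  (h.vanKampen A).of_iso ((colimit.isColimit _).uniqueUpToIso hT)

theorem hasPullback_of_isColimit (j : J) {Z : E} (g : Z ⟶ T) : HasPullback g (t j) := by
  let e : T ≅ ∐ A := hT.coconePointUniqueUpToIso (colimit.isColimit _)
  have he : t j ≫ e.hom = Sigma.ι A j :=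
    hT.comp_coconePointUniqueUpToIso_hom (colimit.isColimit _) ⟨j⟩
  have := h.hasPullback A j (g ≫ e.hom)
  rw [← he] at this
  -- Composing the cospan with the isomorphism `e.inv` returns to the given coproduct.
  have := hasPullback_of_comp_mono (g ≫ e.hom) (t j ≫ e.hom) e.inv
  simpa using this

/-- The van Kampen property for a discrete diagram, where every transformation is equifibered. -/
theorem isColimit_iff {P : E} {A' : J → E} (p : ∀ j, A' j ⟶ P) (b : P ⟶ T) (e : ∀ j, A' j ⟶ A j)
    (w : ∀ j, p j ≫ b = e j ≫ t j) :
    Nonempty (IsColimit (Cofan.mk P p)) ↔ ∀ j, IsPullback (p j) (e j) b (t j) := by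
  refine (h.isVanKampenColimit hT (Cofan.mk P p) (Discrete.natTrans fun j => e j.as) b ?_
    (NatTrans.Equifibered.of_discrete _)).trans ⟨fun H j => H ⟨j⟩, fun H j => H j.as⟩
  ext j
  exact (w j.as).symm

/-- A square over an extensive coproduct is a pull-back if it is one over every summand. -/
theorem isPullback_of_summands {P Q R : E} {A' : J → E} {p : ∀ j, A' j ⟶ P}
    (hP : IsColimit (Cofan.mk P p)) {b : P ⟶ T} {e : ∀ j, A' j ⟶ A j}
    (w : ∀ j, p j ≫ b = e j ≫ t j) {q : P ⟶ Q} {r : Q ⟶ R} {s : T ⟶ R} (sq : q ≫ r = b ≫ s)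
    (H : ∀ j, IsPullback (p j ≫ q) (e j) r (t j ≫ s)) : IsPullback q b r s := by
  have hp := (h.isColimit_iff hT p b e w).1 ⟨hP⟩
  -- Every object over `T` is the coproduct of its pull-backs to the summands, so maps out of a test
  -- object can be glued.
  have cov {W : E} (y : W ⟶ T) : ∃ (A'' : J → E) (k : ∀ j, A'' j ⟶ W) (l : ∀ j, A'' j ⟶ A j),
      (∀ j, k j ≫ y = l j ≫ t j) ∧ Nonempty (IsColimit (Cofan.mk W k)) := by
    have (j : J) : HasPullback y (t j) := h.hasPullback_of_isColimit hT j y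
    exact ⟨fun j => pullback y (t j), fun j => pullback.fst _ _, fun j => pullback.snd _ _,
      fun j => pullback.condition, (h.isColimit_iff hT _ y _ fun j => pullback.condition).2
        fun j => IsPullback.of_hasPullback _ _⟩
  refine ⟨⟨sq⟩, ⟨PullbackCone.isLimitAux' _ fun c => ?_⟩⟩
  -- The goal is data, while `cov` gives mere existence; the step passes to a proposition.
  apply Classical.indefiniteDescription (p := fun l : c.pt ⟶ P => l ≫ q = c.fst ∧ l ≫ b = c.snd ∧
    ∀ {m : c.pt ⟶ P}, m ≫ q = c.fst → m ≫ b = c.snd → m = l)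
  obtain ⟨A'', k, l, hkl, ⟨hk⟩⟩ := cov c.snd
  have hw (j : J) : (k j ≫ c.fst) ≫ r = l j ≫ t j ≫ s := by
    rw [Category.assoc, c.condition, reassoc_of% (hkl j)]
  refine ⟨Cofan.IsColimit.desc hk fun j => (H j).lift (k j ≫ c.fst) (l j) (hw j) ≫ p j,
    ?_, ?_, ?_⟩
  · refine Cofan.IsColimit.hom_ext hk _ _ fun j => ?_
    rw [Cofan.IsColimit.fac_assoc, Category.assoc, (H j).lift_fst]
    rfl
  · refine Cofan.IsColimit.hom_ext hk _ _ fun j => ?_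
    rw [Cofan.IsColimit.fac_assoc, Category.assoc, w, (H j).lift_snd_assoc]
    exact (hkl j).symm
  · intro m hq hb
    refine Cofan.IsColimit.hom_ext hk _ _ fun j => ?_
    rw [Cofan.IsColimit.fac]
    have hm : (k j ≫ m) ≫ b = l j ≫ t j := by rw [Category.assoc, hb, hkl]
    -- A competing map `m`, restricted to `k j`, factors through `p j` because `P` is also
    -- decomposed over `T`; the factor is then fixed by `H j`.
    refine ((hp j).lift_fst _ _ hm).symm.trans (congrArg (· ≫ p j) ?_)
    refine (H j).hom_ext ?_ ?_
    · rw [(hp j).lift_fst_assoc, (H j).lift_fst, Category.assoc, hq]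
    · rw [(hp j).lift_snd, (H j).lift_snd]

end ExtensiveCoproducts

/-! ### Extensive coproducts: the fibres are determined by the map to `Hom_M`. -/

section Cartesian

open CartesianMonoidalCategory

variable {M : Type u₁} [Category.{v₁} M] [MonoidalCategory M]
  {E : Type u₂} [Category.{v₂} E] [CartesianMonoidalCategory E]

/-- Here `⊗` is the product, and the universal property is checked componentwise. -/
theorem isPullback_tensorHom {P X Y Z P' X' Y' Z' : E} {f : P ⟶ X} {g : P ⟶ Y} {h : X ⟶ Z}
    {k : Y ⟶ Z} {f' : P' ⟶ X'} {g' : P' ⟶ Y'} {h' : X' ⟶ Z'} {k' : Y' ⟶ Z'}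
    (H : IsPullback f g h k) (H' : IsPullback f' g' h' k') :
    IsPullback (f ⊗ₘ f') (g ⊗ₘ g') (h ⊗ₘ h') (k ⊗ₘ k') := by
  refine ⟨⟨by rw [tensorHom_comp_tensorHom, tensorHom_comp_tensorHom, H.w, H'.w]⟩,
    ⟨PullbackCone.isLimitAux' _ fun c => ?_⟩⟩
  have w₁ : (c.fst ≫ fst X X') ≫ h = (c.snd ≫ fst Y Y') ≫ k := by
    simpa using c.condition =≫ fst Z Z'
  have w₂ : (c.fst ≫ snd X X') ≫ h' = (c.snd ≫ snd Y Y') ≫ k' := by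
    simpa using c.condition =≫ snd Z Z'
  refine ⟨lift (H.lift _ _ w₁) (H'.lift _ _ w₂), ?_, ?_, ?_⟩
  · change lift _ _ ≫ (f ⊗ₘ f') = c.fst
    ext <;> simp
  · change lift _ _ ≫ (g ⊗ₘ g') = c.snd
    ext <;> simp
  · intro (m : c.pt ⟶ P ⊗ P') h₁ h₂
    replace h₁ : m ≫ (f ⊗ₘ f') = c.fst := h₁
    replace h₂ : m ≫ (g ⊗ₘ g') = c.snd := h₂
    refine CartesianMonoidalCategory.hom_ext (X := P) (Y := P') _ _ ?_ ?_
    · refine H.hom_ext ?_ ?_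
      · simp [← h₁]
      · simp [← h₂]
    · refine H'.hom_ext ?_ ?_
      · simp [← h₁]
      · simp [← h₂]

theorem mono_from_unit {X : E} (f : 𝟙_ E ⟶ X) : Mono f := ⟨fun _ _ _ => toUnit_unique _ _⟩

variable [SymmetricCategory E] [∀ X Y : M, HasColimitsOfShape (Discrete (X ⟶ Y)) E]
  [∀ (X Y : M) (A : E), PreservesColimitsOfShape (Discrete (X ⟶ Y)) (tensorLeft A)]
  {S : Option (SymmetricCategory M)}

namespace BimoduleOver

variable (hE : ∀ X Y : M, ExtensiveCoproducts (X ⟶ Y) E)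

include hE in
-- The decomposition lies over that of the coproduct of units, so the van Kampen property forces its
-- summands to be the fibres of `b`.
theorem isPullback_ι (B : BimoduleOver M E) {X Y : M} (φ : X ⟶ Y) :
    IsPullback (B.ι φ) (B.fib.ε (Arrow.mk φ)) (B.tot.b X Y)
      (Sigma.ι (fun _ : X ⟶ Y => 𝟙_ E) φ) :=
  ((hE X Y).isColimit_iff (coproductIsCoproduct _) (fun φ : X ⟶ Y => B.ι φ) (B.tot.b X Y)
    (fun φ => B.fib.ε (Arrow.mk φ)) fun φ => B.ι_b φ).1 ⟨B.isCoproduct X Y⟩ φ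

include hE in
theorem mono_ι (B : BimoduleOver M E) {X Y : M} (φ : X ⟶ Y) : Mono (B.ι φ) :=
  (B.isPullback_ι hE φ).mono_fst_of_mono (mono_from_unit _)

include hE in
-- The product of the two coproducts of units is split one variable at a time, by
-- `isPullback_of_summands`, until only a pair `(φ, ψ)` is left.
theorem isPullback_μ (B : BimoduleOver M E) (hB : ∀ f g : Arrow M, IsIso (B.fib.μ f g))
    (X Y X' Y' : M) : IsPullback (B.tot.μ X Y X' Y') (B.tot.b X Y ⊗ₘ B.tot.b X' Y')
      (B.tot.b (X ⊗ X') (Y ⊗ Y')) (copowMul E (fun (φ : X ⟶ Y) (ψ : X' ⟶ Y') => φ ⊗ₘ ψ)) := by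
  have h₁ (ψ : X' ⟶ Y') : B.tot.at' X Y ◁ B.ι ψ ≫ (B.tot.b X Y ⊗ₘ B.tot.b X' Y') =
      (B.tot.b X Y ⊗ₘ B.fib.ε (Arrow.mk ψ)) ≫ copow E (X ⟶ Y) ◁ Sigma.ι (fun _ => 𝟙_ E) ψ := by
    rw [← id_tensorHom, ← id_tensorHom, tensorHom_comp_tensorHom, tensorHom_comp_tensorHom, B.ι_b,
      Category.id_comp, Category.comp_id]
  refine (hE X' Y').isPullback_of_summands
    (isColimitWhiskerLeft (copow E (X ⟶ Y)) (coproductIsCoproduct fun _ : X' ⟶ Y' => 𝟙_ E))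
    (isColimitWhiskerLeft (B.tot.at' X Y) (B.isCoproduct X' Y')) h₁ (B.tot.b_μ X Y X' Y')
    fun ψ => ?_
  refine (hE X Y).isPullback_of_summands
    (isColimitWhiskerRight (𝟙_ E) (coproductIsCoproduct fun _ : X ⟶ Y => 𝟙_ E))
    (isColimitWhiskerRight (B.fib.D.obj ⟨Arrow.mk ψ⟩) (B.isCoproduct X Y))
    (e := fun φ => B.fib.ε (Arrow.mk φ) ⊗ₘ B.fib.ε (Arrow.mk ψ)) (fun φ => ?_) ?_
    fun φ => ?_
  · rw [← tensorHom_id, ← tensorHom_id, tensorHom_comp_tensorHom, tensorHom_comp_tensorHom, B.ι_b,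
      Category.id_comp, Category.comp_id]
  · rw [Category.assoc, B.tot.b_μ, reassoc_of% (h₁ ψ)]
  · have h₂ : B.ι φ ▷ _ ≫ B.tot.at' X Y ◁ B.ι ψ ≫ B.tot.μ X Y X' Y' =
        B.fib.μ (Arrow.mk φ) (Arrow.mk ψ) ≫ B.ι (φ ⊗ₘ ψ) := by
      rw [← B.ι_μ, MonoidalCategory.tensorHom_def, Category.assoc]
    have h₃ : Sigma.ι (fun _ : X ⟶ Y => 𝟙_ E) φ ▷ _ ≫
        copow E (X ⟶ Y) ◁ Sigma.ι (fun _ : X' ⟶ Y' => 𝟙_ E) ψ ≫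
          copowMul E (fun (φ : X ⟶ Y) (ψ : X' ⟶ Y') => φ ⊗ₘ ψ) =
        (λ_ (𝟙_ E)).hom ≫ Sigma.ι (fun _ => 𝟙_ E) (φ ⊗ₘ ψ) := by
      rw [← ι_copowMul, MonoidalCategory.tensorHom_def, Category.assoc]
    rw [h₂, h₃]
    have := hB (Arrow.mk φ) (Arrow.mk ψ)
    -- Over `(φ, ψ)`: a square whose horizontal maps `μ` and `λ` are isomorphisms, pasted with the
    -- fibre square of `φ ⊗ ψ`.
    exact (IsPullback.of_horiz_isIso ⟨B.fib.ε_μ (Arrow.mk φ) (Arrow.mk ψ)⟩).paste_horiz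
      (B.isPullback_ι hE (φ ⊗ₘ ψ))

variable {B B' : BimoduleOver M E}

include hE in
theorem hom_ext_tot {f g : B ⟶ B'} (h : Hom.tot f = Hom.tot g) : f = g := by
  refine hom_ext_fib (IndexingData.Hom.ext (funext fun φ => ?_))
  have := B'.mono_ι hE φ.hom
  exact (cancel_mono (B'.ι φ.hom)).1 ((f.w φ.hom).symm.trans
    ((congrArg (fun u => B.ι φ.hom ≫ BimoduleMonoid.Hom.app (SliceMonoid.Hom.hom u) _ _) h).trans
      (g.w φ.hom)))

theorem ι_act_iso (B : BimoduleOver M E) {X Y X' Y' : M} {φ : X ⟶ Y} {φ' : X' ⟶ Y'}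
    (e : Arrow.mk φ ≅ Arrow.mk φ') :
    B.ι φ ≫ B.tot.act (X := X) (Y := Y) (X' := X') (Y' := Y') (srcIso e) (tgtIso e) =
      B.fib.D.map (X := ⟨Arrow.mk φ⟩) (Y := ⟨Arrow.mk φ'⟩) ⟨e⟩ ≫ B.ι φ' :=
  B.ι_act φ φ' (srcIso e) (tgtIso e) e.hom.w

include hE in
-- A morphism over `Hom_M` maps fibres to fibres, as these are pull-backs.
theorem exists_lift_fib (t : B.tot ⟶ B'.tot) {X Y : M} (φ : X ⟶ Y) :
    ∃ a : B.fib.D.obj ⟨Arrow.mk φ⟩ ⟶ B'.fib.D.obj ⟨Arrow.mk φ⟩,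
      a ≫ B'.ι φ = B.ι φ ≫ BimoduleMonoid.Hom.app (SliceMonoid.Hom.hom t) X Y :=
  ⟨(B'.isPullback_ι hE φ).lift (B.ι φ ≫ BimoduleMonoid.Hom.app (SliceMonoid.Hom.hom t) X Y)
    (B.fib.ε _) (by rw [Category.assoc, t.w, B.ι_b]), IsPullback.lift_fst _ _ _ _⟩

include hE in
theorem exists_hom_tot (t : B.tot ⟶ B'.tot) : ∃ f : B ⟶ B', Hom.tot f = t := by
  -- The equation `ha` suffices: the inclusions into `B'` are monomorphisms, so each compatibility
  -- of `a` follows from that of `t`.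
  choose a ha using @exists_lift_fib _ _ _ _ _ _ _ _ _ hE B B' t
  have hmono {X Y : M} (φ : X ⟶ Y) : Mono (B'.ι φ) := B'.mono_ι hE φ
  have nat {X Y X' Y' : M} (φ : X ⟶ Y) (φ' : X' ⟶ Y') (e : Arrow.mk φ ≅ Arrow.mk φ') :
      B.fib.D.map (X := ⟨Arrow.mk φ⟩) (Y := ⟨Arrow.mk φ'⟩) ⟨e⟩ ≫ a φ' =
        a φ ≫ B'.fib.D.map (X := ⟨Arrow.mk φ⟩) (Y := ⟨Arrow.mk φ'⟩) ⟨e⟩ := by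
    rw [← cancel_mono (B'.ι φ'), Category.assoc, Category.assoc, ha, ← B'.ι_act_iso,
      reassoc_of% (ha φ), ← reassoc_of% (B.ι_act_iso e), t.hom.nat]
  have γ {X Y Z : M} (f : X ⟶ Y) (g : Y ⟶ Z) :
      B.fib.γ f g ≫ a (f ≫ g) = (a g ⊗ₘ a f) ≫ B'.fib.γ f g := by
    rw [← cancel_mono (B'.ι (f ≫ g)), Category.assoc, Category.assoc, ← B'.ι_γ,
      tensorHom_comp_tensorHom_assoc, ha, ha, ha, ← tensorHom_comp_tensorHom_assoc,
      ← reassoc_of% (B.ι_γ f g), t.hom.γ]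
  have μ {X Y X' Y' : M} (f : X ⟶ Y) (g : X' ⟶ Y') :
      B.fib.μ (Arrow.mk f) (Arrow.mk g) ≫ a (f ⊗ₘ g) =
        (a f ⊗ₘ a g) ≫ B'.fib.μ (Arrow.mk f) (Arrow.mk g) := by
    refine (cancel_mono (B'.ι (f ⊗ₘ g))).1 ?_
    refine Eq.trans ?_ ((congrArg (_ ≫ ·) (B'.ι_μ f g)).trans (Category.assoc _ _ _).symm)
    rw [Category.assoc, ha, tensorHom_comp_tensorHom_assoc, ha, ha,
      ← tensorHom_comp_tensorHom_assoc, ← t.hom.μ, reassoc_of% (B.ι_μ f g)]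
  exact ⟨⟨t, ⟨fun f => a f.hom, fun {f g} e => nat f.hom g.hom e, γ, fun f g => μ f.hom g.hom,
    fun f => toUnit_unique _ _⟩, fun φ => (ha φ).symm⟩, rfl⟩

end BimoduleOver

end Cartesian

section Decomposition

open CartesianMonoidalCategory

variable {M : Type u₁} [Category.{v₁} M] [MonoidalCategory M]
  {E : Type u₂} [Category.{v₂} E] [CartesianMonoidalCategory E]
  [SymmetricCategory E] [∀ X Y : M, HasColimitsOfShape (Discrete (X ⟶ Y)) E]
  [∀ (X Y : M) (A : E), PreservesColimitsOfShape (Discrete (X ⟶ Y)) (tensorLeft A)]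
  {S : Option (SymmetricCategory M)}

/-! ## The fibres of a bimodule monoid in the slice over `Hom_M` -/

namespace SliceMonoid

variable (hE : ∀ X Y : M, ExtensiveCoproducts (X ⟶ Y) E) (B : SliceMonoid M E)

/-- The fibre over `φ`. -/
noncomputable def fibre {X Y : M} (φ : X ⟶ Y) : E :=
  haveI := (hE X Y).hasPullback (fun _ => 𝟙_ E) φ (B.b X Y)
  pullback (B.b X Y) (Sigma.ι (fun _ : X ⟶ Y => 𝟙_ E) φ)

/-- The inclusion of the fibre over `φ`. -/
noncomputable def fibreι {X Y : M} (φ : X ⟶ Y) : B.fibre hE φ ⟶ B.at' X Y :=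
  haveI := (hE X Y).hasPullback (fun _ => 𝟙_ E) φ (B.b X Y)
  pullback.fst (B.b X Y) (Sigma.ι (fun _ : X ⟶ Y => 𝟙_ E) φ)

theorem isPullback_fibre {X Y : M} (φ : X ⟶ Y) :
    IsPullback (B.fibreι hE φ) (toUnit _) (B.b X Y) (Sigma.ι (fun _ : X ⟶ Y => 𝟙_ E) φ) := by
  have := (hE X Y).hasPullback (fun _ => 𝟙_ E) φ (B.b X Y)
  have h := IsPullback.of_hasPullback (B.b X Y) (Sigma.ι (fun _ : X ⟶ Y => 𝟙_ E) φ)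
  rwa [toUnit_unique (pullback.snd (B.b X Y) (Sigma.ι (fun _ : X ⟶ Y => 𝟙_ E) φ))
    (toUnit _)] at h

theorem fibreι_b {X Y : M} (φ : X ⟶ Y) :
    B.fibreι hE φ ≫ B.b X Y = toUnit _ ≫ Sigma.ι (fun _ : X ⟶ Y => 𝟙_ E) φ :=
  (B.isPullback_fibre hE φ).w

instance {X Y : M} (φ : X ⟶ Y) : Mono (B.fibreι hE φ) :=
  (B.isPullback_fibre hE φ).mono_fst_of_mono (mono_from_unit _)

/-- The action of a commutative square of isomorphisms on the fibres. -/
noncomputable def fibreAct {X Y X' Y' : M} {φ : X ⟶ Y} {φ' : X' ⟶ Y'} (σ : X ≅ X') (τ : Y ≅ Y')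
    (h : σ.hom ≫ φ' = φ ≫ τ.hom) : B.fibre hE φ ⟶ B.fibre hE φ' :=
  (B.isPullback_fibre hE φ').lift (B.fibreι hE φ ≫ B.act σ τ) (toUnit _) (by
    rw [Category.assoc, B.b_nat, reassoc_of% (B.fibreι_b hE φ), ι_copowMap, ← h,
      Iso.inv_hom_id_assoc])

theorem fibreAct_ι {X Y X' Y' : M} {φ : X ⟶ Y} {φ' : X' ⟶ Y'} (σ : X ≅ X') (τ : Y ≅ Y')
    (h : σ.hom ≫ φ' = φ ≫ τ.hom) :
    B.fibreAct hE σ τ h ≫ B.fibreι hE φ' = B.fibreι hE φ ≫ B.act σ τ :=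
  IsPullback.lift_fst _ _ _ _

/-- The multiplication of fibres. -/
noncomputable def fibreγ {X Y Z : M} (f : X ⟶ Y) (g : Y ⟶ Z) :
    B.fibre hE g ⊗ B.fibre hE f ⟶ B.fibre hE (f ≫ g) :=
  (B.isPullback_fibre hE (f ≫ g)).lift ((B.fibreι hE g ⊗ₘ B.fibreι hE f) ≫ B.γ X Y Z) (toUnit _) (by
    -- Since `b` is multiplicative, the product of the fibres over `g` and `f` lands over `f ≫ g`.
    rw [Category.assoc, B.b_γ, tensorHom_comp_tensorHom_assoc, B.fibreι_b hE, B.fibreι_b hE,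
      ← tensorHom_comp_tensorHom_assoc, ι_copowMul, ← Category.assoc]
    exact congrArg (· ≫ _) (toUnit_unique _ _))

theorem fibreγ_ι {X Y Z : M} (f : X ⟶ Y) (g : Y ⟶ Z) :
    B.fibreγ hE f g ≫ B.fibreι hE (f ≫ g) = (B.fibreι hE g ⊗ₘ B.fibreι hE f) ≫ B.γ X Y Z :=
  IsPullback.lift_fst _ _ _ _

/-- The product of fibres over `⊗`. -/
noncomputable def fibreμ {X Y X' Y' : M} (f : X ⟶ Y) (g : X' ⟶ Y') :
    B.fibre hE f ⊗ B.fibre hE g ⟶ B.fibre hE (f ⊗ₘ g) :=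
  (B.isPullback_fibre hE (f ⊗ₘ g)).lift ((B.fibreι hE f ⊗ₘ B.fibreι hE g) ≫ B.μ X Y X' Y')
    (toUnit _) (by
      rw [Category.assoc, B.b_μ, tensorHom_comp_tensorHom_assoc, B.fibreι_b hE, B.fibreι_b hE,
        ← tensorHom_comp_tensorHom_assoc, ι_copowMul, ← Category.assoc]
      exact congrArg (· ≫ _) (toUnit_unique _ _))

theorem fibreμ_ι {X Y X' Y' : M} (f : X ⟶ Y) (g : X' ⟶ Y') :
    B.fibreμ hE f g ≫ B.fibreι hE (f ⊗ₘ g) =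
      (B.fibreι hE f ⊗ₘ B.fibreι hE g) ≫ B.μ X Y X' Y' :=
  IsPullback.lift_fst _ _ _ _

theorem act_refl (X Y : M) : B.act (Iso.refl X) (Iso.refl Y) = 𝟙 (B.at' X Y) :=
  B.ρ.map_id _

theorem act_act {X Y X' Y' X'' Y'' : M} (σ : X ≅ X') (τ : Y ≅ Y') (σ' : X' ≅ X'') (τ' : Y' ≅ Y'') :
    B.act σ τ ≫ B.act σ' τ' = B.act (σ ≪≫ σ') (τ ≪≫ τ') :=
  (B.ρ.map_comp _ _).symm

/-- This and the next laws hold because the inclusions of fibres are monomorphisms: after composing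
with them, each becomes a law of `B`. -/
theorem fibreAct_refl {X Y : M} (φ : X ⟶ Y) :
    B.fibreAct hE (φ := φ) (φ' := φ) (Iso.refl X) (Iso.refl Y) (by simp) = 𝟙 _ := by
  rw [← cancel_mono (B.fibreι hE φ), fibreAct_ι, act_refl, Category.comp_id, Category.id_comp]

theorem fibreAct_comp {X Y X' Y' X'' Y'' : M} {φ : X ⟶ Y} {φ' : X' ⟶ Y'} {φ'' : X'' ⟶ Y''}
    (σ : X ≅ X') (τ : Y ≅ Y') (σ' : X' ≅ X'') (τ' : Y' ≅ Y'')
    (h : σ.hom ≫ φ' = φ ≫ τ.hom) (h' : σ'.hom ≫ φ'' = φ' ≫ τ'.hom) :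
    B.fibreAct hE σ τ h ≫ B.fibreAct hE σ' τ' h' =
      B.fibreAct hE (σ ≪≫ σ') (τ ≪≫ τ') (by
        rw [Iso.trans_hom, Category.assoc, h', reassoc_of% h, Iso.trans_hom]) := by
  rw [← cancel_mono (B.fibreι hE φ''), Category.assoc, fibreAct_ι, reassoc_of% (B.fibreAct_ι hE), fibreAct_ι,
    act_act]

theorem fibreγ_equiv {X Y Z X' Y' Z' : M} (f : X ⟶ Y) (g : Y ⟶ Z) (f' : X' ⟶ Y') (g' : Y' ⟶ Z')
    (σ : X ≅ X') (τ : Y ≅ Y') (υ : Z ≅ Z')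
    (hf : σ.hom ≫ f' = f ≫ τ.hom) (hg : τ.hom ≫ g' = g ≫ υ.hom) :
    (B.fibreAct hE τ υ hg ⊗ₘ B.fibreAct hE σ τ hf) ≫ B.fibreγ hE f' g' =
      B.fibreγ hE f g ≫ B.fibreAct hE σ υ (by rw [reassoc_of% hf, hg, Category.assoc]) := by
  rw [← cancel_mono (B.fibreι hE (f' ≫ g')), Category.assoc, Category.assoc, fibreγ_ι, fibreAct_ι,
    reassoc_of% (B.fibreγ_ι hE), tensorHom_comp_tensorHom_assoc, fibreAct_ι, fibreAct_ι,
    ← tensorHom_comp_tensorHom_assoc, B.γ_nat]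

theorem fibreγ_assoc {X Y Z W : M} (f : X ⟶ Y) (g : Y ⟶ Z) (h : Z ⟶ W) :
    B.fibreγ hE g h ▷ B.fibre hE f ≫ B.fibreγ hE f (g ≫ h) =
      (α_ _ _ _).hom ≫ B.fibre hE h ◁ B.fibreγ hE f g ≫ B.fibreγ hE (f ≫ g) h ≫
        B.fibreAct hE (Iso.refl X) (Iso.refl W) (by simp) := by
  rw [← cancel_mono (B.fibreι hE (f ≫ g ≫ h))]
  simp only [Category.assoc]
  rw [fibreγ_ι, fibreAct_ι, act_refl, Category.comp_id, fibreγ_ι, ← tensorHom_id, ← id_tensorHom,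
    tensorHom_comp_tensorHom_assoc, tensorHom_comp_tensorHom_assoc, fibreγ_ι, fibreγ_ι,
    Category.id_comp, Category.id_comp, ← Category.comp_id (B.fibreι hE f),
    ← tensorHom_comp_tensorHom_assoc, tensorHom_id, B.γ_assoc, associator_naturality_assoc,
    ← id_tensorHom, tensorHom_comp_tensorHom_assoc, Category.comp_id, Category.comp_id]

theorem fibreμ_equiv {X₁ Y₁ X₂ Y₂ X₁' Y₁' X₂' Y₂' : M} (f : X₁ ⟶ Y₁) (f' : X₁' ⟶ Y₁')
    (g : X₂ ⟶ Y₂) (g' : X₂' ⟶ Y₂') (σ : X₁ ≅ X₁') (τ : Y₁ ≅ Y₁') (σ' : X₂ ≅ X₂') (τ' : Y₂ ≅ Y₂')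
    (hf : σ.hom ≫ f' = f ≫ τ.hom) (hg : σ'.hom ≫ g' = g ≫ τ'.hom) :
    (B.fibreAct hE σ τ hf ⊗ₘ B.fibreAct hE σ' τ' hg) ≫ B.fibreμ hE f' g' =
      B.fibreμ hE f g ≫ B.fibreAct hE (σ ⊗ᵢ σ') (τ ⊗ᵢ τ') (by
        rw [tensorIso_hom, tensorIso_hom, tensorHom_comp_tensorHom, tensorHom_comp_tensorHom, hf,
          hg]) := by
  rw [← cancel_mono (B.fibreι hE (f' ⊗ₘ g')), Category.assoc, Category.assoc, fibreμ_ι, fibreAct_ι,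
    reassoc_of% (B.fibreμ_ι hE), tensorHom_comp_tensorHom_assoc, fibreAct_ι, fibreAct_ι,
    ← tensorHom_comp_tensorHom_assoc, B.μ_nat]

theorem fibreμ_assoc {X₁ Y₁ X₂ Y₂ X₃ Y₃ : M} (f : X₁ ⟶ Y₁) (g : X₂ ⟶ Y₂) (h : X₃ ⟶ Y₃) :
    B.fibreμ hE f g ▷ B.fibre hE h ≫ B.fibreμ hE (f ⊗ₘ g) h ≫
        B.fibreAct hE (α_ X₁ X₂ X₃) (α_ Y₁ Y₂ Y₃) (by simp) =
      (α_ _ _ _).hom ≫ B.fibre hE f ◁ B.fibreμ hE g h ≫ B.fibreμ hE f (g ⊗ₘ h) := by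
  rw [← cancel_mono (B.fibreι hE (f ⊗ₘ g ⊗ₘ h))]
  simp only [Category.assoc]
  rw [fibreμ_ι, fibreAct_ι, reassoc_of% (B.fibreμ_ι hE), ← tensorHom_id, ← id_tensorHom,
    tensorHom_comp_tensorHom_assoc, tensorHom_comp_tensorHom_assoc, fibreμ_ι, fibreμ_ι,
    Category.id_comp, Category.id_comp, ← Category.comp_id (B.fibreι hE h),
    ← tensorHom_comp_tensorHom_assoc, tensorHom_id, B.μ_assoc, associator_naturality_assoc,
    ← id_tensorHom, tensorHom_comp_tensorHom_assoc, Category.comp_id, Category.comp_id]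

theorem fibre_interchange {X Y Z X' Y' Z' : M}
    (f : X ⟶ Y) (g : Y ⟶ Z) (f' : X' ⟶ Y') (g' : Y' ⟶ Z') :
    tensorμ (B.fibre hE g) (B.fibre hE g') (B.fibre hE f) (B.fibre hE f') ≫
        (B.fibreγ hE f g ⊗ₘ B.fibreγ hE f' g') ≫ B.fibreμ hE (f ≫ g) (f' ≫ g') ≫
          B.fibreAct hE (Iso.refl _) (Iso.refl _) (by simp) =
      (B.fibreμ hE g g' ⊗ₘ B.fibreμ hE f f') ≫ B.fibreγ hE (f ⊗ₘ f') (g ⊗ₘ g') := by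
  rw [← cancel_mono (B.fibreι hE ((f ⊗ₘ f') ≫ (g ⊗ₘ g')))]
  simp only [Category.assoc]
  rw [fibreγ_ι, fibreAct_ι, act_refl, Category.comp_id, fibreμ_ι, tensorHom_comp_tensorHom_assoc,
    tensorHom_comp_tensorHom_assoc, fibreγ_ι, fibreγ_ι, fibreμ_ι, fibreμ_ι,
    ← tensorHom_comp_tensorHom_assoc, ← tensorHom_comp_tensorHom_assoc, ← B.interchange,
    tensorμ_natural_assoc]

/-- The fibres of a bimodule monoid in the slice over `Hom_M` as indexing data. -/
noncomputable def fibreData : IndexingData M E where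
  D :=
    { obj f := B.fibre hE f.of.hom
      map e := B.fibreAct hE (srcIso e.iso) (tgtIso e.iso) e.iso.hom.w
      map_id f := B.fibreAct_refl hE f.of.hom
      map_comp e e' := (B.fibreAct_comp hE (srcIso e.iso) (tgtIso e.iso) (srcIso e'.iso)
        (tgtIso e'.iso) e.iso.hom.w e'.iso.hom.w).symm }
  γ f g := B.fibreγ hE f g
  γ_equiv := B.fibreγ_equiv hE
  γ_assoc := B.fibreγ_assoc hE
  μ f g := B.fibreμ hE f.hom g.hom
  μ_equiv {f f' g g'} e e' := B.fibreμ_equiv hE f.hom f'.hom g.hom g'.hom (srcIso e) (tgtIso e)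
    (srcIso e') (tgtIso e') e.hom.w e'.hom.w
  μ_assoc f g h := B.fibreμ_assoc hE f.hom g.hom h.hom
  interchange := B.fibre_interchange hE
  ε _ := toUnit _
  ε_act _ := toUnit_unique _ _
  ε_γ _ _ := toUnit_unique _ _
  ε_μ _ _ := toUnit_unique _ _

/-- The decomposition of a bimodule monoid in the slice over `Hom_M` into its fibres. -/
noncomputable def decompose : BimoduleOver M E where
  tot := B
  fib := B.fibreData hE
  ι φ := B.fibreι hE φ
  -- The van Kampen property in the other direction: the squares are pull-backs, so the fibres sum
  -- to `B`.
  isCoproduct X Y := (((hE X Y).isColimit_iff (coproductIsCoproduct _) _ (B.b X Y) _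
    fun φ => B.fibreι_b hE φ).2 (B.isPullback_fibre hE)).some
  ι_act _ _ σ τ h := (B.fibreAct_ι hE σ τ h).symm
  ι_γ f g := (B.fibreγ_ι hE f g).symm
  ι_μ f g := (B.fibreμ_ι hE f g).symm
  ι_b := B.fibreι_b hE

/-- The product of two fibre squares, pasted with the strength square, is a pull-back of `b` along
`𝟙 ⊗ 𝟙 ≅ 𝟙` followed by the inclusion at `f ⊗ g`. Cancelling the fibre square over `f ⊗ g` makes
`fibreμ` a base change of the isomorphism `λ`. -/
theorem isIso_fibreμ (hB : SliceMonoid.isStrong S B) {X Y X' Y' : M} (f : X ⟶ Y) (g : X' ⟶ Y') :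
    IsIso (B.fibreμ hE f g) := by
  have h := (isPullback_tensorHom (B.isPullback_fibre hE f) (B.isPullback_fibre hE g)).paste_horiz
    (hB.1 X Y X' Y')
  rw [ι_copowMul, ← fibreμ_ι] at h
  exact (h.of_right (toUnit_unique _ _) (B.isPullback_fibre hE (f ⊗ₘ g))).isIso_fst_of_isIso

theorem fibreμ_braiding (s : SymmetricCategory M)
    (hs : ∀ X Y X' Y' : M, B.μ X Y X' Y' ≫ B.act (s.braiding X X') (s.braiding Y Y') =
      (β_ _ _).hom ≫ B.μ X' Y' X Y) {X Y X' Y' : M} (f : X ⟶ Y) (g : X' ⟶ Y') :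
    B.fibreμ hE f g ≫ B.fibreAct hE (φ' := g ⊗ₘ f) (s.braiding X X') (s.braiding Y Y')
        (by simp) = (β_ (B.fibre hE f) (B.fibre hE g)).hom ≫ B.fibreμ hE g f := by
  rw [← cancel_mono (B.fibreι hE (g ⊗ₘ f)), Category.assoc, Category.assoc, fibreAct_ι,
    fibreμ_ι, reassoc_of% (B.fibreμ_ι hE), hs, BraidedCategory.braiding_naturality_assoc]

theorem decompose_isStrong (hB : SliceMonoid.isStrong S B) :
    BimoduleOver.isStrong S (B.decompose hE) :=
  ⟨fun f g => B.isIso_fibreμ hE hB f.hom g.hom, fun s hs f g =>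
    B.fibreμ_braiding hE s (hB.2 s hs) f.hom g.hom, hB.2⟩

end SliceMonoid

/-! ## Extensive coproducts: the decomposition is a property -/

variable (hE : ∀ X Y : M, ExtensiveCoproducts (X ⟶ Y) E)

variable (S) in
/-- The functor that forgets the decomposition, on strong bimodule monoids. -/
def strongToSlice : StrongBimoduleOver M E S ⥤ StrongSliceMonoid M E S where
  obj B := ⟨B.obj.tot, B.obj.isPullback_μ hE B.property.1, B.property.2.2⟩
  map f := ObjectProperty.homMk (BimoduleOver.Hom.tot f.hom)
  map_id _ := rfl
  map_comp _ _ := rfl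

instance : (strongToSlice S hE).Faithful where
  map_injective h := ObjectProperty.hom_ext _
    (BimoduleOver.hom_ext_tot hE (congrArg InducedCategory.Hom.hom h))

instance : (strongToSlice S hE).Full where
  map_surjective t := by
    obtain ⟨f, hf⟩ := BimoduleOver.exists_hom_tot hE t.hom
    exact ⟨ObjectProperty.homMk f, ObjectProperty.hom_ext _ hf⟩

/-- Decomposing does not change the total object, so the required isomorphism is the identity. -/
instance : (strongToSlice S hE).EssSurj where
  mem_essImage B := ⟨⟨B.obj.decompose hE, B.obj.decompose_isStrong hE B.property⟩,
    ⟨ObjectProperty.isoMk _ (Iso.refl B.obj)⟩⟩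

instance : (strongToSlice S hE).IsEquivalence where

variable (S) in
/-- If the coproducts are extensive, functors on `M^{loc+}` are equivalent to strong bimodule
monoids in the slice over `Hom_M`. -/
noncomputable def sliceEquivalence : StrongFunctor (LocPlus S) E ≌ StrongSliceMonoid M E S :=
  (cartesianEquivalence M E S).trans (strongToSlice S hE).asEquivalence

end Decomposition

end PlusConstruction

open PlusConstruction in
theorem theorem3p6 (M : Type u₁) [Category.{v₁} M] [MonoidalCategory M]
    (S : Option (SymmetricCategory M)) :
    (∀ (E : Type u₂) [Category.{v₂} E] [MonoidalCategory E] [SymmetricCategory E]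
      [∀ X Y : M, HasColimitsOfShape (Discrete (X ⟶ Y)) E]
      [∀ (X Y : M) (A : E), PreservesColimitsOfShape (Discrete (X ⟶ Y)) (tensorLeft A)],
      ∃ e : CounitalFunctor (LocPlus S) E ≌ StrongBimoduleOver M E S,
        (∃ c : FibreComparison (Over.forget (trivialFunctor (LocPlus S) E))
            (e.functor ⋙ (BimoduleOver.isStrong S).ι),
          ∀ (F : CounitalFunctor (LocPlus S) E) (f : Arrow M),
            (c.κ F f).hom ≫ (e.functor.obj F).obj.fib.ε f = counit F f) ∧
        ∀ F : CounitalFunctor (LocPlus S) E,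
          IsSplitFunctor F.left ↔ (e.functor.obj F).obj.IsIsoSplit) ∧
    (∀ (E : Type u₂) [Category.{v₂} E] [CartesianMonoidalCategory E] [SymmetricCategory E]
      [∀ X Y : M, HasColimitsOfShape (Discrete (X ⟶ Y)) E]
      [∀ (X Y : M) (A : E), PreservesColimitsOfShape (Discrete (X ⟶ Y)) (tensorLeft A)],
      ∃ e : StrongFunctor (LocPlus S) E ≌ StrongBimoduleOver M E S,
        Nonempty (FibreComparison (𝟭 _) (e.functor ⋙ (BimoduleOver.isStrong S).ι)) ∧
        ((∀ X Y : M, ExtensiveCoproducts (X ⟶ Y) E) →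
          ∃ e' : StrongFunctor (LocPlus S) E ≌ StrongSliceMonoid M E S,
            Nonempty (e'.functor ⋙ (SliceMonoid.isStrong S).ι ≅
              e.functor ⋙ (BimoduleOver.isStrong S).ι ⋙ BimoduleOver.toSlice))) := by
  refine ⟨fun E _ _ _ _ _ => ⟨counitalEquivalence M E S,
    -- The counits agree up to composition with an identity. Both splitting conditions concern the
    -- same fibrewise multiplication, hence `Iff.rfl`.
    ⟨counitalComparison M E S, fun _ _ => Category.id_comp _⟩, fun _ => Iff.rfl⟩,
    fun E _ _ _ _ _ => ⟨cartesianEquivalence M E S, ⟨cartesianComparison M E S⟩,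
      -- The second equivalence is the first one followed by forgetting the decomposition, so
      -- compatibility holds by definition.
      fun hE => ⟨sliceEquivalence S hE, ⟨Iso.refl _⟩⟩⟩⟩
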